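/- For coprime integers $a,b$ let $T_{a,b}\subset S^3=\{(z,w)\in\mathbb{C}^2 : |z|^2+|w|^2=1\}$ be the torus knot, i.e. the image of $\theta\mapsto \frac{1}{\sqrt2}(e^{ia\theta},e^{ib\theta})$, and let $X=S^3\setminus T_{a,b}$ be its exterior. For a prime number $p$, a $\mathbb{Z}/p^n\mathbb{Z}$-cover of $X$ is a connected covering space of $X$ with an action of $\mathbb{Z}/p^n\mathbb{Z}$ by homeomorphisms that is simply transitive on every fibre, and a $\mathbb{Z}_p$-cover of $X$ is a system $(X_{p^n}\to X)_{n\ge 0}$ of $\mathbb{Z}/p^n\mathbb{Z}$-covers with continuous maps $X_{p^{n+1}}\to X_{p^n}$ over $X$ that are equivariant with respect to the reduction $\mathbb{Z}/p^{n+1}\mathbb{Z}\to\mathbb{Z}/p^n\mathbb{Z}$. Let $p$ be a prime number and let $a,b$ be coprime integers with $p\nmid b$; write $a=p^r a'$ with $r\in\mathbb{Z}_{\ge 0}$, $a'\in\mathbb{Z}$, $p\nmid a'$. Then $X$ has a $\mathbb{Z}_p$-cover, and for every $\mathbb{Z}_p$-cover $(X_{p^n}\to X)_n$ of $X$ the torsion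 subgroup $H_1(X_{p^n})_{\rm tor}$ of the first integral singular homology group of $X_{p^n}$ satisfies \[ |H_1(X_{p^n})_{\rm tor}| = |b|^{\,p^{\min\{n,r\}}-1}\qquad\text{for all } n\ge 0, \] and hence \[ \lim_{n\to\infty}|H_1(X_{p^n})_{\rm tor}| = |b|^{\,p^r-1}\quad\text{in } \mathbb{Z}_p . \] Here $|b|$ is the ordinary absolute value of the integer $b$. -/

import Mathlib

open scoped Topology

noncomputable section

/-- The unit sphere in `ℂ²`. -/
abbrev ThreeSphere : Type := Metric.sphere (0 : EuclideanSpace ℂ (Fin 2)) 1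

/-- The torus knot `T_{a,b}` (for coprime `a`, `b`): the image of the curve
`θ ↦ (e^{iaθ}, e^{ibθ}) / √2` on the Clifford torus in the 3-sphere. -/
def torusKnot (a b : ℤ) : Set ThreeSphere :=
  {x | ∃ θ : ℝ,
    x.1 0 = Complex.exp (a * θ * Complex.I) / (Real.sqrt 2 : ℂ) ∧
    x.1 1 = Complex.exp (b * θ * Complex.I) / (Real.sqrt 2 : ℂ)}

/-- The exterior `S³ - T_{a,b}`, with the subspace topology. -/
abbrev TorusKnotExterior (a b : ℤ) : Type := ↥(torusKnot a b)ᶜ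

/-- A `ℤ/m`-cover of `X`: a connected covering space of `X` with an action of `ℤ/m` by
homeomorphisms that is simply transitive on every fibre. As the total space is connected, the
action identifies `ℤ/m` with the group of deck transformations. -/
structure CyclicCover (m : ℕ) (X : Type) [TopologicalSpace X] where
  space : Type
  [topologicalSpace : TopologicalSpace space]
  [connectedSpace : ConnectedSpace space]
  [addAction : AddAction (ZMod m) space]
  proj : space → X
  isCoveringMap : IsCoveringMap proj
  surjective : Function.Surjective proj
  continuous_vadd : ∀ g : ZMod m, Continuous fun x : space => g +ᵥ x
  proj_eq_iff : ∀ x y : space, proj x = proj y ↔ ∃ g : ZMod m, g +ᵥ x = y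
  free : ∀ (g : ZMod m) (x : space), g +ᵥ x = x → g = 0

attribute [instance] CyclicCover.topologicalSpace CyclicCover.connectedSpace
  CyclicCover.addAction

/-- A `ℤ_p`-cover of `X`: a compatible system of `ℤ/pⁿ`-covers, that is, maps over `X` from each
layer to the one below, equivariant along the reduction `ℤ/pⁿ⁺¹ → ℤ/pⁿ`. -/
structure ZpCover (p : ℕ) (X : Type) [TopologicalSpace X] where
  layer : ∀ n : ℕ, CyclicCover (p ^ n) X
  trans : ∀ n : ℕ, (layer (n + 1)).space → (layer n).space
  continuous_trans : ∀ n, Continuous (trans n)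
  proj_trans : ∀ n x, (layer n).proj (trans n x) = (layer (n + 1)).proj x
  trans_vadd : ∀ (n : ℕ) (g : ZMod (p ^ (n + 1))) (x : (layer (n + 1)).space),
    trans n (g +ᵥ x) =
      ZMod.castHom (pow_dvd_pow p n.le_succ) (ZMod (p ^ n)) g +ᵥ trans n x

/-- The first singular homology group of `X` with integral coefficients. -/
abbrev H₁ (X : Type) [TopologicalSpace X] : AddCommGrpCat.{0} :=
  ((AlgebraicTopology.singularHomologyFunctor AddCommGrpCat.{0} 1).obj
    (AddCommGrpCat.of ℤ)).obj (TopCat.of X)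

/-- The order `|H₁(X)_tor|` of the torsion subgroup of the first homology group (the value is `0`
if that subgroup is infinite). -/
def cardTorsionH₁ (X : Type) [TopologicalSpace X] : ℕ :=
  Nat.card (AddCommGroup.torsion (H₁ X))

end

/-! Replace `a`, `b` by their absolute values and rescale the sphere, so that the knot is `w ^ a = z
^ b`. The group of the exterior is generated by loops `x`, `y` along the cores `w = 0` and `z = 0`,
with `x ^ a = y ^ b` (`closure_genX_genY`, `genX_pow`). Generation and this one relation suffice; no
presentation is needed. The winding number of `w ^ a - z ^ b` is a homomorphism to `ℤ` with `x ↦ b`,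
`y ↦ a`.

A `ℤ/pⁿ`-cover gives a surjection `φ` of the group onto `ℤ/pⁿ`, and by Hurewicz the `H₁` of the
cover is the abelianization of `φ.ker` (`exists_hom_card_torsion`). As `p ∤ b`, `φ` is a unit
multiple of the winding number modulo `m = pⁿ`, so its kernel `K` is the same for every cover
(`ker_eq_divKer`).

Let `N = gcd(a, m) = p ^ min n r`. With powers of `x` as coset representatives, the abelianization
of `K` is spanned by the class `ξ` of `x ^ m` and by classes `η i` of `x ^ i * y * x ^ (-k - i)`
depending only on `i` modulo `N`. They satisfy `b • η i = e • ξ`, where `a - k * b = m * e` and `e`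
is prime to `b`. The torsion is then spanned by the `N - 1` differences `η i - η 0`, each killed by
`b`, hence has order at most `b ^ (N - 1)`.

Equality needs characters to `ℤ/b` separating the `η i`, and these come from geometry. With `a = N *
c`, on the cover `u ^ N = w ^ a - z ^ b` the function `z ^ b = (w ^ c) ^ N - u ^ N` has the factor
`w ^ c - u`, which has no common zero with its cofactor. Adjoining `b`-th roots `v`, `s` of the two
factors with `v * s = z` therefore gives an unbranched `ℤ/b`-cover (`TwistCover`). The core `z = 0`
has `N` branches `u = ζ * w ^ c` with `ζ ^ N = 1`, and the monodromy of `y` differs on the branch `u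
= w ^ c` from that on the others by `a`, a unit modulo `b` (`exists_monodromy_genY`,
`exists_twistHom`). Existence of a `ℤ_p`-cover follows from the covers of `pⁿ`-th roots of the
defining equation. -/

noncomputable section

open CategoryTheory Simplicial AlgebraicTopology

/-! ### The degree-one Hurewicz theorem: paths as chains modulo boundaries. -/

namespace Hurewicz

variable {Y : Type} [TopologicalSpace Y]

/-- The singular simplex of `Y` given by a continuous map. -/
def simplex {n : ℕ} (τ : C(stdSimplex ℝ (Fin (n + 1)), Y)) :
    (TopCat.toSSet.obj (TopCat.of Y)) _⦋n⦌ :=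
  (TopCat.toSSetObjEquiv (TopCat.of Y) (.op ⦋n⦌)).symm τ

/-- The inclusion of a face of the standard simplex. -/
def face {n : ℕ} (i : Fin (n + 2)) :
    C(stdSimplex ℝ (Fin (n + 1)), stdSimplex ℝ (Fin (n + 2))) :=
  ⟨stdSimplex.map i.succAbove, stdSimplex.continuous_map _⟩

lemma δ_simplex {n : ℕ} (τ : C(stdSimplex ℝ (Fin (n + 2)), Y)) (i : Fin (n + 2)) :
    (TopCat.toSSet.obj (TopCat.of Y)).δ i (simplex τ) = simplex (τ.comp (face i)) := by
  rfl

lemma simplex_surjective {n : ℕ} (σ : (TopCat.toSSet.obj (TopCat.of Y)) _⦋n⦌) :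
    ∃ τ : C(stdSimplex ℝ (Fin (n + 1)), Y), simplex τ = σ :=
  ⟨TopCat.toSSetObjEquiv (TopCat.of Y) (.op ⦋n⦌) σ, Equiv.symm_apply_apply _ _⟩

variable (Y) in
/-- The singular chain complex. -/
abbrev chains : ChainComplex AddCommGrpCat.{0} ℕ :=
  (TopCat.toSSet.obj (TopCat.of Y)).chainComplex (AddCommGrpCat.of ℤ)

variable (Y) in
/-- One-chains modulo boundaries. -/
abbrev opc : AddCommGrpCat.{0} := (chains Y).opcycles 1

/-- The generator of the chain group attached to a simplex. -/
def gen {n : ℕ} (τ : C(stdSimplex ℝ (Fin (n + 1)), Y)) : (chains Y).X n :=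
  (SSet.ιChainComplex (R := AddCommGrpCat.of ℤ) _ (simplex τ)).hom (1 : ℤ)

lemma d_gen {n : ℕ} (τ : C(stdSimplex ℝ (Fin (n + 2)), Y)) :
    ((chains Y).d (n + 1) n).hom (gen τ) = ∑ i : Fin (n + 2),
        (-1 : ℤ) ^ i.val • gen (τ.comp (face i)) := by
  have := congr($(SSet.ιChainComplex_d (R := AddCommGrpCat.of ℤ) (TopCat.toSSet.obj (TopCat.of Y))
      (simplex τ)).hom (1:ℤ))
  rw [gen]
  refine this.trans ?_
  change AddCommGrpCat.homAddEquiv _ _ = _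
  rw [map_sum, AddMonoidHom.finsetSum_apply]
  refine Finset.sum_congr rfl fun i _ => ?_
  rw [map_zsmul, AddMonoidHom.zsmul_apply, δ_simplex]
  rfl

lemma hom_ext_gen {n : ℕ} {T : AddCommGrpCat.{0}} {f g : (chains Y).X n ⟶ T}
    (h : ∀ τ, f.hom (gen τ) = g.hom (gen τ)) : f = g := by
  refine SSet.chainComplex_hom_ext fun σ => ?_
  obtain ⟨τ, rfl⟩ := simplex_surjective σ
  ext
  exact h τ

lemma exists_hom {n : ℕ} {T : AddCommGrpCat.{0}} (φ : C(stdSimplex ℝ (Fin (n + 1)), Y) → T) : ∃ f :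
    (chains Y).X n ⟶ T, ∀ τ, f.hom (gen τ) = φ τ := by
  refine ⟨((TopCat.toSSet.obj (TopCat.of Y)).isColimitChainComplexXCofan _ n).desc
      (Limits.Cofan.mk _ fun σ => AddCommGrpCat.ofHom
      (zmultiplesHom _ (φ (TopCat.toSSetObjEquiv (TopCat.of Y) (.op ⦋n⦌) σ)))), fun τ => ?_⟩
  have := ((TopCat.toSSet.obj (TopCat.of Y)).isColimitChainComplexXCofan (AddCommGrpCat.of ℤ) n).fac
      (Limits.Cofan.mk _ fun σ => AddCommGrpCat.ofHom
      (zmultiplesHom T (φ (TopCat.toSSetObjEquiv (TopCat.of Y) (.op ⦋n⦌) σ)))) ⟨simplex τ⟩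
  have := congr($(this).hom (1:ℤ))
  refine this.trans ?_
  simp [simplex]

/-- The class of a singular one-simplex modulo boundaries. -/
def cls (σ : C(stdSimplex ℝ (Fin 2), Y)) : opc Y := ((chains Y).pOpcycles 1).hom (gen σ)

/-- This is the boundary of a triangle, the only relation used among one-simplices. -/
lemma cls_face (τ : C(stdSimplex ℝ (Fin 3), Y)) :
    cls (τ.comp (face 2)) + cls (τ.comp (face 0)) = cls (τ.comp (face 1)) := by
  have h1 : ((chains Y).pOpcycles 1).hom (((chains Y).d 2 1).hom (gen τ)) = 0 := by
    exact congr($((chains Y).d_pOpcycles 2 1).hom (gen τ))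
  rw [d_gen, map_sum, Fin.sum_univ_three] at h1
  simp at h1
  simp only [cls]
  rw [← sub_eq_zero, ← h1]
  abel

/-- The one-simplex given by a path. -/
def ofPath {x y : Y} (γ : Path x y) : C(stdSimplex ℝ (Fin 2), Y) :=
  γ.toContinuousMap.comp ⟨stdSimplexHomeomorphUnitInterval,
      stdSimplexHomeomorphUnitInterval.continuous⟩

/-- The class of a path in one-chains modulo boundaries. -/
def pcls {x y : Y} (γ : Path x y) : opc Y := cls (ofPath γ)

lemma pcls_refl (x : Y) : pcls (Path.refl x) = 0 := by
  have := cls_face (ContinuousMap.const (stdSimplex ℝ (Fin 3)) x)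
  have h : ∀ i, (ContinuousMap.const (stdSimplex ℝ (Fin 3)) x).comp (face i) =
      ofPath (Path.refl x) := by
    intro i; rfl
  rw [h, h, h] at this
  simpa [pcls] using this

lemma face_zero_apply (s : stdSimplex ℝ (Fin 2)) : (face 0 s : Fin 3 → ℝ) = ![0, s 0, s 1] := by
  ext j
  fin_cases j <;> simp [face, FunOnFinite.linearMap_apply_apply, Finset.sum_filter]

lemma face_one_apply (s : stdSimplex ℝ (Fin 2)) : (face 1 s : Fin 3 → ℝ) = ![s 0, 0, s 1] := by
  ext j
  fin_cases j <;> simp [face, FunOnFinite.linearMap_apply_apply, Finset.sum_filter]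

lemma face_two_apply (s : stdSimplex ℝ (Fin 2)) : (face 2 s : Fin 3 → ℝ) = ![s 0, s 1, 0] := by
  have : Fin.succAbove (2 : Fin 3) 1 = 1 := rfl
  ext j
  fin_cases j <;> simp [face, FunOnFinite.linearMap_apply_apply, Finset.sum_filter, this]

/-- The affine map from the triangle to the interval with given values at the last two vertices,
and value `0` at the first. -/
def toI (l m : ℝ) (hl : l ∈ Set.Icc 0 1) (hm : m ∈ Set.Icc 0 1) :
    C(stdSimplex ℝ (Fin 3), unitInterval) :=
  ⟨fun t => ⟨l * t 1 + m * t 2, by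
      have h0 := stdSimplex.zero_le t 0
      have h1 := stdSimplex.zero_le t 1
      have h2 := stdSimplex.zero_le t 2
      have h3 := stdSimplex.sum_eq_one t
      rw [Fin.sum_univ_three] at h3
      obtain ⟨hl0, hl1⟩ := hl
      obtain ⟨hm0, hm1⟩ := hm
      constructor
      · positivity
      · nlinarith⟩, by
      refine Continuous.subtype_mk ?_ _
      exact (continuous_const.mul ((continuous_apply 1).comp continuous_subtype_val)).add
        (continuous_const.mul ((continuous_apply 2).comp continuous_subtype_val))⟩

lemma toI_face_zero (l m : ℝ) (hl hm) (s : stdSimplex ℝ (Fin 2)) :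
    (toI l m hl hm (face 0 s) : ℝ) = l + (m - l) * s 1 := by
  have h3 := stdSimplex.add_eq_one s
  simp only [toI, ContinuousMap.coe_mk, face_zero_apply]
  simp
  linear_combination l * h3

lemma toI_face_one (l m : ℝ) (hl hm) (s : stdSimplex ℝ (Fin 2)) :
    (toI l m hl hm (face 1 s) : ℝ) = m * s 1 := by
  simp only [toI, ContinuousMap.coe_mk, face_one_apply]
  simp

lemma toI_face_two (l m : ℝ) (hl hm) (s : stdSimplex ℝ (Fin 2)) :
    (toI l m hl hm (face 2 s) : ℝ) = l * s 1 := by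
  simp only [toI, ContinuousMap.coe_mk, face_two_apply]
  simp

lemma ofPath_apply {x y : Y} (γ : Path x y) (s : stdSimplex ℝ (Fin 2)) :
    ofPath γ s = γ.extend (s 1) :=
  (γ.extend_apply _).symm

/-- The triangle is collapsed onto the interval with its vertices at `0`, `1/2`, `1`; composing with
the concatenated path gives a two-simplex whose edges are the three paths. -/
lemma pcls_trans {x y z : Y} (γ : Path x y) (γ' : Path y z) :
    pcls (γ.trans γ') = pcls γ + pcls γ' := by
  have := cls_face ((γ.trans γ').toContinuousMap.comp (toI (1 / 2) 1 (by norm_num) (by norm_num)))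
  have key (t : unitInterval) : (γ.trans γ').toContinuousMap t =
      if (t : ℝ) ≤ 1 / 2 then γ.extend (2 * t) else γ'.extend (2 * t - 1) := rfl
  rw [pcls, pcls, pcls]
  convert this.symm using 2
  · ext s
    simp only [ContinuousMap.comp_apply, key, toI_face_one, ofPath_apply]
    rw [Path.extend_apply _ ⟨stdSimplex.zero_le s 1, stdSimplex.le_one s 1⟩]
    simp [Path.trans]
  · congr 1
    ext s
    have := stdSimplex.le_one s 1
    simp only [ContinuousMap.comp_apply, key, toI_face_two, ofPath_apply]
    rw [if_pos (by linarith)]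
    congr 1
    ring
  · congr 1
    ext s
    have := stdSimplex.zero_le s 1
    simp only [ContinuousMap.comp_apply, key, toI_face_zero, ofPath_apply]
    split_ifs with h
    · have h1 : s 1 = 0 := by linarith
      simp [h1]
    · congr 1
      ring

/-- The square of the homotopy is cut along its diagonal into two triangles. Besides `γ`, `γ'` and
the common diagonal, their edges are constant. -/
lemma pcls_eq_of_homotopic {x y : Y} {γ γ' : Path x y} (h : γ.Homotopic γ') :
    pcls γ = pcls γ' := by
  obtain ⟨F⟩ := h
  -- At the vertices `p` takes the values `0, 0, 1` and `q` the values `0, 1, 1`, so `(p, q)` and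
  -- `(q, p)` are the two halves of the square.
  let p : C(stdSimplex ℝ (Fin 3), unitInterval) := toI 0 1 (by norm_num) (by norm_num)
  let q : C(stdSimplex ℝ (Fin 3), unitInterval) := toI 1 1 (by norm_num) (by norm_num)
  have p2 (s) : p (face 2 s) = 0 := by ext; rw [toI_face_two]; simp
  have q0 (s) : q (face 0 s) = 1 := by ext; rw [toI_face_zero]; simp
  have p0 (s) : p (face 0 s) = stdSimplexHomeomorphUnitInterval s := by
    ext; rw [toI_face_zero]; simp; rfl
  have q2 (s) : q (face 2 s) = stdSimplexHomeomorphUnitInterval s := by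
    ext; rw [toI_face_two]; simp; rfl
  have pq1 (s) : p (face 1 s) = q (face 1 s) := by
    ext; rw [toI_face_one, toI_face_one]
  have h1 := cls_face (F.toContinuousMap.comp (p.prodMk q))
  have h2 := cls_face (F.toContinuousMap.comp (q.prodMk p))
  have b1 : (F.toContinuousMap.comp (p.prodMk q)).comp (face 2) = ofPath γ := by
    ext s
    change F (p (face 2 s), q (face 2 s)) = γ (stdSimplexHomeomorphUnitInterval s)
    rw [p2, q2, F.apply_zero]
    rfl
  have b2 : (F.toContinuousMap.comp (p.prodMk q)).comp (face 0) = ofPath (Path.refl y) := by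
    ext s
    change F (p (face 0 s), q (face 0 s)) = y
    rw [q0]
    exact Path.Homotopy.target F _
  have b3 : (F.toContinuousMap.comp (q.prodMk p)).comp (face 2) = ofPath (Path.refl x) := by
    ext s
    change F (q (face 2 s), p (face 2 s)) = x
    rw [p2]
    exact Path.Homotopy.source F _
  have b4 : (F.toContinuousMap.comp (q.prodMk p)).comp (face 0) = ofPath γ' := by
    ext s
    change F (q (face 0 s), p (face 0 s)) = γ' (stdSimplexHomeomorphUnitInterval s)
    rw [p0, q0, F.apply_one]
    rfl
  have b5 : (F.toContinuousMap.comp (p.prodMk q)).comp (face 1) =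
      (F.toContinuousMap.comp (q.prodMk p)).comp (face 1) := by
    ext s
    change F (p (face 1 s), q (face 1 s)) = F (q (face 1 s), p (face 1 s))
    rw [pq1]
  rw [b1, b2, b5] at h1
  rw [b3, b4] at h2
  have := h1.trans h2.symm
  change pcls γ + pcls (Path.refl y) = pcls (Path.refl x) + pcls γ' at this
  simpa [pcls_refl] using this

lemma pcls_symm {x y : Y} (γ : Path x y) : pcls γ.symm = - pcls γ := by
  rw [eq_neg_iff_add_eq_zero, ← pcls_trans, ← pcls_refl y]
  exact pcls_eq_of_homotopic ⟨(Path.Homotopy.reflSymmTrans γ).symm⟩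

/-- The path underlying a singular one-simplex. -/
def toPath (σ : C(stdSimplex ℝ (Fin 2), Y)) :
    Path (σ (stdSimplex.vertex 0)) (σ (stdSimplex.vertex 1)) where
  toFun t := σ (stdSimplexHomeomorphUnitInterval.symm t)
  continuous_toFun := by fun_prop
  source' := by
    rw [← stdSimplexHomeomorphUnitInterval_zero, Homeomorph.symm_apply_apply]
  target' := by
    rw [← stdSimplexHomeomorphUnitInterval_one, Homeomorph.symm_apply_apply]

lemma ofPath_toPath (σ : C(stdSimplex ℝ (Fin 2), Y)) : ofPath (toPath σ) = σ := by
  ext s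
  change σ (stdSimplexHomeomorphUnitInterval.symm (stdSimplexHomeomorphUnitInterval s)) = _
  simp

lemma toPath_ofPath {x y : Y} (γ : Path x y) :
    ∃ h h', toPath (ofPath γ) = γ.cast h h' := by
  have h : ofPath γ (stdSimplex.vertex 0) = x := by rw [ofPath_apply]; simp
  have h' : ofPath γ (stdSimplex.vertex 1) = y := by rw [ofPath_apply]; simp
  refine ⟨h, h', ?_⟩
  ext t
  change γ (stdSimplexHomeomorphUnitInterval (stdSimplexHomeomorphUnitInterval.symm t)) = γ t
  simp

/-! ### The Hurewicz map and its inverse. -/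

variable (y₀ : Y)

/-- The abelianized fundamental group, written additively. -/
abbrev abPi : AddCommGrpCat.{0} :=
  AddCommGrpCat.of (Additive (Abelianization (FundamentalGroup Y y₀)))

/-- The class of a loop in the abelianized fundamental group. -/
def loopCls (γ : Path.Homotopic.Quotient y₀ y₀) : abPi y₀ :=
  Additive.ofMul (Abelianization.of (FundamentalGroup.fromPath γ))

lemma exists_loopCls_eq (c : abPi y₀) : ∃ γ : Path y₀ y₀, loopCls y₀ (.mk γ) = c := by
  obtain ⟨γ, hγ⟩ := QuotientGroup.mk_surjective (Additive.toMul c)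
  obtain ⟨γ', hγ'⟩ := Path.Homotopic.Quotient.mk_surjective γ.toPath
  refine ⟨γ', ?_⟩
  rw [hγ']
  exact congrArg Additive.ofMul hγ

lemma loopCls_trans (γ γ' : Path.Homotopic.Quotient y₀ y₀) :
    loopCls y₀ (γ.trans γ') = loopCls y₀ γ + loopCls y₀ γ' := by
  -- The product in `FundamentalGroup` composes paths from right to left.
  rw [add_comm]
  exact congrArg Additive.ofMul
    (map_mul Abelianization.of (FundamentalGroup.fromPath γ') (FundamentalGroup.fromPath γ))

/-- The class of a homotopy class of paths in one-chains modulo boundaries. -/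
def qcls {x y : Y} (γ : Path.Homotopic.Quotient x y) : opc Y :=
  Quotient.lift pcls (fun _ _ h => pcls_eq_of_homotopic h) γ

lemma qcls_trans {x y z : Y} (γ : Path.Homotopic.Quotient x y)
    (γ' : Path.Homotopic.Quotient y z) : qcls (γ.trans γ') = qcls γ + qcls γ' := by
  induction γ using Path.Homotopic.Quotient.ind
  induction γ' using Path.Homotopic.Quotient.ind
  exact pcls_trans _ _

lemma qcls_symm {x y : Y} (γ : Path.Homotopic.Quotient x y) : qcls γ.symm = - qcls γ := by
  induction γ using Path.Homotopic.Quotient.ind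
  exact pcls_symm _

/-- The class of a loop in one-chains modulo boundaries, as a homomorphism. -/
def qclsHom : FundamentalGroup Y y₀ →* Multiplicative (opc Y) where
  toFun γ := Multiplicative.ofAdd (qcls γ.toPath)
  map_one' := congrArg Multiplicative.ofAdd (pcls_refl y₀)
  map_mul' γ γ' := congrArg Multiplicative.ofAdd
    ((qcls_trans γ'.toPath γ.toPath).trans (add_comm _ _))

/-- The map from the abelianized fundamental group to one-chains modulo boundaries. -/
def abPiToOpc : abPi y₀ ⟶ opc Y :=
  AddCommGrpCat.ofHom (AddMonoidHom.toMultiplicativeRight.symm (Abelianization.lift (qclsHom y₀)))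

lemma abPiToOpc_loopCls (γ : Path.Homotopic.Quotient y₀ y₀) :
    (abPiToOpc y₀).hom (loopCls y₀ γ) = qcls γ := rfl

lemma fromOpcycles_pcls {x y : Y} (γ : Path x y) :
    ((chains Y).fromOpcycles 1 0).hom (pcls γ) =
      gen (ContinuousMap.const _ y) - gen (ContinuousMap.const _ x) := by
  have h : ((chains Y).fromOpcycles 1 0).hom (pcls γ) = ((chains Y).d 1 0).hom (gen (ofPath γ)) :=
    congr($((chains Y).p_fromOpcycles 1 0).hom (gen (ofPath γ)))
  rw [h, d_gen, Fin.sum_univ_two]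
  have h0 : (ofPath γ).comp (face 0) = ContinuousMap.const _ y := by
    ext s
    have : face 0 s = stdSimplex.vertex 1 := by
      rw [Subsingleton.elim s (stdSimplex.vertex 0)]
      exact stdSimplex.map_vertex _ _
    simp [this, ofPath_apply]
  have h1 : (ofPath γ).comp (face 1) = ContinuousMap.const _ x := by
    ext s
    have : face 1 s = stdSimplex.vertex 0 := by
      rw [Subsingleton.elim s (stdSimplex.vertex 0)]
      exact stdSimplex.map_vertex _ _
    simp [this, ofPath_apply]
  rw [h0, h1]
  simp [sub_eq_add_neg]

lemma abPiToOpc_comp_fromOpcycles : abPiToOpc y₀ ≫ (chains Y).fromOpcycles 1 0 = 0 := by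
  refine AddCommGrpCat.hom_ext (AddMonoidHom.ext fun c => ?_)
  obtain ⟨γ, rfl⟩ := exists_loopCls_eq y₀ c
  exact (fromOpcycles_pcls γ).trans (sub_self _)

/-- The Hurewicz homomorphism. -/
def hurewiczHom : abPi y₀ ⟶ (chains Y).homology 1 :=
  ((chains Y).homologyIsKernel 1 0 (by simp)).lift
    (Limits.KernelFork.ofι (abPiToOpc y₀) (abPiToOpc_comp_fromOpcycles y₀))

lemma hurewiczHom_ι : hurewiczHom y₀ ≫ (chains Y).homologyι 1 = abPiToOpc y₀ :=
  ((chains Y).homologyIsKernel 1 0 (by simp)).fac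
    (Limits.KernelFork.ofι (abPiToOpc y₀) (abPiToOpc_comp_fromOpcycles y₀))
    Limits.WalkingParallelPair.zero

variable [PathConnectedSpace Y]

/-- A chosen paths from the base point. -/
def tail (y : Y) : Path y₀ y := PathConnectedSpace.somePath y₀ y

/-- The class of the loop obtained by joining a path to the base point at both ends. -/
def lp {x y : Y} (γ : Path.Homotopic.Quotient x y) : abPi y₀ :=
  loopCls y₀ (((Path.Homotopic.Quotient.mk (tail y₀ x)).trans γ).trans
    (Path.Homotopic.Quotient.mk (tail y₀ y)).symm)

lemma lp_trans {x y z : Y} (γ : Path.Homotopic.Quotient x y) (γ' : Path.Homotopic.Quotient y z) :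
    lp y₀ (γ.trans γ') = lp y₀ γ + lp y₀ γ' := by
  rw [lp, lp, lp, ← loopCls_trans]
  congr 1
  simp only [Path.Homotopic.Quotient.trans_assoc]
  rw [← Path.Homotopic.Quotient.trans_assoc (Path.Homotopic.Quotient.symm _)]
  simp

lemma lp_cast {x y x' y' : Y} (γ : Path x y) (h : x' = x) (h' : y' = y) :
    lp y₀ (Path.Homotopic.Quotient.mk (γ.cast h h')) = lp y₀ (Path.Homotopic.Quotient.mk γ) := by
  subst h h'
  rfl

/-- The tail at `y₀` is itself a loop, not necessarily constant; conjugating by it has no effect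
after abelianization. -/
lemma lp_loop (γ : Path.Homotopic.Quotient y₀ y₀) : lp y₀ γ = loopCls y₀ γ := by
  rw [lp, loopCls_trans, loopCls_trans, add_right_comm, ← loopCls_trans,
    Path.Homotopic.Quotient.trans_symm]
  have : loopCls y₀ (.refl y₀) = 0 := rfl
  rw [this, zero_add]

/-- In the contractible standard triangle two edges are together homotopic to the third; push this
forward along `τ`. It makes `lp` vanish on boundaries. -/
lemma lp_face (τ : C(stdSimplex ℝ (Fin 3), Y)) :
    lp y₀ (.mk (toPath (τ.comp (face 2)))) + lp y₀ (.mk (toPath (τ.comp (face 0)))) =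
      lp y₀ (.mk (toPath (τ.comp (face 1)))) := by
  have : ContractibleSpace (stdSimplex ℝ (Fin 3)) :=
    (convex_stdSimplex ℝ (Fin 3)).contractibleSpace ⟨_, (stdSimplex.vertex 0).2⟩
  have v (i : Fin 3) (j : Fin 2) : stdSimplex.vertex (S := ℝ) (i.succAbove j) =
      face i (stdSimplex.vertex j) := (stdSimplex.map_vertex _ _).symm
  let w (i : Fin 3) : stdSimplex ℝ (Fin 3) := stdSimplex.vertex i
  let e01 : Path (w 0) (w 1) := (toPath (face 2)).cast (v 2 0) (v 2 1)
  let e12 : Path (w 1) (w 2) := (toPath (face 0)).cast (v 0 0) (v 0 1)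
  let e02 : Path (w 0) (w 2) := (toPath (face 1)).cast (v 1 0) (v 1 1)
  have key : (e01.trans e12).Homotopic e02 := SimplyConnectedSpace.paths_homotopic _ _
  have key2 := Path.Homotopic.Quotient.eq.mpr (key.map τ)
  rw [Path.map_trans, Path.Homotopic.Quotient.mk_trans] at key2
  have key3 := congrArg (lp y₀) key2
  rw [lp_trans] at key3
  have c1 : lp y₀ (.mk (e01.map τ.continuous)) = lp y₀ (.mk (toPath (τ.comp (face 2)))) :=
    lp_cast y₀ (toPath (τ.comp (face 2))) (congrArg τ (v 2 0)) (congrArg τ (v 2 1))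
  have c2 : lp y₀ (.mk (e12.map τ.continuous)) = lp y₀ (.mk (toPath (τ.comp (face 0)))) :=
    lp_cast y₀ (toPath (τ.comp (face 0))) (congrArg τ (v 0 0)) (congrArg τ (v 0 1))
  have c3 : lp y₀ (.mk (e02.map τ.continuous)) = lp y₀ (.mk (toPath (τ.comp (face 1)))) :=
    lp_cast y₀ (toPath (τ.comp (face 1))) (congrArg τ (v 1 0)) (congrArg τ (v 1 1))
  rwa [c1, c2, c3] at key3

lemma abPiToOpc_lp {x y : Y} (γ : Path.Homotopic.Quotient x y) :
    (abPiToOpc y₀).hom (lp y₀ γ) = pcls (tail y₀ x) + qcls γ - pcls (tail y₀ y) := by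
  rw [lp, abPiToOpc_loopCls, qcls_trans, qcls_trans, qcls_symm, sub_eq_add_neg]
  rfl

/-- Closing up simplices with tails defines a map on chains modulo boundaries. It is a left inverse
of `abPiToOpc`, and a right inverse up to a term that factors through the boundary, which is zero on
homology. -/
lemma exists_inverse : ∃ g : (chains Y).homology 1 ⟶ abPi y₀,
    hurewiczHom y₀ ≫ g = 𝟙 _ ∧ g ≫ hurewiczHom y₀ = 𝟙 _ := by
  obtain ⟨f, hf⟩ := exists_hom (Y := Y) (n := 1) (T := abPi y₀)
    (fun σ => lp y₀ (.mk (toPath σ)))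
  have hdf : (chains Y).d 2 1 ≫ f = 0 := by
    refine hom_ext_gen fun τ => ?_
    change f.hom (((chains Y).d 2 1).hom (gen τ)) = 0
    have h0 := hf (τ.comp (face 0))
    have h1 := hf (τ.comp (face 1))
    have h2 := hf (τ.comp (face 2))
    rw [d_gen, map_sum, Fin.sum_univ_three, map_zsmul, map_zsmul, map_zsmul, h0, h1, h2,
      ← lp_face y₀ τ]
    generalize lp y₀ (.mk (toPath (τ.comp (face 0)))) = u
    generalize lp y₀ (.mk (toPath (τ.comp (face 2)))) = v
    norm_num
  let g' : opc Y ⟶ abPi y₀ := (chains Y).descOpcycles f 2 (by simp) hdf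
  have hg' : (chains Y).pOpcycles 1 ≫ g' = f := (chains Y).p_descOpcycles _ _ _ _
  -- The correction: a vertex is sent to the class of its tail.
  obtain ⟨P, hP⟩ := exists_hom (Y := Y) (n := 0) (T := opc Y)
    (fun σ => pcls (tail y₀ (σ (stdSimplex.vertex 0))))
  have h0 (γ : Path y₀ y₀) : g'.hom ((abPiToOpc y₀).hom (loopCls y₀ (.mk γ))) =
      loopCls y₀ (.mk γ) := by
    have e1 : g'.hom (pcls γ) = f.hom (gen (ofPath γ)) := congr($(hg').hom (gen (ofPath γ)))
    obtain ⟨h, h', e⟩ := toPath_ofPath γ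
    have e2 := hf (ofPath γ)
    rw [e, lp_cast, lp_loop] at e2
    exact e1.trans e2
  have h1 : abPiToOpc y₀ ≫ g' = 𝟙 _ := by
    refine AddCommGrpCat.hom_ext (AddMonoidHom.ext fun c => ?_)
    obtain ⟨γ, rfl⟩ := exists_loopCls_eq y₀ c
    exact h0 γ
  have h2 : g' ≫ abPiToOpc y₀ = 𝟙 _ - (chains Y).fromOpcycles 1 0 ≫ P := by
    rw [← cancel_epi ((chains Y).pOpcycles 1)]
    refine hom_ext_gen fun σ => ?_
    have e1 : ((chains Y).pOpcycles 1 ≫ g' ≫ abPiToOpc y₀).hom (gen σ) =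
        (abPiToOpc y₀).hom (f.hom (gen σ)) := by
      rw [← hg']; rfl
    have e2 : ((chains Y).pOpcycles 1 ≫ (𝟙 _ - (chains Y).fromOpcycles 1 0 ≫ P)).hom (gen σ) =
        cls σ - P.hom (((chains Y).fromOpcycles 1 0).hom (pcls (toPath σ))) := by
      rw [pcls, ofPath_toPath]; rfl
    rw [e1, e2, hf, abPiToOpc_lp, fromOpcycles_pcls, map_sub, hP, hP]
    have e3 : qcls (.mk (toPath σ)) = cls σ := congrArg cls (ofPath_toPath σ)
    rw [e3]
    simp only [ContinuousMap.const_apply]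
    abel
  refine ⟨(chains Y).homologyι 1 ≫ g', ?_, ?_⟩
  · rw [← Category.assoc, hurewiczHom_ι, h1]
  · rw [← cancel_mono ((chains Y).homologyι 1), Category.assoc, Category.assoc, hurewiczHom_ι, h2]
    simp

/-- The Hurewicz isomorphism in degree one. -/
theorem nonempty_addEquiv_H₁ :
    Nonempty (Additive (Abelianization (FundamentalGroup Y y₀)) ≃+ H₁ Y) := by
  obtain ⟨g, h1, h2⟩ := exists_inverse y₀
  exact ⟨(Iso.mk (hurewiczHom y₀) g h1 h2).addCommGroupIsoToAddEquiv⟩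

end Hurewicz

end

noncomputable section

/-! ### Algebra: torsion of the abelianized kernels. -/

namespace TorusGroup

/-- The differences `η j.succ - η 0` are killed by `b`, so they define a map `(ℤ/b)ⁿ → A`. The
characters `c i.succ` show that it is injective. That every torsion element is hit follows from `w`,
which kills torsion, and from the coprimality of `e` and `b`. -/
lemma card_torsion_of_generators {A : Type*} [AddCommGroup A] {n : ℕ} (b : ℕ) (hb : b ≠ 0)
    (ξ : A) (η : Fin (n + 1) → A) (e m : ℤ) (hm : m ≠ 0) (he : IsCoprime e b)
    (hgen : ∀ t : A, ∃ (u : ℤ) (v : Fin (n + 1) → ℤ), t = u • ξ + ∑ j, v j • η j)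
    (hrel : ∀ i, b • η i = e • ξ)
    (w : A →+ ℤ) (hwξ : w ξ = m * b) (hwη : ∀ i, w (η i) = m * e)
    (c : Fin (n + 1) → A →+ ZMod b) (α β : ZMod b) (hβ : IsUnit β)
    (hcη : ∀ i j, c i (η j) = α - if i = j then β else 0) :
    Nat.card (AddCommGroup.torsion A) = b ^ n := by
  have : NeZero b := ⟨hb⟩
  have kill (j : Fin n) : b • (η j.succ - η 0) = 0 := by rw [smul_sub, hrel, hrel, sub_self]
  let ψ : (Fin n → ZMod b) → A := fun v => ∑ j, (v j).val • (η j.succ - η 0)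
  have hψ (v) : b • ψ v = 0 := by
    rw [Finset.smul_sum]
    exact Finset.sum_eq_zero fun j _ => by rw [smul_comm, kill, smul_zero]
  have hmem (v) : ψ v ∈ AddCommGroup.torsion A :=
    isOfFinAddOrder_iff_nsmul_eq_zero.mpr ⟨b, Nat.pos_of_ne_zero hb, hψ v⟩
  have hc (v) (i : Fin n) : c i.succ (ψ v) = - (β * v i) := by
    simp only [ψ, map_sum, map_nsmul, map_sub, hcη]
    rw [Finset.sum_eq_single i]
    · simp [mul_comm]
    · intro j _ hj
      simp [hj.symm]
    · simp
  have hbij : Function.Bijective (fun v => (⟨ψ v, hmem v⟩ : AddCommGroup.torsion A)) := by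
    constructor
    · intro v v' h
      have h' : ψ v = ψ v' := congrArg Subtype.val h
      ext i
      have := congrArg (c i.succ) h'
      rw [hc, hc, neg_inj] at this
      rw [hβ.mul_left_cancel this]
    · rintro ⟨t, ht⟩
      have hwt : w t = 0 := by
        obtain ⟨k, hk, hkt⟩ := isOfFinAddOrder_iff_nsmul_eq_zero.mp ht
        have := congrArg w hkt
        rw [map_nsmul, map_zero, nsmul_eq_mul, mul_eq_zero] at this
        exact this.resolve_left (by exact_mod_cast hk.ne')
      obtain ⟨u, v, rfl⟩ := hgen t
      have h1 : u * b + (∑ j, v j) * e = 0 := by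
        rw [map_add, map_zsmul, map_sum, hwξ] at hwt
        simp only [map_zsmul, hwη, smul_eq_mul, ← Finset.sum_mul] at hwt
        apply mul_left_cancel₀ hm
        linear_combination hwt
      -- The vanishing of `w` reads `u * b + (∑ v) * e = 0`. Hence `∑ v = s * b` and `u = -s * e`,
      -- and `b • η 0 = e • ξ` turns the `ξ`-term into a multiple of `η 0` that cancels `(∑ v) • η
      -- 0`.
      obtain ⟨s, hs⟩ : (b : ℤ) ∣ ∑ j, v j :=
        he.symm.dvd_of_dvd_mul_right ⟨-u, by linear_combination h1⟩
      have hu : u = - (s * e) := by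
        have : (b : ℤ) ≠ 0 := by exact_mod_cast hb
        apply mul_right_cancel₀ this
        rw [hs] at h1
        linear_combination h1
      have hbη : (b : ℤ) • η 0 = e • ξ := by rw [← hrel 0, natCast_zsmul]
      refine ⟨fun j => (v j.succ : ZMod b), Subtype.ext ?_⟩
      have h2 : ψ (fun j => (v j.succ : ZMod b)) = ∑ j : Fin n, v j.succ • (η j.succ - η 0) := by
        refine Finset.sum_congr rfl fun j _ => ?_
        rw [← natCast_zsmul, ← sub_eq_zero, ← sub_smul]
        have : (b : ℤ) ∣ ((v j.succ : ZMod b).val : ℤ) - v j.succ := by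
          rw [← ZMod.intCast_zmod_eq_zero_iff_dvd]
          simp
        obtain ⟨q, hq⟩ := this
        rw [hq, mul_comm, mul_smul, natCast_zsmul, kill, smul_zero]
      change ψ _ = u • ξ + ∑ j, v j • η j
      rw [h2, hu, neg_smul, mul_smul, ← hbη, ← mul_smul, mul_comm s, ← hs, Fin.sum_univ_succ,
        Fin.sum_univ_succ]
      simp only [smul_sub, Finset.sum_sub_distrib, add_smul, Finset.sum_smul]
      abel
  rw [← Nat.card_congr (Equiv.ofBijective _ hbij)]
  simp

variable {G : Type*} [Group G]

/-- The subgroup of elements whose image in `ℤ` is divisible by `m`. -/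
def divKer (w : G →* Multiplicative ℤ) (m : ℕ) : Subgroup G where
  carrier := {g | (m : ℤ) ∣ (w g).toAdd}
  mul_mem' h h' := by
    simp only [Set.mem_ofPred_eq, map_mul, toAdd_mul] at *
    exact dvd_add h h'
  one_mem' := by simp
  inv_mem' h := by simpa using h

lemma mem_divKer {w : G →* Multiplicative ℤ} {m : ℕ} {g : G} :
    g ∈ divKer w m ↔ (m : ℤ) ∣ (w g).toAdd := Iff.rfl

/-- Reidemeister–Schreier with powers of `x` as coset representatives yields the generators and
relations required by `card_torsion_of_generators`. The single character `c` on the larger subgroup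
`divKer w N` yields all the needed ones through conjugation by powers of `x`. -/
theorem card_torsion_abelianization_divKer {x y : G} (hgen : Subgroup.closure {x, y} = ⊤) {a b : ℕ}
    (hxy : x ^ a = y ^ b) (hb : b ≠ 0) (hab : a.Coprime b) (w : G →* Multiplicative ℤ)
    (hwx : (w x).toAdd = b) (hwy : (w y).toAdd = a) {m : ℕ} (hm : m ≠ 0) (hmb : m.Coprime b)
    {n N : ℕ} (hn : a.gcd m = N) (hN : N = n + 1) (c : divKer w N →* Multiplicative (ZMod b))
    (α β : ZMod b) (hβ : IsUnit β)
    (hcx : ∀ g : divKer w N, g.1 = x ^ N → c g = 1)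
    (hcy : ∀ (i : ℤ) (g : divKer w N), g.1 = x ^ i * y * x ^ (-i) →
      (c g).toAdd = α - if (N : ℤ) ∣ i then β else 0) :
    Nat.card (AddCommGroup.torsion (Additive (Abelianization (divKer w m)))) = b ^ n := by
  have hNa : (N : ℤ) ∣ a := by rw [← hn]; exact_mod_cast Nat.gcd_dvd_left a m
  have hNm : (N : ℤ) ∣ m := by rw [← hn]; exact_mod_cast Nat.gcd_dvd_right a m
  have hmb' : IsCoprime (m : ℤ) b := Nat.isCoprime_iff_coprime.mpr hmb
  -- choose `k` with `b * k ≡ a` modulo `m`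
  obtain ⟨k, e, hke⟩ : ∃ k e : ℤ, (a : ℤ) - k * b = m * e := by
    obtain ⟨u, v, huv⟩ := hmb'
    exact ⟨a * v, a * u, by linear_combination (-(a : ℤ)) * huv⟩
  -- Since `k * b = a - m * e`, and `N` divides `a` and `m` and is prime to `b`.
  have hNk : (N : ℤ) ∣ k := by
    have h1 : (N : ℤ) ∣ k * b := by
      have : k * b = a - m * e := by linear_combination -hke
      rw [this]
      exact dvd_sub hNa (hNm.mul_right e)
    exact (hmb'.of_isCoprime_of_dvd_left hNm).dvd_of_dvd_mul_right h1
  have heb : IsCoprime e (b : ℤ) := by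
    have h1 : IsCoprime ((a : ℤ) - k * b) b := by
      obtain ⟨u, v, huv⟩ := Nat.isCoprime_iff_coprime.mpr hab
      exact ⟨u, v + u * k, by linear_combination huv⟩
    rw [hke] at h1
    exact h1.of_mul_left_right
  have hwxz (i : ℤ) : (w (x ^ i)).toAdd = i * b := by rw [map_zpow, toAdd_zpow, hwx, smul_eq_mul]
  have hwη (i : ℤ) : (w (x ^ i * y * x ^ (-k - i))).toAdd = m * e := by
    rw [map_mul w, map_mul w, toAdd_mul, toAdd_mul, hwxz, hwxz, hwy]
    linear_combination hke
  let K := divKer w m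
  let cl : K → Additive (Abelianization K) := fun g => Additive.ofMul (Abelianization.of g)
  have cl_mul (g h : K) : cl (g * h) = cl g + cl h := by
    simp only [cl, map_mul, ofMul_mul]
  have cl_inv (g : K) : cl g⁻¹ = - cl g := by
    simp only [cl, map_inv, ofMul_inv]
  let X : K := ⟨x ^ (m : ℤ), by rw [mem_divKer, hwxz]; exact dvd_mul_right _ _⟩
  let E : ℤ → K := fun i => ⟨x ^ i * y * x ^ (-k - i), by
    rw [mem_divKer, hwη]
    exact dvd_mul_right _ _⟩
  -- `x ^ a = y ^ b` commutes with `y`, so the elements `E i` are unchanged by `i ↦ i + a`. A shift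
  -- by `m` is conjugation by `X`, invisible in the abelianization; Bézout combines the two into the
  -- period `N`.
  have comm : Commute (x ^ (a : ℤ)) y := by
    rw [zpow_natCast, hxy]
    exact (Commute.refl y).pow_left b
  have per_a : Function.Periodic (fun i => cl (E i)) (a : ℤ) := by
    intro i
    refine congrArg cl (Subtype.ext ?_)
    change x ^ (i + a) * y * x ^ (-k - (i + a)) = x ^ i * y * x ^ (-k - i)
    have : -k - (i + (a : ℤ)) = - a + (-k - i) := by ring
    rw [this, zpow_add, zpow_add x (-(a : ℤ)), mul_assoc (x ^ i), comm.eq, zpow_neg]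
    group
  have per_m : Function.Periodic (fun i => cl (E i)) (m : ℤ) := by
    intro i
    have : E (i + m) = X * E i * X⁻¹ := by
      refine Subtype.ext ?_
      change x ^ (i + m) * y * x ^ (-k - (i + m)) =
          x ^ (m : ℤ) * (x ^ i * y * x ^ (-k - i)) * (x ^ (m : ℤ))⁻¹
      group
    change cl (E (i + m)) = cl (E i)
    rw [this, cl_mul, cl_mul, cl_inv]
    abel
  have per_N : Function.Periodic (fun i => cl (E i)) (N : ℤ) := by
    have : (N : ℤ) = a.gcdA m * a + a.gcdB m * m := by
      rw [← hn, Nat.gcd_eq_gcd_ab]; ring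
    rw [this]
    exact (per_a.int_mul _).add_period (per_m.int_mul _)
  have per {i j : ℤ} (h : (N : ℤ) ∣ j - i) : cl (E j) = cl (E i) := by
    obtain ⟨q, hq⟩ := h
    have := per_N.int_mul q i
    have e : j = i + q * N := by linear_combination hq
    rw [e]
    exact this
  -- The element is the product `E i * E (i + k) * E (i + 2k) * ⋯` with `t` factors, whose classes
  -- agree because `N ∣ k`. For `t = b` it is `x ^ (a - k * b) = X ^ e`.
  have hpow (t : ℕ) : ∀ (i : ℤ) (g : K), g.1 = x ^ i * y ^ t * x ^ (-(k * t) - i) → cl g =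
      t • cl (E i) := by
    induction t with
    | zero =>
      intro i g hg
      have : g = 1 := Subtype.ext (by rw [hg]; simp)
      rw [this, zero_smul]
      simp [cl]
    | succ t ih =>
      intro i g hg
      have h1 : g = E i * ((E i)⁻¹ * g) := by group
      have h2 := ih (i + k) ((E i)⁻¹ * g) (by
        change (x ^ i * y * x ^ (-k - i))⁻¹ * g.1 = _
        rw [hg, pow_succ']
        push_cast
        group)
      rw [h1, cl_mul, h2, per (i := i) (j := i + k) (by simpa using hNk), succ_nsmul']
  have hwK (g : K) : (N : ℤ) ∣ (w g).toAdd := hNm.trans g.2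
  have cl_zpow (g : K) (i : ℤ) : cl (g ^ i) = i • cl g := by
    simp only [cl, map_zpow, ofMul_zpow]
  have hrel (i : ℤ) : b • cl (E i) = e • cl X := by
    rw [← cl_zpow, ← hpow b i (X ^ e)]
    change (x ^ (m : ℤ)) ^ e = _
    rw [← zpow_mul, ← hke, ← hxy]
    group
  -- the classes of `X` and the `E i` span
  let Λ : AddSubgroup (Additive (Abelianization K)) :=
    AddSubgroup.closure ({cl X} ∪ Set.range fun j : Fin (n + 1) => cl (E j))
  have hXΛ : cl X ∈ Λ := AddSubgroup.subset_closure (.inl rfl)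
  have hEΛ (i : ℤ) : cl (E i) ∈ Λ := by
    have hNpos : (0 : ℤ) < N := by omega
    have h0 := Int.emod_nonneg i hNpos.ne'
    have h1 := Int.emod_lt_of_pos i hNpos
    have h2 : cl (E i) = cl (E (⟨(i % N).toNat, by omega⟩ : Fin (n + 1))) := by
      refine per ?_
      simp only [Int.toNat_of_nonneg h0]
      exact Int.dvd_self_sub_emod
    rw [h2]
    exact AddSubgroup.subset_closure (.inr ⟨_, rfl⟩)
  -- Schreier rewriting: each letter `y` read after `x ^ i` contributes `E i` and changes the
  -- representative to `x ^ (i + k)`.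
  have hdecomp (g : G) : ∃ κ : K, cl κ ∈ Λ ∧ ∃ i : ℤ, g = κ * x ^ i := by
    have hg : g ∈ Subgroup.closure {x, y} := by rw [hgen]; trivial
    induction hg using Subgroup.closure_induction_right with
    | one => exact ⟨1, by simp [cl], 0, by simp⟩
    | mul_right g _ z hz ih =>
      obtain ⟨κ, hκ, i, rfl⟩ := ih
      rcases hz with rfl | rfl
      · exact ⟨κ, hκ, i + 1, by rw [zpow_add_one, mul_assoc]⟩
      · refine ⟨κ * E i, by rw [cl_mul]; exact Λ.add_mem hκ (hEΛ i), i + k, ?_⟩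
        change κ.1 * x ^ i * z = κ.1 * (x ^ i * z * x ^ (-k - i)) * x ^ (i + k)
        group
    | mul_inv_cancel g _ z hz ih =>
      obtain ⟨κ, hκ, i, rfl⟩ := ih
      rcases hz with rfl | rfl
      · exact ⟨κ, hκ, i - 1, by rw [zpow_sub_one, mul_assoc]⟩
      · refine ⟨κ * (E (i - k))⁻¹, by
          rw [cl_mul, cl_inv]; exact Λ.add_mem hκ (Λ.neg_mem (hEΛ _)), i - k, ?_⟩
        change κ.1 * x ^ i * z⁻¹ = κ.1 * (x ^ (i - k) * z * x ^ (-k - (i - k)))⁻¹ * x ^ (i - k)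
        group
  have hΛ (t : Additive (Abelianization K)) : t ∈ Λ := by
    obtain ⟨g, hg⟩ := QuotientGroup.mk_surjective (Additive.toMul t)
    have hg' : cl g = t := congrArg Additive.ofMul hg
    obtain ⟨κ, hκ, i, hi⟩ := hdecomp g.1
    have h1 : (m : ℤ) ∣ i := by
      have h2 : (m : ℤ) ∣ i * b := by
        have h3 := dvd_sub g.2 κ.2
        rw [hi, map_mul w, toAdd_mul, hwxz] at h3
        simpa using h3
      exact hmb'.dvd_of_dvd_mul_right h2
    obtain ⟨q, rfl⟩ := h1
    have h4 : g = κ * X ^ q := Subtype.ext (by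
      rw [hi, zpow_mul]; rfl)
    rw [← hg', h4, cl_mul, cl_zpow]
    exact Λ.add_mem hκ (Λ.zsmul_mem hXΛ q)
  have hspan (t : Additive (Abelianization K)) : ∃ (u : ℤ) (v : Fin (n + 1) → ℤ),
      t = u • cl X + ∑ j, v j • cl (E j) := by
    induction hΛ t using AddSubgroup.closure_induction with
    | mem t ht =>
      rcases ht with rfl | ⟨j, rfl⟩
      · exact ⟨1, 0, by simp⟩
      · exact ⟨0, Pi.single j 1, by simp [Pi.single_apply]⟩
    | zero => exact ⟨0, 0, by simp⟩
    | add s t _ _ hs ht =>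
      obtain ⟨u, v, rfl⟩ := hs
      obtain ⟨u', v', rfl⟩ := ht
      exact ⟨u + u', v + v', by simp only [add_smul, Pi.add_apply, Finset.sum_add_distrib]; abel⟩
    | neg t _ ht =>
      obtain ⟨u, v, rfl⟩ := ht
      exact ⟨-u, -v, by simp only [neg_smul, Pi.neg_apply, Finset.sum_neg_distrib]; abel⟩
  let wA : Additive (Abelianization K) →+ ℤ :=
    AddMonoidHom.toMultiplicativeRight.symm (Abelianization.lift (w.comp K.subtype))
  have hwA (g : K) : wA (cl g) = (w g).toAdd := rfl
  let cj (j : ℤ) : K →* Multiplicative (ZMod b) :=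
    c.comp (((MulAut.conj (x ^ (-j))).toMonoidHom.comp K.subtype).codRestrict (divKer w N)
      (fun g => by
        change (N : ℤ) ∣ (w (x ^ (-j) * g.1 * (x ^ (-j))⁻¹)).toAdd
        rw [map_mul w, map_mul w, map_inv w, mul_right_comm, mul_inv_cancel, one_mul]
        exact hwK g))
  let cA (j : ℤ) : Additive (Abelianization K) →+ ZMod b :=
    AddMonoidHom.toMultiplicativeRight.symm (Abelianization.lift (cj j))
  have hcA (j : ℤ) (g : K) : cA j (cl g) = (cj j g).toAdd := rfl
  let XN : divKer w N := ⟨x ^ N, by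
    rw [mem_divKer, map_pow w, toAdd_pow, hwx]; simp⟩
  have hcE (i j : ℤ) : (cj j (E i)).toAdd = α - if (N : ℤ) ∣ i - j then β else 0 := by
    obtain ⟨q, rfl⟩ := hNk
    let g' : divKer w N := ⟨x ^ (i - j) * y * x ^ (-(i - j)), by
      rw [mem_divKer, map_mul w, map_mul w, toAdd_mul, toAdd_mul, hwxz, hwxz, hwy]
      convert hNa using 1
      ring⟩
    rw [← hcy (i - j) g' rfl]
    -- `E i` differs from a conjugate of `y` by a power of `x ^ N`, because `N ∣ k`, and `c` kills
    -- that power.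
    have : cj j (E i) = c (g' * XN ^ (-q)) := by
      refine congrArg c (Subtype.ext ?_)
      change x ^ (-j) * (x ^ i * y * x ^ (-(N * q) - i)) * (x ^ (-j))⁻¹ =
        x ^ (i - j) * y * x ^ (-(i - j)) * (x ^ N) ^ (-q)
      rw [← zpow_natCast x N, ← zpow_mul]
      group
    rw [this, map_mul c, map_zpow c, hcx XN rfl]
    simp
  refine card_torsion_of_generators b hb (cl X) (fun j : Fin (n + 1) => cl (E j)) e m
    (by exact_mod_cast hm) heb hspan (fun i => hrel i) wA ?_ (fun i => ?_)
    (fun j => cA j) α β hβ (fun i j => ?_)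
  · rw [hwA]
    exact hwxz m
  · rw [hwA]
    exact hwη i
  · rw [hcA, hcE]
    congr 1
    have : (N : ℤ) ∣ ((j : ℕ) : ℤ) - ((i : ℕ) : ℤ) ↔ i = j := by
      constructor
      · intro h
        have h2 := Int.eq_zero_of_abs_lt_dvd h (by rw [abs_lt]; omega)
        exact Fin.ext (by omega)
      · rintro rfl
        simp
    simp [this]

/-- The relation gives `a φ(x) = b φ(y)` with `b` invertible modulo `pⁿ`, so `φ` is determined by
`φ(x)` and equals `μ * w`. Surjectivity forces `μ` to be a unit. -/
lemma ker_eq_divKer {x y : G} (hgen : Subgroup.closure {x, y} = ⊤) {a b : ℕ}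
    (hxy : x ^ a = y ^ b) (w : G →* Multiplicative ℤ)
    (hwx : (w x).toAdd = b) (hwy : (w y).toAdd = a) {p : ℕ} (hp : p.Prime) (hpb : ¬ p ∣ b) (n : ℕ)
    (φ : G →* Multiplicative (ZMod (p ^ n))) (hφ : Function.Surjective φ) :
    φ.ker = divKer w (p ^ n) := by
  have hb : IsUnit (b : ZMod (p ^ n)) := by
    rw [ZMod.isUnit_iff_coprime]
    exact (Nat.Coprime.pow_left n ((Nat.Prime.coprime_iff_not_dvd hp).mpr hpb)).symm
  obtain ⟨β, hβ⟩ := hb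
  -- `φ = μ * w` modulo `p ^ n`
  set μ : ZMod (p ^ n) := (φ x).toAdd * ↑β⁻¹ with hμ
  have hββ : (b : ZMod (p ^ n)) * ↑β⁻¹ = 1 := by rw [← hβ]; simp
  have hrel : (a : ZMod (p ^ n)) * (φ x).toAdd = b * (φ y).toAdd := by
    have := congrArg (fun g => (φ g).toAdd) hxy
    simpa using this
  have hφw (g : G) : (φ g).toAdd = μ * ((w g).toAdd : ℤ) := by
    have hg : g ∈ Subgroup.closure {x, y} := by rw [hgen]; trivial
    induction hg using Subgroup.closure_induction with
    | mem z hz =>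
      rcases hz with rfl | rfl
      · rw [hwx, hμ]
        push_cast
        linear_combination (-(φ z).toAdd) * hββ
      · rw [hwy, hμ]
        push_cast
        linear_combination (-(φ z).toAdd) * hββ - ↑β⁻¹ * hrel
    | one => simp
    | mul g h _ _ hg hh =>
      rw [map_mul φ, map_mul w, toAdd_mul, toAdd_mul, hg, hh]
      push_cast
      ring
    | inv g _ hg =>
      rw [map_inv φ, map_inv w, toAdd_inv, toAdd_inv, hg]
      push_cast
      ring
  have hμu : IsUnit μ := by
    obtain ⟨g, hg⟩ := hφ (Multiplicative.ofAdd 1)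
    have := hφw g
    rw [hg, toAdd_ofAdd] at this
    exact IsUnit.of_mul_eq_one _ this.symm
  ext g
  rw [MonoidHom.mem_ker, mem_divKer, ← ZMod.intCast_zmod_eq_zero_iff_dvd,
    ← hμu.mul_right_eq_zero, ← hφw]
  rfl

end TorusGroup

end

noncomputable section

namespace CoveringAux

/-! ### The generation half of van Kampen's theorem. -/

section VanKampen

variable {X : Type*} [TopologicalSpace X] {x₀ : X}

/-- Join a path to the base point along chosen tails. -/
def closeUp (τ : ∀ z : X, Path x₀ z) {z z' : X} (γ : Path.Homotopic.Quotient z z') :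
    FundamentalGroup X x₀ :=
  FundamentalGroup.fromPath (((Path.Homotopic.Quotient.mk (τ z)).trans γ).trans
      (Path.Homotopic.Quotient.mk (τ z')).symm)

lemma closeUp_trans (τ : ∀ z : X, Path x₀ z) {z z' z'' : X} (γ : Path.Homotopic.Quotient z z')
    (γ' : Path.Homotopic.Quotient z' z'') : closeUp τ (γ.trans γ') = closeUp τ γ' * closeUp τ γ :=
        by
  rw [FundamentalGroup.mul_def]
  simp only [closeUp, Path.Homotopic.Quotient.trans_assoc]
  rw [← Path.Homotopic.Quotient.trans_assoc (Path.Homotopic.Quotient.symm _)]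
  simp

lemma closeUp_cast (τ : ∀ z : X, Path x₀ z) {z z' y y' : X} (γ : Path z z') (h : y = z)
    (h' : y' = z') : closeUp τ (Path.Homotopic.Quotient.mk (γ.cast h h')) =
        closeUp τ (Path.Homotopic.Quotient.mk γ) := by
  subst h h'
  rfl

/-- Subdivide a loop so that each piece lies in `U` or in `V`, and close each piece up with tails. A
tail stays inside every one of `U`, `V` that contains its endpoint, which is possible because `U`,
`V` and `U ∩ V` are path connected. -/
theorem subgroup_eq_top_of_open_cover {U V : Set X} (hU : IsOpen U) (hV : IsOpen V)
    (hUV : U ∪ V = Set.univ) (hU' : IsPathConnected U) (hV' : IsPathConnected V)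
    (hUV' : IsPathConnected (U ∩ V)) (hx : x₀ ∈ U ∩ V) (H : Subgroup (FundamentalGroup X x₀))
    (hHU : ∀ γ : Path x₀ x₀, (∀ t, γ t ∈ U) → FundamentalGroup.fromPath (.mk γ) ∈ H)
    (hHV : ∀ γ : Path x₀ x₀, (∀ t, γ t ∈ V) → FundamentalGroup.fromPath (.mk γ) ∈ H) : H = ⊤ := by
  have tails (z : X) : ∃ τ : Path x₀ z, (z ∈ U → ∀ t, τ t ∈ U) ∧ (z ∈ V → ∀ t, τ t ∈ V) := by
    by_cases hzU : z ∈ U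
    · by_cases hzV : z ∈ V
      · obtain ⟨τ, hτ⟩ := hUV'.joinedIn x₀ hx z ⟨hzU, hzV⟩
        exact ⟨τ, fun _ t => (hτ t).1, fun _ t => (hτ t).2⟩
      · obtain ⟨τ, hτ⟩ := hU'.joinedIn x₀ hx.1 z hzU
        exact ⟨τ, fun _ t => hτ t, fun h => absurd h hzV⟩
    · have hzV : z ∈ V := by
        have : z ∈ U ∪ V := by rw [hUV]; trivial
        exact this.resolve_left hzU
      obtain ⟨τ, hτ⟩ := hV'.joinedIn x₀ hx.2 z hzV
      exact ⟨τ, fun h => absurd h hzU, fun _ t => hτ t⟩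
  choose τ hτU hτV using tails
  have key {W : Set X} (hτ : ∀ z ∈ W, ∀ t, τ z t ∈ W)
      (hH : ∀ γ : Path x₀ x₀, (∀ t, γ t ∈ W) → FundamentalGroup.fromPath (.mk γ) ∈ H)
      {z z' : X} (γ : Path z z') (hγ : ∀ t, γ t ∈ W) : closeUp τ (.mk γ) ∈ H := by
    have hz : z ∈ W := by simpa using hγ 0
    have hz' : z' ∈ W := by simpa using hγ 1
    refine hH (((τ z).trans γ).trans (τ z').symm) fun t => ?_
    have hr : Set.range (((τ z).trans γ).trans (τ z').symm) ⊆ W := by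
      rw [Path.trans_range, Path.trans_range, Path.symm_range]
      rintro _ ((⟨s, rfl⟩ | ⟨s, rfl⟩) | ⟨s, rfl⟩)
      exacts [hτ z hz s, hγ s, hτ z' hz' s]
    exact hr ⟨t, rfl⟩
  have keyU {z z' : X} (γ : Path z z') := key hτU hHU γ
  have keyV {z z' : X} (γ : Path z z') := key hτV hHV γ
  have loop (γ : Path x₀ x₀) : closeUp τ (.mk γ) ∈ H := by
    obtain ⟨t, t0, tmono, ⟨n, hn⟩, ht⟩ := exists_monotone_Icc_subset_open_cover_unitInterval
      (c := fun b : Bool => γ ⁻¹' (if b then U else V))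
      (fun b => by cases b <;> simp [hU.preimage γ.continuous, hV.preimage γ.continuous])
      (fun s _ => by
        have : γ s ∈ U ∪ V := by rw [hUV]; trivial
        rcases this with h | h
        · exact Set.mem_iUnion.mpr ⟨true, h⟩
        · exact Set.mem_iUnion.mpr ⟨false, h⟩)
    have step (k : ℕ) : closeUp τ (.mk (γ.subpath 0 (t k))) ∈ H := by
      induction k with
      | zero =>
        have hr : closeUp τ (.mk (Path.refl (γ 0))) = 1 := by
          simp only [closeUp, Path.Homotopic.Quotient.mk_refl]
          simp
          rfl
        rw [t0, Path.subpath_self, hr]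
        exact H.one_mem
      | succ k ih =>
        have e : Path.Homotopic.Quotient.mk (γ.subpath 0 (t (k + 1))) =
            (Path.Homotopic.Quotient.mk (γ.subpath 0 (t k))).trans
                (Path.Homotopic.Quotient.mk (γ.subpath (t k) (t (k + 1)))) := by
          rw [← Path.Homotopic.Quotient.mk_trans]
          exact (Path.Homotopic.Quotient.eq.mpr ⟨Path.Homotopy.subpathTransSubpath γ _ _ _⟩).symm
        rw [e, closeUp_trans]
        refine H.mul_mem ?_ ih
        obtain ⟨b, hb⟩ := ht k
        have hr : Set.range (γ.subpath (t k) (t (k + 1))) ⊆ if b then U else V := by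
          rw [Path.range_subpath_of_le _ _ _ (tmono k.le_succ), Set.image_subset_iff]
          exact hb
        cases b
        · exact keyV _ fun s => hr ⟨s, rfl⟩
        · exact keyU _ fun s => hr ⟨s, rfl⟩
    have := step n
    rwa [hn n le_rfl, Path.subpath_zero_one, closeUp_cast] at this
  rw [eq_top_iff]
  intro γ _
  obtain ⟨γ, rfl⟩ := Path.Homotopic.Quotient.mk_surjective γ
  have hτ : FundamentalGroup.fromPath (.mk (τ x₀)) ∈ H := hHU _ (hτU x₀ hx.1)
  -- The tail at `x₀` may be a nontrivial loop; it lies in `U`, so the conjugation by it can be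
  -- undone inside `H`.
  have e : FundamentalGroup.fromPath (.mk γ) =
      FundamentalGroup.fromPath (.mk (τ x₀)) * closeUp τ (.mk γ) *
        (FundamentalGroup.fromPath (.mk (τ x₀)))⁻¹ := by
    have : closeUp τ (.mk γ) = (FundamentalGroup.fromPath (.mk (τ x₀)))⁻¹ *
      (FundamentalGroup.fromPath (.mk γ) * FundamentalGroup.fromPath (.mk (τ x₀))) := rfl
    rw [this]
    group
  have := H.mul_mem (H.mul_mem hτ (loop γ)) (H.inv_mem hτ)
  rwa [← e] at this

end VanKampen

/-! ### From a cyclic cover to the kernel of a homomorphism. -/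

section Cyclic

variable {X : Type} [TopologicalSpace X]

lemma locallyPathConnectedSpace_of_isLocalHomeomorph {Y X : Type*} [TopologicalSpace X]
    [TopologicalSpace Y] [LocallyPathConnectedSpace X] {f : Y → X} (hf : IsLocalHomeomorph f) :
    LocallyPathConnectedSpace Y := by
  choose e he _ using hf
  let : ChartedSpace X Y :=
    { atlas := Set.range e
      chartAt := e
      mem_chart_source := he
      chart_mem_atlas := fun y => ⟨y, rfl⟩ }
  exact ChartedSpace.locallyPathConnectedSpace X Y

lemma card_torsion_congr {A B : Type*} [AddCommGroup A] [AddCommGroup B] (e : A ≃+ B) :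
    Nat.card (AddCommGroup.torsion A) = Nat.card (AddCommGroup.torsion B) :=
  Nat.card_congr (e.toEquiv.subtypeEquiv fun a => by
    change IsOfFinAddOrder a ↔ IsOfFinAddOrder (e a)
    exact (Function.Injective.isOfFinAddOrder_iff (f := e.toAddMonoidHom) e.injective).symm)

lemma isQuotientCoveringMap {m : ℕ} (C : CyclicCover m X) :
    IsQuotientCoveringMap C.proj (Multiplicative (ZMod m)) := by
  refine (isQuotientCoveringMap_iff_isCoveringMap_and _ _).mpr ⟨C.isCoveringMap, C.surjective,
    ⟨fun g => C.continuous_vadd g.toAdd⟩, ?_, ?_⟩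
  · refine isCancelSMul_iff_eq_one_of_smul_eq.mpr fun g x h => ?_
    exact congrArg Multiplicative.ofAdd (C.free g.toAdd x h)
  · intro y z
    rw [eq_comm, C.proj_eq_iff]
    rfl

/-- The deck action turns monodromy into a homomorphism to `ℤ/m`. Its kernel is the image of the
fundamental group of the total space, which injects, and Hurewicz identifies the abelianization with
`H₁`. -/
theorem exists_hom_card_torsion {m : ℕ} [LocallyPathConnectedSpace X] (C : CyclicCover m X)
    (x₀ : X) : ∃ φ : FundamentalGroup X x₀ →* Multiplicative (ZMod m), Function.Surjective φ ∧
      cardTorsionH₁ C.space =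
        Nat.card (AddCommGroup.torsion (Additive (Abelianization φ.ker))) := by
  have hq := isQuotientCoveringMap C
  have := locallyPathConnectedSpace_of_isLocalHomeomorph C.isCoveringMap.isLocalHomeomorph
  have : PathConnectedSpace C.space := pathConnectedSpace_iff_connectedSpace.mpr inferInstance
  obtain ⟨y, hy⟩ := C.surjective x₀
  let e : C.proj ⁻¹' {x₀} := ⟨y, hy⟩
  -- Monodromy naturally lands in the opposite group, which is harmless as `ℤ/m` is commutative.
  let φ : FundamentalGroup X x₀ →* Multiplicative (ZMod m) :=
    (MulOpposite.opMulEquiv.symm.toMonoidHom).comp (hq.fundamentalGroupToMulOpposite e)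
  refine ⟨φ, MulOpposite.opMulEquiv.symm.surjective.comp
    (hq.fundamentalGroupToMulOpposite_surjective e), ?_⟩
  have hker : φ.ker = (FundamentalGroup.mapOfEq ⟨C.proj, hq.continuous⟩ e.2).range := by
    rw [← hq.ker_monodromyPerm, ← hq.ker_fundamentalGroupToMulOpposite e]
    ext g
    simp [φ, MonoidHom.mem_ker]
  have hinj : Function.Injective (FundamentalGroup.mapOfEq ⟨C.proj, hq.continuous⟩ e.2) := by
    intro g g' h
    have hm (g) := FundamentalGroup.mapOfEq_apply ⟨C.proj, hq.continuous⟩ hy g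
    have h1 := (hm g).symm.trans (h.trans (hm g'))
    refine C.isCoveringMap.injective_path_homotopic_map _ _ ?_
    have h' := congrArg (fun q => Path.Homotopic.Quotient.cast q hy hy) h1
    simpa using h'
  obtain ⟨E⟩ := Hurewicz.nonempty_addEquiv_H₁ (Y := C.space) y
  rw [hker, cardTorsionH₁, ← card_torsion_congr E]
  exact card_torsion_congr (MulEquiv.toAdditive (MulEquiv.abelianizationCongr
      (MonoidHom.ofInjective hinj)))

end Cyclic

end CoveringAux

end

noncomputable section

namespace CoveringAux

open scoped unitInterval

/-! ### Covering maps from free actions of finite groups. -/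

section FiniteQuotient

variable {E Y : Type*} [TopologicalSpace E] [TopologicalSpace Y]

/-- In a Hausdorff space `e` is separated from each `g • e` with `g ≠ 1`; finiteness of `G` permits
intersecting the resulting neighbourhoods. -/
lemma isQuotientCoveringMap_of_finite {G : Type*} [Group G] [Finite G] [MulAction G E] [T2Space E]
    [ContinuousConstSMul G E] {f : E → Y} (hfree : ∀ (g : G) (e : E), g • e = e → g = 1)
    (hc : Continuous f) (hs : Function.Surjective f) (hcl : IsClosedMap f)
    (horb : ∀ {e e' : E}, f e = f e' ↔ e ∈ MulAction.orbit G e') : IsQuotientCoveringMap f G where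
  toIsQuotientMap := hcl.isQuotientMap hc hs
  continuous_const_smul := continuous_const_smul
  apply_eq_iff_mem_orbit := horb
  disjoint e := by
    have sep (g : G) : ∃ U ∈ 𝓝 e, g ≠ 1 → ∀ y ∈ U, g • y ∉ U := by
      by_cases hg : g = 1
      · exact ⟨Set.univ, Filter.univ_mem, fun h => absurd hg h⟩
      · obtain ⟨A, B, hA, hB, heA, heB, hAB⟩ := t2_separation (fun h => hg (hfree g e h))
        refine ⟨(g • ·) ⁻¹' A ∩ B, (((hA.preimage (continuous_const_smul g)).inter hB)).mem_nhds
          ⟨heA, heB⟩, fun _ y hy hy' => ?_⟩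
        exact Set.disjoint_left.mp hAB hy.1 hy'.2
    choose U hU hU' using sep
    refine ⟨⋂ g, U g, Filter.iInter_mem.mpr hU, fun g => ?_⟩
    rintro ⟨_, ⟨y, hy, rfl⟩, hy'⟩
    by_contra hg
    exact hU' g hg y (Set.mem_iInter.mp hy g) (Set.mem_iInter.mp hy' g)

/-- Projection from a closed set on which a proper function of the second coordinate is determined
by the first coordinate. -/
lemma isClosedMap_fst_of_isProperMap {A B : Type*} [TopologicalSpace A] [TopologicalSpace B]
    [T2Space B] {q : A → B} (hq : IsProperMap q) {r : Y → B} (hr : Continuous r) {C : Set (Y × A)}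
    (hC : IsClosed C) (h : ∀ c ∈ C, q c.2 = r c.1) : IsClosedMap fun c : C => c.1.1 := by
  intro K hK
  have h1 : IsClosed (Prod.map id q '' (Subtype.val '' K)) :=
    (isProperMap_id.prodMap hq).isClosedMap _ (hC.isClosedMap_subtype_val _ hK)
  convert h1.preimage (continuous_id.prodMk hr) using 1
  ext y
  constructor
  · rintro ⟨c, hc, rfl⟩
    exact ⟨c.1, ⟨c, hc, rfl⟩, Prod.ext rfl (h _ c.2)⟩
  · rintro ⟨_, ⟨c, hc, rfl⟩, hy⟩
    exact ⟨c, hc, congrArg Prod.fst hy⟩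

lemma isProperMap_pow {d : ℕ} (hd : d ≠ 0) : IsProperMap fun v : ℂ => v ^ d := by
  refine isProperMap_iff_tendsto_cocompact.mpr ⟨continuous_pow d, ?_⟩
  rw [← Metric.cobounded_eq_cocompact]
  exact tendsto_pow_cobounded_cobounded hd

/-- Composites of covering maps need not be covering maps in general. Here closedness and finite
fibres pass to the composite, and a closed local homeomorphism with finite fibres from a Hausdorff
space is a covering map. -/
lemma isCoveringMap_comp {Z : Type*} [TopologicalSpace Z] [T2Space E] {f : E → Y} {g : Y → Z}
    (hf : IsLocalHomeomorph f) (hg : IsLocalHomeomorph g) (hfc : IsClosedMap f)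
    (hgc : IsClosedMap g) (hff : ∀ y, (f ⁻¹' {y}).Finite) (hgf : ∀ z, (g ⁻¹' {z}).Finite) :
    IsCoveringMap (g ∘ f) := by
  rw [isCoveringMap_iff_isCoveringMapOn_univ]
  refine (hgc.comp hfc).isCoveringMapOn_of_isLocalHomeomorphOn (fun z _ => ?_)
    fun e _ => (hg.comp hf) e
  rw [Set.preimage_comp]
  exact (hgf z).preimage' fun y _ => hff y

lemma IsQuotientCoveringMap.finite_fiber {G : Type*} [Group G] [Finite G] [MulAction G E]
    {f : E → Y} (hf : IsQuotientCoveringMap f G) (y : Y) : (f ⁻¹' {y}).Finite := by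
  obtain ⟨e, he⟩ := hf.surjective y
  exact Finite.of_equiv _ (hf.fiberEquivGroup ⟨e, he⟩).symm

end FiniteQuotient

/-! ### Monodromy along loops that come from a simply connected space. -/

section Monodromy

variable {E X S : Type*} [TopologicalSpace E] [TopologicalSpace X] [TopologicalSpace S]
  {p : E → X} (cov : IsCoveringMap p)

include cov in
lemma monodromy_mk {x y : X} (γ : Path x y) (e : p ⁻¹' {x}) (Γ : C(I, E))
    (hΓ : ∀ t, p (Γ t) = γ t) (h0 : Γ 0 = e) : (cov.monodromy (.mk γ) e).1 = Γ 1 := by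
  have := (cov.eq_liftPath_iff' (γ := γ) (e := e.1) (γ.source.trans e.2.symm) (Γ := Γ)).mpr
    ⟨funext hΓ, h0⟩
  rw [this]
  rfl

/-- Continuous functions with values in roots of unity are constant. -/
lemma eq_of_pow_eq_one [PreconnectedSpace S] {N : ℕ} (hN : N ≠ 0) {h : S → ℂ} (hc : Continuous h)
    (h1 : ∀ s, h s ^ N = 1) (s s' : S) : h s = h s' := by
  have hpre := isPreconnected_range hc
  have hfin : (Set.range h).Finite := by
    have hN' : 0 < N := Nat.pos_of_ne_zero hN
    refine ((Polynomial.nthRoots N (1 : ℂ)).toFinset.finite_toSet).subset ?_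
    rintro _ ⟨s, rfl⟩
    simpa [Polynomial.mem_nthRoots hN'] using h1 s
  by_contra hne
  exact hpre.infinite_of_nontrivial ⟨_, ⟨s, rfl⟩, _, ⟨s', rfl⟩, hne⟩ hfin

/-- The class of the image of a path from `e₀` to `e` when both ends lie over `x₀`. -/
def imageLoop [PathConnectedSpace S] (θ : C(S, X)) {x₀ : X} {e₀ e : S} (h₀ : θ e₀ = x₀)
    (h : θ e = x₀) : FundamentalGroup X x₀ :=
  FundamentalGroup.fromPath
    (.mk (((PathConnectedSpace.somePath e₀ e).map θ.continuous).cast h₀.symm h.symm))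

lemma imageLoop_eq [SimplyConnectedSpace S] (θ : C(S, X)) {x₀ : X} {e₀ e : S} (h₀ : θ e₀ = x₀)
    (h : θ e = x₀) (γ : Path x₀ x₀) (Γ : Path e₀ e) (hΓ : ∀ t, θ (Γ t) = γ t) :
    imageLoop θ h₀ h = FundamentalGroup.fromPath (.mk γ) := by
  have : γ = (Γ.map θ.continuous).cast h₀.symm h.symm := by
    ext t
    exact (hΓ t).symm
  rw [this]
  subst h₀
  refine congrArg FundamentalGroup.fromPath (Path.Homotopic.Quotient.eq.mpr ?_)
  have h2 := (SimplyConnectedSpace.paths_homotopic (PathConnectedSpace.somePath e₀ e) Γ).map θ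
  obtain ⟨H⟩ := h2
  exact ⟨H.cast rfl rfl⟩

/-- To reach `T e`, go from `e₀` to `T e₀` and then follow the `T`-translate of the path from `e₀`
to `e`, which has the same image under `θ` as the path itself. -/
lemma imageLoop_mul [SimplyConnectedSpace S] (θ : C(S, X)) {x₀ : X} {e₀ e : S} (h₀ : θ e₀ = x₀)
    (h : θ e = x₀) (T : C(S, S)) (hT : ∀ s, θ (T s) = θ s) :
    imageLoop θ h₀ ((hT e).trans h) =
      imageLoop θ h₀ h * imageLoop θ h₀ ((hT e₀).trans h₀) := by
  refine imageLoop_eq θ h₀ ((hT e).trans h)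
    ((((PathConnectedSpace.somePath e₀ (T e₀)).map θ.continuous).cast h₀.symm
        ((hT e₀).trans h₀).symm).trans
      (((PathConnectedSpace.somePath e₀ e).map θ.continuous).cast h₀.symm h.symm))
    ((PathConnectedSpace.somePath e₀ (T e₀)).trans
      ((PathConnectedSpace.somePath e₀ e).map T.continuous)) fun t => ?_
  simp only [Path.trans_apply]
  split_ifs <;> simp [hT]

lemma imageLoop_self [SimplyConnectedSpace S] (θ : C(S, X)) {x₀ : X} {e₀ : S} (h₀ : θ e₀ = x₀) :
    imageLoop θ h₀ h₀ = 1 :=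
  imageLoop_eq θ h₀ h₀ (Path.refl x₀) (Path.refl e₀) fun _ => h₀

lemma imageLoop_zpow [SimplyConnectedSpace S] (θ : C(S, X)) {x₀ : X} {e₀ : S} (h₀ : θ e₀ = x₀)
    (T : ℤ → C(S, S)) (hT : ∀ k s, θ (T k s) = θ s) (hadd : ∀ k l s, T (k + l) s = T k (T l s))
    (hzero : ∀ s, T 0 s = s) (k : ℤ) :
    imageLoop θ h₀ ((hT k e₀).trans h₀) = imageLoop θ h₀ ((hT 1 e₀).trans h₀) ^ k := by
  let φ : Multiplicative ℤ →* FundamentalGroup X x₀ :=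
    { toFun := fun k => imageLoop θ h₀ ((hT k.toAdd e₀).trans h₀)
      map_one' := by
        refine Eq.trans ?_ (imageLoop_self θ h₀)
        simp [hzero]
      map_mul' := fun k l => by
        rw [← imageLoop_mul θ h₀ _ (T l.toAdd) (hT _)]
        congr 1
        rw [toAdd_mul, add_comm, hadd] }
  have := φ.map_zpow (Multiplicative.ofAdd 1) k
  rwa [← ofAdd_zsmul, smul_eq_mul, mul_one] at this

/-- Once all of `θ` is lifted to `Θ`, lifting a loop amounts to evaluating `Θ` at an endpoint.
Monodromy can then be computed at any convenient point of `S`. -/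
lemma monodromy_imageLoop [PathConnectedSpace S] (θ : C(S, X)) {x₀ : X} {e₀ e : S} (h₀ : θ e₀ = x₀)
    (h : θ e = x₀) (Θ : C(S, E)) (hΘ : ∀ s, p (Θ s) = θ s) (ε : p ⁻¹' {x₀}) (hε : Θ e₀ = ε) :
    (cov.monodromyPerm x₀ (imageLoop θ h₀ h) ε).1 = Θ e := by
  refine (monodromy_mk cov _ ε (Θ.comp (PathConnectedSpace.somePath e₀ e)) (fun t => ?_) ?_).trans
      ?_
  · simp [hΘ]
  · simpa using hε
  · simp

end Monodromy

/-! ### Winding numbers of nowhere vanishing functions. -/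

section Winding

variable {X S : Type*} [TopologicalSpace X] [TopologicalSpace S]

lemma exists_continuous_log (f : C(I, {z : ℂ // z ≠ 0})) (l : ℂ) (hl : Complex.exp l = f 0) :
    ∃ F : C(I, ℂ), F 0 = l ∧ ∀ t, Complex.exp (F t) = f t := by
  have h0 : f 0 = (⟨_, Complex.exp_ne_zero l⟩ : {z : ℂ // z ≠ 0}) := Subtype.ext hl.symm
  refine ⟨Complex.isCoveringMap_exp.liftPath f l h0, Complex.isCoveringMap_exp.liftPath_zero ..,
    fun t => ?_⟩
  exact congrArg Subtype.val (congrFun (Complex.isCoveringMap_exp.liftPath_lifts f l h0) t)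

/-- Two logarithms along the same loop differ by a constant, so the increment depends only on the
loop. Monodromy of the exponential covering makes it homotopy invariant, and concatenating
logarithms makes it additive. -/
theorem exists_winding (f : C(X, {z : ℂ // z ≠ 0})) (x₀ : X) :
    ∃ w : FundamentalGroup X x₀ →* Multiplicative ℤ, ∀ (γ : Path x₀ x₀) (F : C(I, ℂ)),
      (∀ t, Complex.exp (F t) = f (γ t)) →
      F 1 = F 0 + 2 * Real.pi * Complex.I * (w (FundamentalGroup.fromPath (.mk γ))).toAdd := by
  have hq := Complex.isAddQuotientCoveringMap_exp
  have hpi := Complex.two_pi_I_ne_zero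
  let cov := hq.isCoveringMap
  let l₀ : (fun z : ℂ => (⟨_, z.exp_ne_zero⟩ : {z : ℂ // z ≠ 0})) ⁻¹' {f x₀} :=
    ⟨Complex.log (f x₀), Subtype.ext (Complex.exp_log (f x₀).2)⟩
  have lift (γ : Path x₀ x₀) : ∃ n : ℤ, ∀ F : C(I, ℂ), (∀ t, Complex.exp (F t) = f (γ t)) →
      F 1 = F 0 + 2 * Real.pi * Complex.I * n := by
    obtain ⟨F₀, h0, hF₀⟩ := exists_continuous_log (f.comp γ) l₀.1
        (by simp [l₀, Complex.exp_log (f x₀).2])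
    have h1 : Complex.exp (F₀ 1) = Complex.exp (F₀ 0) := by simp [hF₀]
    obtain ⟨n, hn⟩ := Complex.exp_eq_exp_iff_exists_int.mp h1
    refine ⟨n, fun F hF => ?_⟩
    have h2 : Complex.exp (F 0) = Complex.exp (F₀ 0) := by simp [hF₀, hF]
    obtain ⟨m, hm⟩ := Complex.exp_eq_exp_iff_exists_int.mp h2
    have e : (F : I → ℂ) = fun t => F₀ t + m * (2 * Real.pi * Complex.I) := by
      refine cov.eq_of_comp_eq F.continuous (by fun_prop) (funext fun t => Subtype.ext ?_) 0 hm
      simp only [Function.comp]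
      rw [Complex.exp_add, Complex.exp_int_mul_two_pi_mul_I, mul_one, hF, hF₀]
      rfl
    linear_combination congrFun e 1 - hm + hn
  have wd (g : FundamentalGroup X x₀) : ∃ n : ℤ, ∀ (γ : Path x₀ x₀),
      FundamentalGroup.fromPath (.mk γ) = g → ∀ F : C(I, ℂ), (∀ t, Complex.exp (F t) = f (γ t)) →
      F 1 = F 0 + 2 * Real.pi * Complex.I * n := by
    obtain ⟨γ₀, rfl⟩ := Path.Homotopic.Quotient.mk_surjective g
    obtain ⟨n, hn⟩ := lift γ₀
    refine ⟨n, fun γ hγ F hF => ?_⟩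
    obtain ⟨F₀, h0, hF₀⟩ := exists_continuous_log (f.comp γ₀) (F 0) (by simp [hF])
    have hF₀1 := hn F₀ hF₀
    have hx : (⟨_, (F 0).exp_ne_zero⟩ : {z : ℂ // z ≠ 0}) = f x₀ := Subtype.ext (by simp [hF])
    have m1 := monodromy_mk cov (γ₀.map f.continuous) ⟨F 0, hx⟩ F₀ (fun t => Subtype.ext (hF₀ t)) h0
    have m2 := monodromy_mk cov (γ.map f.continuous) ⟨F 0, hx⟩ F (fun t => Subtype.ext (hF t)) rfl
    have hγ' : Path.Homotopic.Quotient.mk (γ.map f.continuous) =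
        Path.Homotopic.Quotient.mk (γ₀.map f.continuous) :=
      Path.Homotopic.Quotient.eq.mpr ((Path.Homotopic.Quotient.eq.mp hγ).map f)
    rw [hγ'] at m2
    rw [← m2, m1, hF₀1, h0]
  choose n hn using wd
  refine ⟨MonoidHom.mk' (fun g => Multiplicative.ofAdd (n g)) fun g h => ?_,
    fun γ F hF => hn _ γ rfl F hF⟩
  obtain ⟨γ, rfl⟩ := Path.Homotopic.Quotient.mk_surjective g
  obtain ⟨γ', rfl⟩ := Path.Homotopic.Quotient.mk_surjective h
  obtain ⟨F', h0', hF'⟩ := exists_continuous_log (f.comp γ') l₀.1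
      (by simp [l₀, Complex.exp_log (f x₀).2])
  obtain ⟨F, h0, hF⟩ := exists_continuous_log (f.comp γ) (F' 1) (by simp [hF'])
  let P : Path (F' 0) (F 1) := Path.trans ⟨F', rfl, rfl⟩ (⟨F, h0, rfl⟩ : Path (F' 1) (F 1))
  have e := hn _ (γ'.trans γ) rfl P.toContinuousMap (fun t => by
    simp only [P, Path.coe_toContinuousMap, Path.trans_apply]
    split_ifs
    · exact hF' _
    · exact hF _)
  have e1 := hn _ γ rfl F hF
  have e2 := hn _ γ' rfl F' hF'
  have e3 : F 1 = F' 0 + 2 * Real.pi * Complex.I *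
    n (Path.Homotopic.Quotient.mk (γ'.trans γ)) := by simpa using e
  have e4 : (n (Path.Homotopic.Quotient.mk (γ'.trans γ)) : ℂ) =
      n (Path.Homotopic.Quotient.mk γ) + n (Path.Homotopic.Quotient.mk γ') := by
    apply mul_left_cancel₀ hpi
    have : F 1 = F' 0 + 2 * Real.pi * Complex.I * n (Path.Homotopic.Quotient.mk γ') + 2 * Real.pi *
        Complex.I * n (Path.Homotopic.Quotient.mk γ) := by
      linear_combination e1 + h0 + e2
    linear_combination this - e3
  rw [← ofAdd_add]
  refine congrArg Multiplicative.ofAdd ?_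
  exact_mod_cast e4

/-- The winding number about zero of the image of a loop under a nowhere vanishing function. -/
def winding (f : C(X, {z : ℂ // z ≠ 0})) (x₀ : X) : FundamentalGroup X x₀ →* Multiplicative ℤ :=
  (exists_winding f x₀).choose

lemma winding_spec (f : C(X, {z : ℂ // z ≠ 0})) {x₀ : X} (γ : Path x₀ x₀) (F : C(I, ℂ))
    (hF : ∀ t, Complex.exp (F t) = f (γ t)) :
    F 1 = F 0 + 2 * Real.pi * Complex.I *
      (winding f x₀ (FundamentalGroup.fromPath (.mk γ))).toAdd :=
  (exists_winding f x₀).choose_spec γ F hF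

lemma winding_imageLoop [PathConnectedSpace S] (f : C(X, {z : ℂ // z ≠ 0})) (θ : C(S, X)) {x₀ : X}
    {e₀ e : S} (h₀ : θ e₀ = x₀) (h : θ e = x₀) (F : C(S, ℂ))
    (hF : ∀ s, Complex.exp (F s) = f (θ s)) (n : ℤ)
    (hn : F e = F e₀ + 2 * Real.pi * Complex.I * n) :
    (winding f x₀ (imageLoop θ h₀ h)).toAdd = n := by
  have := winding_spec f
    (((PathConnectedSpace.somePath e₀ e).map θ.continuous).cast h₀.symm h.symm)
    (F.comp (PathConnectedSpace.somePath e₀ e)) (fun t => by simp [hF])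
  simp only [ContinuousMap.comp_apply, ContinuousMap.coe_coe, Path.target, Path.source, hn,
    add_right_inj] at this
  exact_mod_cast (mul_left_cancel₀ Complex.two_pi_I_ne_zero this).symm

/-- Monodromy multiplies an `N`-th root of `f` by the root of unity given by the winding number. -/
lemma root_monodromyPerm {E : Type*} [TopologicalSpace E] {p : E → X} (cov : IsCoveringMap p)
    (f : C(X, {z : ℂ // z ≠ 0})) {N : ℕ} (hN : N ≠ 0) (u : C(E, ℂ)) (hu : ∀ e, u e ^ N = f (p e))
    {x₀ : X} (g : FundamentalGroup X x₀) (ε : p ⁻¹' {x₀}) :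
    u (cov.monodromyPerm x₀ g ε).1 =
      u ε.1 * Complex.exp (2 * Real.pi * Complex.I * (winding f x₀ g).toAdd / N) := by
  obtain ⟨γ, rfl⟩ := Path.Homotopic.Quotient.mk_surjective g
  have hN' : (N : ℂ) ≠ 0 := Nat.cast_ne_zero.mpr hN
  have h0 : γ 0 = p ε.1 := γ.source.trans ε.2.symm
  obtain ⟨F, -, hF⟩ := exists_continuous_log (f.comp γ) (Complex.log (f (γ 0)))
    (by simpa using Complex.exp_log (f x₀).2)
  have hΓ (t) : p (cov.liftPath γ ε.1 h0 t) = γ t := congrFun (cov.liftPath_lifts γ ε.1 h0) t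
  -- Along the lifted path both `u` and `exp (F / N)` are `N`-th roots of `f`, so their ratio is
  -- constant.
  have hc := eq_of_pow_eq_one hN (h := fun t => u (cov.liftPath γ ε.1 h0 t) * Complex.exp
      (-(F t / N)))
    (by fun_prop) (fun t => by
      rw [mul_pow, hu, hΓ, ← Complex.exp_nat_mul, mul_neg, mul_div_cancel₀ _ hN', Complex.exp_neg,
        hF]
      exact mul_inv_cancel₀ (f (γ t)).2) 1 0
  have hs := winding_spec f γ F hF
  rw [cov.liftPath_zero, hs] at hc
  change u (cov.liftPath γ ε.1 h0 1) = _
  have e1 : u (cov.liftPath γ ε.1 h0 1) = u (cov.liftPath γ ε.1 h0 1) *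
      Complex.exp (-((F 0 + 2 * Real.pi * Complex.I *
        (winding f x₀ (FundamentalGroup.fromPath (.mk γ))).toAdd) / N)) *
      Complex.exp ((F 0 + 2 * Real.pi * Complex.I *
        (winding f x₀ (FundamentalGroup.fromPath (.mk γ))).toAdd) / N) := by
    rw [mul_assoc, ← Complex.exp_add, neg_add_cancel, Complex.exp_zero, mul_one]
  rw [e1, hc, mul_assoc, ← Complex.exp_add]
  congr 2
  change _ = 2 * Real.pi * Complex.I * (winding f x₀ (FundamentalGroup.fromPath (.mk γ))).toAdd / N
  ring

end Winding

end CoveringAux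

end

noncomputable section

/-! ### The model exterior and the sheet over one slit piece. -/

namespace TorusExterior

open Complex CoveringAux

/-- The point of the unit circle with argument `t`. -/
def rot (t : ℝ) : ℂ := exp (t * I)

lemma continuous_rot : Continuous rot := by unfold rot; fun_prop

attribute [fun_prop] continuous_rot

lemma rot_zero : rot 0 = 1 := by simp [rot]

lemma rot_pi : rot Real.pi = -1 := by simp [rot]

lemma rot_add (s t : ℝ) : rot (s + t) = rot s * rot t := by
  rw [rot, rot, rot, ← exp_add]; push_cast; ring_nf

lemma rot_pow (t : ℝ) (n : ℕ) : rot t ^ n = rot (n * t) := by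
  rw [rot, rot, ← exp_nat_mul]; push_cast; ring_nf

lemma rot_ne_zero (t : ℝ) : rot t ≠ 0 := exp_ne_zero _

lemma norm_rot (t : ℝ) : ‖rot t‖ = 1 := norm_exp_ofReal_mul_I t

lemma rot_int (k : ℤ) : rot (2 * Real.pi * k) = 1 := by
  rw [rot, exp_eq_one_iff]
  exact ⟨k, by push_cast; ring⟩

lemma rot_eq_rot_iff {s t : ℝ} : rot s = rot t ↔ ∃ k : ℤ, s = t + 2 * Real.pi * k := by
  rw [rot, rot, exp_eq_exp_iff_exists_int]
  refine exists_congr fun k => ⟨fun h => ?_, fun h => by rw [h]; push_cast; ring⟩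
  have : (s : ℂ) = ((t + 2 * Real.pi * k : ℝ) : ℂ) := by
    apply mul_right_cancel₀ I_ne_zero
    rw [h]; push_cast; ring
  exact_mod_cast this

lemma conj_rot (t : ℝ) : (starRingEnd ℂ) (rot t) * rot t = 1 := by
  rw [← normSq_eq_conj_mul_self, normSq_eq_norm_sq, norm_rot]; simp

lemma norm_mul_rot_arg (z : ℂ) : ‖z‖ * rot (arg z) = z := norm_mul_exp_arg_mul_I z

lemma ofReal_mul_mem_slitPlane {r : ℝ} (hr : 0 < r) {z : ℂ} : r * z ∈ slitPlane ↔ z ∈ slitPlane :=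
    by
  simp [mem_slitPlane_iff, hr, hr.ne']

/-- The exterior of the torus knot in the sphere of radius `√2`, as the complement of a curve. -/
abbrev Ext (a b : ℕ) : Type := {x : ℂ × ℂ // ‖x.1‖ ^ 2 + ‖x.2‖ ^ 2 = 2 ∧ x.2 ^ a ≠ x.1 ^ b}

variable (a b : ℕ)

/-- The defining equation of the knot, as a function on the exterior. -/
def defect : C(Ext a b, {z : ℂ // z ≠ 0}) where
  toFun x := ⟨x.1.2 ^ a - x.1.1 ^ b, sub_ne_zero.mpr x.2.2⟩
  continuous_toFun := by fun_prop

/-- Exchange of the coordinates. -/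
def swap : C(Ext b a, Ext a b) where
  toFun x := ⟨x.1.swap, (add_comm _ _).trans x.2.1, x.2.2.symm⟩
  continuous_toFun := by fun_prop

lemma swap_swap (x : Ext a b) : swap a b (swap b a x) = x := rfl

/-- The modulus of the coordinate complementary to `ω`. -/
def radius (ω : ℂ) : ℝ := √(2 - ‖ω‖ ^ 2)

@[fun_prop]
lemma continuous_radius : Continuous radius := by unfold radius; fun_prop

lemma radius_pos {ω : ℂ} (h : ‖ω‖ ^ 2 < 2) : 0 < radius ω := Real.sqrt_pos.mpr (by linarith)

lemma radius_sq {ω : ℂ} (h : ‖ω‖ ^ 2 < 2) : radius ω ^ 2 = 2 - ‖ω‖ ^ 2 := Real.sq_sqrt (by linarith)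

lemma radius_mul_rot (ω : ℂ) (t : ℝ) : radius (ω * rot t) = radius ω := by
  simp [radius, norm_rot]

/-- The universal cover of the complement of a slit neighbourhood of the core `z = 0`. -/
def sheet : Set (ℝ × ℂ) := {q | ‖q.2‖ ^ 2 < 2 ∧ (radius q.2 : ℂ) ^ b - q.2 ^ a ∈ slitPlane}

lemma isOpen_sheet : IsOpen (sheet a b) := by
  have h1 : IsOpen {q : ℝ × ℂ | ‖q.2‖ ^ 2 < 2} := isOpen_lt (by fun_prop) (by fun_prop)
  have h2 : Continuous fun q : ℝ × ℂ => (radius q.2 : ℂ) ^ b - q.2 ^ a := by fun_prop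
  exact h1.inter (isOpen_slitPlane.preimage h2)

variable {a b}

/-- Scaling `ω` by `t` multiplies `ω ^ a` by `t ^ a` and does not decrease the radius. A nonzero
imaginary part stays nonzero and a positive real part stays positive. -/
lemma starConvex_sheet (ha : a ≠ 0) : StarConvex ℝ 0 (sheet a b) := by
  rw [starConvex_zero_iff]
  rintro ⟨s, ω⟩ ⟨h1, h2⟩ t ht0 ht1
  simp only at h1 h2
  have hn : ‖(t : ℂ) * ω‖ ^ 2 ≤ ‖ω‖ ^ 2 := by
    rw [norm_mul, mul_pow, norm_real, Real.norm_eq_abs, sq_abs]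
    have : t ^ 2 ≤ 1 := pow_le_one₀ ht0 ht1
    nlinarith [sq_nonneg ‖ω‖]
  have hr : radius ω ^ b ≤ radius (t * ω) ^ b := by
    refine pow_le_pow_left₀ (Real.sqrt_nonneg _) (Real.sqrt_le_sqrt (by linarith)) b
  have hpos : 0 < radius ω ^ b := pow_pos (radius_pos h1) b
  refine ⟨by simpa using hn.trans_lt h1, ?_⟩
  simp only [Prod.smul_mk, real_smul, mul_pow]
  rcases ht0.eq_or_lt with rfl | ht
  · have : ((radius (0 : ℂ) : ℂ)) ^ b ∈ slitPlane := by
      rw [← ofReal_pow]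
      exact ofReal_mem_slitPlane.mpr (pow_pos (radius_pos (by simp)) b)
    simpa [ha] using this
  · simp only [mem_slitPlane_iff, ← ofReal_pow, sub_re, sub_im, ofReal_re, ofReal_im, re_ofReal_mul,
      im_ofReal_mul, zero_sub, neg_ne_zero] at h2 ⊢
    have hta : 0 < t ^ a := pow_pos ht a
    rcases h2 with h2 | h2
    · left
      have hta1 : t ^ a ≤ 1 := pow_le_one₀ ht0 ht1
      rcases le_or_gt (ω ^ a).re 0 with h3 | h3 <;> nlinarith
    · right
      exact mul_ne_zero hta.ne' h2

lemma zero_mem_sheet (ha : a ≠ 0) : (0 : ℝ × ℂ) ∈ sheet a b := by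
  refine ⟨by simp, ?_⟩
  simp only [Prod.snd_zero, zero_pow ha, sub_zero, ← ofReal_pow]
  exact ofReal_mem_slitPlane.mpr (pow_pos (radius_pos (by simp)) b)

lemma simplyConnectedSpace_sheet (ha : a ≠ 0) : SimplyConnectedSpace (sheet a b) :=
  have := (starConvex_sheet (b := b) ha).contractibleSpace ⟨0, zero_mem_sheet ha⟩
  inferInstance

variable (a b) in
instance : LocallyPathConnectedSpace (sheet a b) := (isOpen_sheet a b).locallyPathConnectedSpace

/-- Both monomials acquire the common phase `rot (a * b * s)`, so the slit condition involves `ω`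
alone. -/
lemma monomial_sub_monomial (s : ℝ) (ω : ℂ) : (ω * rot (b * s)) ^ a - (radius ω * rot (a * s)) ^ b =
    - (rot (a * b * s) * (radius ω ^ b - ω ^ a)) := by
  rw [mul_pow, mul_pow, rot_pow, rot_pow]
  ring_nf

variable (a b) in
/-- The sheet covers the complement of a slit neighbourhood of the core `z = 0`. -/
def sheetMap : C(sheet a b, Ext a b) where
  toFun q := ⟨(radius q.1.2 * rot (a * q.1.1), q.1.2 * rot (b * q.1.1)), by
    simp [norm_rot, radius_sq q.2.1], by
      rw [← sub_ne_zero, monomial_sub_monomial]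
      exact neg_ne_zero.mpr (mul_ne_zero (rot_ne_zero _) (slitPlane_ne_zero q.2.2))⟩
  continuous_toFun := by fun_prop

variable (a b) in
/-- The deck transformations of the sheet. -/
def sheetDeck [NeZero a] (k : ℤ) : C(sheet a b, sheet a b) where
  toFun q := ⟨(q.1.1 + 2 * Real.pi * k / a, q.1.2 * rot (-(2 * Real.pi * k * b / a))), by
    refine ⟨by simpa [norm_rot] using q.2.1, ?_⟩
    have : rot (-(2 * Real.pi * k * b / a)) ^ a = 1 := by
      rw [rot_pow, ← rot_int (-(k * b))]
      congr 1
      have : (a : ℝ) ≠ 0 := NeZero.ne _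
      push_cast
      field_simp
    simpa [radius_mul_rot, mul_pow, this] using q.2.2⟩
  continuous_toFun := by fun_prop

lemma sheetMap_sheetDeck [NeZero a] (k : ℤ) (q : sheet a b) :
    sheetMap a b (sheetDeck a b k q) = sheetMap a b q := by
  have ha : (a : ℝ) ≠ 0 := NeZero.ne _
  refine Subtype.ext (Prod.ext ?_ ?_)
  · change (radius (q.1.2 * _) : ℂ) * rot (a * (q.1.1 + 2 * Real.pi * k / a)) =
        radius q.1.2 * rot (a * q.1.1)
    rw [radius_mul_rot, mul_add, mul_div_cancel₀ _ ha, rot_add, rot_int, mul_one]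
  · change q.1.2 * rot _ * rot (b * (q.1.1 + 2 * Real.pi * k / a)) = q.1.2 * rot (b * q.1.1)
    rw [mul_assoc, ← rot_add]
    congr 2
    ring

lemma sheetDeck_add [NeZero a] (k l : ℤ) (q : sheet a b) :
    sheetDeck a b (k + l) q = sheetDeck a b k (sheetDeck a b l q) := by
  refine Subtype.ext (Prod.ext ?_ ?_)
  · change _ + _ = _ + _ + _
    push_cast
    ring
  · change q.1.2 * rot _ = q.1.2 * rot _ * rot _
    rw [mul_assoc q.1.2, ← rot_add]
    congr 2
    push_cast
    ring

lemma sheetDeck_zero [NeZero a] (q : sheet a b) : sheetDeck a b 0 q = q :=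
  Subtype.ext (Prod.ext (by simp [sheetDeck]) (by simp [sheetDeck, rot_zero]))

lemma norm_sheetMap_fst (q : sheet a b) : ‖(sheetMap a b q).1.1‖ = radius q.1.2 := by
  simp [sheetMap, norm_rot, abs_of_pos (radius_pos q.2.1)]

/-- The first coordinate fixes the radius and the phase `a * s` modulo `2π`, hence `s` modulo `2π /
a`; the second coordinate then determines `ω`. -/
lemma exists_sheetDeck_eq [NeZero a] {q q' : sheet a b} (h : sheetMap a b q' = sheetMap a b q) :
    ∃ k : ℤ, q' = sheetDeck a b k q := by
  have ha : (a : ℝ) ≠ 0 := NeZero.ne _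
  have hr : radius q'.1.2 = radius q.1.2 := by rw [← norm_sheetMap_fst, ← norm_sheetMap_fst, h]
  have h1 : (radius q'.1.2 : ℂ) * rot (a * q'.1.1) = radius q.1.2 * rot (a * q.1.1) :=
    congrArg (fun x => x.1.1) h
  have h2 : q'.1.2 * rot (b * q'.1.1) = q.1.2 * rot (b * q.1.1) := congrArg (fun x => x.1.2) h
  rw [hr] at h1
  obtain ⟨k, hk⟩ := rot_eq_rot_iff.mp
    (mul_left_cancel₀ (ofReal_ne_zero.mpr (radius_pos q.2.1).ne') h1)
  have hs : q'.1.1 = q.1.1 + 2 * Real.pi * k / a := by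
    field_simp
    linarith
  refine ⟨k, Subtype.ext (Prod.ext hs ?_)⟩
  change q'.1.2 = q.1.2 * rot _
  apply mul_right_cancel₀ (rot_ne_zero (b * q'.1.1))
  rw [h2, mul_assoc, ← rot_add, hs]
  congr 2
  ring

variable (a b) in
/-- The image of the sheet. -/
def slitExt : Set (Ext a b) := {x | (starRingEnd ℂ) x.1.1 ^ b * (x.1.1 ^ b - x.1.2 ^ a) ∈ slitPlane}

lemma isOpen_slitExt : IsOpen (slitExt a b) := isOpen_slitPlane.preimage (by fun_prop)

/-- The factor `conj z ^ b` in `slitExt` removes the common phase and leaves a positive multiple of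
the expression defining the sheet. -/
lemma sheetMap_mem (q : sheet a b) : sheetMap a b q ∈ slitExt a b := by
  have h := monomial_sub_monomial (a := a) (b := b) q.1.1 q.1.2
  have e : (starRingEnd ℂ) (radius q.1.2 * rot (a * q.1.1)) ^ b *
      ((radius q.1.2 * rot (a * q.1.1)) ^ b -
      (q.1.2 * rot (b * q.1.1)) ^ a) = ((radius q.1.2 ^ b : ℝ) : ℂ) *
          (radius q.1.2 ^ b - q.1.2 ^ a) := by
    rw [← neg_sub, h, neg_neg, map_mul, conj_ofReal, mul_pow, ofReal_pow]
    have e2 : rot (a * b * q.1.1) = rot (a * q.1.1) ^ b := by rw [rot_pow]; ring_nf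
    rw [e2, ← mul_assoc, mul_assoc (_ ^ b) (_ ^ b) (_ ^ b), ← mul_pow, conj_rot, one_pow, mul_one]
  change _ ∈ slitPlane
  simp only [sheetMap, ContinuousMap.coe_mk]
  rw [e]
  exact (ofReal_mul_mem_slitPlane (pow_pos (radius_pos q.2.1) b)).mpr q.2.2

/-- A choice of argument of the first coordinate gives a preimage in the sheet. -/
lemma mem_sheet_of_arg {x : Ext a b} (hb : b ≠ 0) (hx : x ∈ slitExt a b) {s : ℝ}
    (hs : x.1.1 = ‖x.1.1‖ * rot (a * s)) :
    radius (x.1.2 * rot (-(b * s))) = ‖x.1.1‖ ∧ (s, x.1.2 * rot (-(b * s))) ∈ sheet a b := by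
  have hz : x.1.1 ≠ 0 := by
    intro h
    apply slitPlane_ne_zero hx
    simp [h, hb]
  have hz' : 0 < ‖x.1.1‖ := norm_pos_iff.mpr hz
  have hr : radius (x.1.2 * rot (-(b * s))) = ‖x.1.1‖ := by
    rw [radius_mul_rot, radius, ← eq_sub_of_add_eq x.2.1, Real.sqrt_sq hz'.le]
  refine ⟨hr, ?_, ?_⟩
  · have := x.2.1
    simp only [norm_mul, norm_rot, mul_one]
    nlinarith
  · have h1 := hx
    change _ ∈ slitPlane at h1
    have hw : x.1.2 = x.1.2 * rot (-(b * s)) * rot (b * s) := by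
      rw [mul_assoc, ← rot_add, neg_add_cancel, rot_zero, mul_one]
    generalize x.1.2 * rot (-(b * s)) = ω at hw hr
    have h := monomial_sub_monomial (a := a) (b := b) s ω
    rw [hr, ← hs, ← hw] at h
    simp only
    rw [hr]
    rw [← neg_sub, h, neg_neg, hs] at h1
    have e2 : rot (a * b * s) = rot (a * s) ^ b := by rw [rot_pow]; ring_nf
    rw [e2, map_mul, conj_ofReal, mul_pow, ← mul_assoc, mul_assoc (_ ^ b) (_ ^ b) (_ ^ b),
        ← mul_pow,
      conj_rot, one_pow, mul_one, ← ofReal_pow, norm_mul, norm_rot, norm_real, norm_norm, mul_one]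
          at h1
    exact (ofReal_mul_mem_slitPlane (pow_pos hz' b)).mp h1

lemma sheetMap_of_arg {x : Ext a b} (hb : b ≠ 0) (hx : x ∈ slitExt a b) {s : ℝ}
    (hs : x.1.1 = ‖x.1.1‖ * rot (a * s)) :
    sheetMap a b ⟨_, (mem_sheet_of_arg hb hx hs).2⟩ = x := by
  refine Subtype.ext (Prod.ext ?_ ?_)
  · change (radius (x.1.2 * rot (-(b * s))) : ℂ) * rot (a * s) = _
    rw [(mem_sheet_of_arg hb hx hs).1, ← hs]
  · change x.1.2 * rot (-(b * s)) * rot (b * s) = _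
    rw [mul_assoc, ← rot_add, neg_add_cancel, rot_zero, mul_one]

lemma range_sheetMap [NeZero a] (hb : b ≠ 0) : Set.range (sheetMap a b) = slitExt a b := by
  refine Set.Subset.antisymm (Set.range_subset_iff.mpr sheetMap_mem) fun x hx => ?_
  have ha : (a : ℝ) ≠ 0 := NeZero.ne _
  exact ⟨_, sheetMap_of_arg hb hx (s := arg x.1.1 / a) (by
    rw [mul_div_cancel₀ _ ha, norm_mul_rot_arg])⟩

lemma isPathConnected_slitExt [NeZero a] (hb : b ≠ 0) : IsPathConnected (slitExt a b) := by
  have := simplyConnectedSpace_sheet (b := b) (NeZero.ne a)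
  rw [← range_sheetMap hb]
  exact isPathConnected_range (sheetMap a b).continuous

/-- A continuous logarithm of the first coordinate gives `s`, and `ω` is then explicit. Paths are
thus lifted without proving that `sheetMap` is a covering map. -/
lemma exists_lift_sheetMap [NeZero a] (hb : b ≠ 0) (γ : C(unitInterval, Ext a b))
    (hγ : ∀ t, γ t ∈ slitExt a b)
    (q : sheet a b) (hq : sheetMap a b q = γ 0) :
    ∃ Γ : C(unitInterval, sheet a b), Γ 0 = q ∧ ∀ t, sheetMap a b (Γ t) = γ t := by
  have ha : (a : ℝ) ≠ 0 := NeZero.ne _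
  have hz (t) : (γ t).1.1 ≠ 0 := by
    intro h
    apply slitPlane_ne_zero (hγ t)
    simp [h, hb]
  have hrpos := radius_pos q.2.1
  obtain ⟨L, hL0, hL⟩ := exists_continuous_log ⟨fun t => ⟨(γ t).1.1, hz t⟩, by fun_prop⟩
    (Real.log (radius q.1.2) + (a * q.1.1 : ℝ) * I) (by
      rw [exp_add, ← ofReal_exp, Real.exp_log hrpos]
      exact congrArg (fun x => x.1.1) hq)
  have hs (t) : (γ t).1.1 = ‖(γ t).1.1‖ * rot (a * ((L t).im / a)) := by
    have h := hL t
    simp only [ContinuousMap.coe_mk] at h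
    rw [mul_div_cancel₀ _ ha, ← h, norm_exp, rot, ofReal_exp, ← exp_add, re_add_im]
  refine ⟨⟨fun t => ⟨_, (mem_sheet_of_arg hb (hγ t) (hs t)).2⟩, by fun_prop⟩, ?_, fun t =>
    sheetMap_of_arg hb (hγ t) (hs t)⟩
  have h0 : (L 0).im / a = q.1.1 := by
    rw [hL0, add_im, ofReal_im, im_ofReal_mul, I_im]
    field_simp
    ring
  refine Subtype.ext (Prod.ext h0 ?_)
  change (γ 0).1.2 * rot (-(b * ((L 0).im / a))) = q.1.2
  rw [h0, ← hq]
  change q.1.2 * rot (b * q.1.1) * _ = _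
  rw [mul_assoc, ← rot_add, add_neg_cancel, rot_zero, mul_one]

variable (a b) in
/-- A logarithm of the defining equation on the sheet. -/
def sheetLog : C(sheet a b, ℂ) where
  toFun q := (a * b * q.1.1 : ℝ) * I + Real.pi * I + log (radius q.1.2 ^ b - q.1.2 ^ a)
  continuous_toFun := by
    refine Continuous.add (by fun_prop) (Continuous.clog (by fun_prop) fun q => q.2.2)

lemma exp_sheetLog (q : sheet a b) : exp (sheetLog a b q) = defect a b (sheetMap a b q) := by
  change exp _ = (q.1.2 * rot (b * q.1.1)) ^ a - (radius q.1.2 * rot (a * q.1.1)) ^ b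
  rw [monomial_sub_monomial]
  simp only [sheetLog, ContinuousMap.coe_mk]
  -- The summand `π * I` of `sheetLog` accounts for the minus sign in `monomial_sub_monomial`.
  rw [exp_add, exp_add, exp_pi_mul_I, exp_log (slitPlane_ne_zero q.2.2), rot]
  ring

lemma sheetLog_sheetDeck [NeZero a] (q : sheet a b) :
    sheetLog a b (sheetDeck a b 1 q) = sheetLog a b q + 2 * Real.pi * I * (b : ℤ) := by
  have ha : (a : ℂ) ≠ 0 := NeZero.ne _
  have : rot (-(2 * Real.pi * (1 : ℤ) * b / a)) ^ a = 1 := by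
    rw [rot_pow, ← rot_int (-b)]
    congr 1
    have : (a : ℝ) ≠ 0 := NeZero.ne _
    push_cast
    field_simp
  simp only [sheetLog, sheetDeck, ContinuousMap.coe_mk, radius_mul_rot, mul_pow, this, mul_one]
  push_cast
  field_simp
  ring

end TorusExterior

end

noncomputable section

/-! ### The two slit pieces and their intersection. -/

namespace TorusExterior

open Complex CoveringAux

variable {a b : ℕ}

variable (a b) in
/-- The complement of a slit neighbourhood of the other core. -/
def slitExt' : Set (Ext a b) := swap b a ⁻¹' slitExt b a

lemma isOpen_slitExt' : IsOpen (slitExt' a b) := isOpen_slitExt.preimage (swap b a).continuous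

lemma isPathConnected_slitExt' [NeZero b] (ha : a ≠ 0) : IsPathConnected (slitExt' a b) := by
  have : slitExt' a b = swap a b '' slitExt b a := by
    ext x
    exact ⟨fun h => ⟨_, h, rfl⟩, by rintro ⟨y, hy, rfl⟩; exact hy⟩
  rw [this]
  exact (isPathConnected_slitExt ha).image (swap a b).continuous

/-- The Hermitian pairing of the two monomials whose difference defines the knot. -/
def pairing (x : Ext a b) : ℂ := (starRingEnd ℂ) (x.1.1 ^ b) * x.1.2 ^ a

lemma mem_slitExt {x : Ext a b} :
    x ∈ slitExt a b ↔ (pairing x).re < normSq (x.1.1 ^ b) ∨ (pairing x).im ≠ 0 := by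
  have : (starRingEnd ℂ) x.1.1 ^ b * (x.1.1 ^ b - x.1.2 ^ a) = normSq (x.1.1 ^ b) - pairing x := by
    rw [mul_sub, ← map_pow, ← normSq_eq_conj_mul_self, pairing]
  change _ ∈ slitPlane ↔ _
  rw [this, mem_slitPlane_iff]
  simp only [sub_re, sub_im, ofReal_re, ofReal_im, sub_pos, zero_sub, neg_ne_zero]

lemma mem_slitExt' {x : Ext a b} :
    x ∈ slitExt' a b ↔ (pairing x).re < normSq (x.1.2 ^ a) ∨ (pairing x).im ≠ 0 := by
  have h : pairing (swap b a x) = (starRingEnd ℂ) (pairing x) := by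
    simp [pairing, swap, mul_comm]
  change swap b a x ∈ slitExt b a ↔ _
  rw [mem_slitExt, h]
  simp [swap]

/-- This is `0 < |z ^ b - w ^ a|²` expanded. A point outside both slit pieces would violate it, so
the pieces cover the exterior. -/
lemma normSq_sub_pos (x : Ext a b) :
    2 * (pairing x).re < normSq (x.1.1 ^ b) + normSq (x.1.2 ^ a) := by
  have h := normSq_pos.mpr (sub_ne_zero.mpr x.2.2.symm)
  have e : (pairing x).re = (x.1.1 ^ b * (starRingEnd ℂ) (x.1.2 ^ a)).re := by
    rw [← conj_re]
    simp [pairing]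
  rw [normSq_sub, ← e] at h
  linarith

lemma slitExt_union : slitExt a b ∪ slitExt' a b = Set.univ := by
  refine Set.eq_univ_of_forall fun x => ?_
  by_contra h
  rw [Set.mem_union, mem_slitExt, mem_slitExt'] at h
  push Not at h
  linarith [normSq_sub_pos x, h.1.1, h.2.1]

lemma mem_slitExt_inter {x : Ext a b} :
    x ∈ slitExt a b ∩ slitExt' a b ↔ -pairing x ∈ slitPlane := by
  rw [Set.mem_inter_iff, mem_slitExt, mem_slitExt', mem_slitPlane_iff]
  have h1 := normSq_nonneg (x.1.1 ^ b)
  have h2 := normSq_nonneg (x.1.2 ^ a)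
  have h3 : normSq (pairing x) = normSq (x.1.1 ^ b) * normSq (x.1.2 ^ a) := by
    rw [pairing, normSq_mul, normSq_conj]
  rw [normSq_apply] at h3
  simp only [neg_re, neg_im, neg_ne_zero, neg_pos]
  by_cases him : (pairing x).im = 0
  · simp only [him, ne_eq, not_true_eq_false, or_false]
    refine ⟨fun h => ?_, fun h => ⟨by linarith, by linarith⟩⟩
    -- If the pairing is real and nonnegative, its square is `|z ^ b|² * |w ^ a|²`, so it cannot be
    -- smaller than both factors.
    by_contra hre
    rw [him] at h3
    nlinarith [h.1, h.2]
  · simp [him]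

/-- The intersection is where the pairing avoids the nonnegative reals. It is the image of a convex
set of triples: position `s` along the flow, modulus `r` of `w`, and phase `φ` of the pairing in the
open interval from `0` to `2π`. -/
lemma isPathConnected_slitExt_inter [NeZero a] [NeZero b] (hab : a.Coprime b) :
    IsPathConnected (slitExt a b ∩ slitExt' a b) := by
  have ha : (a : ℝ) ≠ 0 := NeZero.ne _
  have hpi := Real.pi_pos
  let D : Set (ℝ × ℝ × ℝ) := Set.univ ×ˢ Set.Ioo 0 √2 ×ˢ Set.Ioo 0 (2 * Real.pi)
  have hD : IsPathConnected D :=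
    ((convex_univ.prod ((convex_Ioo _ _).prod (convex_Ioo _ _)))).isPathConnected
      ⟨(0, 1, Real.pi), trivial, ⟨by simp, Real.lt_sqrt_of_sq_lt (by norm_num)⟩,
        ⟨hpi, by linarith⟩⟩
  have := isPathConnected_iff_pathConnectedSpace.mp hD
  have hlt (d : D) : d.1.2.1 ^ 2 < 2 := (Real.lt_sqrt d.2.2.1.1.le).mp d.2.2.1.2
  have hpair (s r φ : ℝ) : (starRingEnd ℂ) ((√(2 - r ^ 2) * rot (a * s)) ^ b) *
      (r * rot (b * s + φ / a)) ^ a = (√(2 - r ^ 2) ^ b * r ^ a : ℝ) * rot φ := by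
    have e1 : rot (b * s + φ / a) ^ a = rot (a * s) ^ b * rot φ := by
      rw [rot_pow, rot_pow, ← rot_add]
      congr 1
      field_simp
    rw [mul_pow, mul_pow, e1, map_mul]
    have e2 : (starRingEnd ℂ) (rot (a * s) ^ b) * rot (a * s) ^ b = 1 := by
      rw [map_pow, ← mul_pow, conj_rot, one_pow]
    rw [← ofReal_pow, conj_ofReal]
    push_cast
    linear_combination (√(2 - r ^ 2) : ℂ) ^ b * r ^ a * rot φ * e2
  have hslit {φ : ℝ} (h0 : 0 < φ) (h1 : φ < 2 * Real.pi) : - rot φ ∈ slitPlane := by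
    have e : - rot φ = rot (φ - Real.pi) := by
      rw [← mul_left_inj' (rot_ne_zero Real.pi), ← rot_add, rot_pi]
      simp
    rw [e, rot, mem_slitPlane_iff_arg, arg_exp_mul_I,
        (toIocMod_eq_self _).mpr ⟨by linarith, by linarith⟩]
    exact ⟨by linarith, exp_ne_zero _⟩
  let f : D → Ext a b := fun d => ⟨(√(2 - d.1.2.1 ^ 2) * rot (a * d.1.1),
      d.1.2.1 * rot (b * d.1.1 + d.1.2.2 / a)), by
    have := hlt d
    simp only [norm_mul, norm_rot, norm_real, mul_one, Real.norm_eq_abs, sq_abs]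
    rw [Real.sq_sqrt (by linarith)]
    ring, fun h => by
      have := hpair d.1.1 d.1.2.1 d.1.2.2
      rw [h, ← normSq_eq_conj_mul_self] at this
      have hpos : 0 < √(2 - d.1.2.1 ^ 2) ^ b * d.1.2.1 ^ a :=
        mul_pos (pow_pos (Real.sqrt_pos.mpr (by linarith [hlt d])) b) (pow_pos d.2.2.1.1 a)
      have h2 := (ofReal_mul_mem_slitPlane hpos).mpr (hslit d.2.2.2.1 d.2.2.2.2)
      rw [mul_neg, ← this, ← ofReal_neg, ofReal_mem_slitPlane] at h2
      linarith [normSq_nonneg ((√(2 - d.1.2.1 ^ 2) * rot (a * d.1.1)) ^ b)]⟩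
  have hf : Continuous f := by
    refine Continuous.subtype_mk ?_ _
    fun_prop
  have hrange : Set.range f = slitExt a b ∩ slitExt' a b := by
    ext x
    rw [mem_slitExt_inter]
    constructor
    · rintro ⟨d, rfl⟩
      have hpos : 0 < √(2 - d.1.2.1 ^ 2) ^ b * d.1.2.1 ^ a :=
        mul_pos (pow_pos (Real.sqrt_pos.mpr (by linarith [hlt d])) b) (pow_pos d.2.2.1.1 a)
      change -((starRingEnd ℂ) ((√(2 - d.1.2.1 ^ 2) * rot (a * d.1.1)) ^ b) *
      (d.1.2.1 * rot (b * d.1.1 + d.1.2.2 / a)) ^ a) ∈ _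
      rw [hpair, ← mul_neg]
      exact (ofReal_mul_mem_slitPlane hpos).mpr (hslit d.2.2.2.1 d.2.2.2.2)
    · intro hx
      have hne : pairing x ≠ 0 := fun h => slitPlane_ne_zero hx (by rw [h, neg_zero])
      have hz : x.1.1 ≠ 0 := by
        rintro h
        simp [pairing, h, NeZero.ne b] at hne
      have hw : x.1.2 ≠ 0 := by
        rintro h
        simp [pairing, h, NeZero.ne a] at hne
      have hw0 := norm_pos_iff.mpr hw
      have hz0 := norm_pos_iff.mpr hz
      have hw2 : ‖x.1.2‖ ^ 2 < 2 := by nlinarith [x.2.1]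
      have hsq : √(2 - ‖x.1.2‖ ^ 2) = ‖x.1.1‖ := by
        rw [← eq_sub_of_add_eq x.2.1, Real.sqrt_sq hz0.le]
      let ψ : ℝ := a * (arg x.1.2 - b * (arg x.1.1 / a))
      obtain ⟨m, hm, -⟩ := existsUnique_add_zsmul_mem_Ico (by positivity : 0 < 2 * Real.pi) ψ 0
      rw [zero_add, zsmul_eq_mul] at hm
      -- By coprimality, changing the arguments of `z` and `w` by multiples of `2π` realizes every
      -- shift of `ψ` by a multiple of `2π`.
      obtain ⟨k, l, hkl⟩ : ∃ k l : ℤ, m = a * l - b * k := by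
        have h := Nat.isCoprime_iff_coprime.mpr hab
        obtain ⟨i, j, hij⟩ := h
        exact ⟨-(m * j), m * i, by linear_combination -m * hij⟩
      let s : ℝ := arg x.1.1 / a + 2 * Real.pi * k / a
      let φ : ℝ := ψ + m * (2 * Real.pi)
      have e1 : rot (a * s) = rot (arg x.1.1) :=
        rot_eq_rot_iff.mpr ⟨k, by simp only [s]; field_simp⟩
      have e2 : rot (b * s + φ / a) = rot (arg x.1.2) := by
        refine rot_eq_rot_iff.mpr ⟨l, ?_⟩
        simp only [s, φ, ψ, hkl]
        push_cast
        field_simp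
        ring
      -- Phase zero would make the pairing a positive real, which the slit excludes.
      have hφ : φ ≠ 0 := by
        intro h
        have hp := hpair s ‖x.1.2‖ φ
        rw [e1, e2, hsq, norm_mul_rot_arg, norm_mul_rot_arg, h, rot_zero, mul_one] at hp
        change pairing x = _ at hp
        rw [hp, ← ofReal_neg, ofReal_mem_slitPlane] at hx
        have : 0 < ‖x.1.1‖ ^ b * ‖x.1.2‖ ^ a := by positivity
        linarith
      refine ⟨⟨(s, ‖x.1.2‖, φ), trivial, ⟨hw0, (Real.lt_sqrt hw0.le).mpr hw2⟩,
        lt_of_le_of_ne hm.1 hφ.symm, hm.2⟩, Subtype.ext (Prod.ext ?_ ?_)⟩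
      · change (√(2 - ‖x.1.2‖ ^ 2) : ℂ) * rot (a * s) = _
        rw [e1, hsq, norm_mul_rot_arg]
      · change (‖x.1.2‖ : ℂ) * rot (b * s + φ / a) = _
        rw [e2, norm_mul_rot_arg]
  rw [← hrange]
  exact isPathConnected_range hf

lemma radius_rot (t : ℝ) : radius (rot t) = 1 := by
  rw [radius, norm_rot]
  norm_num

variable (a b) in
-- Here the slit expression is `1 + 1`, for every `s`. Both sheets thus contain the whole vertical
-- line over the flow orbit of the base point.
lemma mem_sheet_of_pow_eq_neg_one {s t : ℝ} (h : rot t ^ a = -1) : (s, rot t) ∈ sheet a b := by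
  refine ⟨by simp [norm_rot], ?_⟩
  simp only [radius_rot, h, ofReal_one, one_pow, sub_neg_eq_add]
  rw [← ofReal_one, ← ofReal_add, ofReal_mem_slitPlane]
  norm_num

/-! ### The two generators and their relation. -/

section Generators

variable (a b) [NeZero a] [NeZero b]

instance : SimplyConnectedSpace (sheet a b) := simplyConnectedSpace_sheet (NeZero.ne a)

lemma rot_pi_div_pow : rot (Real.pi / a) ^ a = -1 := by
  have ha : (a : ℝ) ≠ 0 := NeZero.ne _
  rw [rot_pow, mul_div_cancel₀ _ ha, rot_pi]

lemma rot_neg_pi_div_pow : rot (-(Real.pi / a)) ^ a = -1 := by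
  have ha : (a : ℝ) ≠ 0 := NeZero.ne _
  have h : rot (-Real.pi) = -1 := by
    rw [← mul_left_inj' (rot_ne_zero Real.pi), ← rot_add, rot_pi]
    simp [rot_zero]
  rw [rot_pow, mul_neg, mul_div_cancel₀ _ ha, h]

/-- The base point of the exterior. -/
def basePt : Ext a b := ⟨(1, rot (Real.pi / a)), by simp [norm_rot]; norm_num, by
  rw [rot_pi_div_pow, one_pow]
  norm_num⟩

/-- The base point of the first sheet. -/
def sheetPt : sheet a b := ⟨(0, rot (Real.pi / a)),
    mem_sheet_of_pow_eq_neg_one a b (rot_pi_div_pow a)⟩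

/-- The base point of the second sheet. -/
def sheetPt' : sheet b a :=
  ⟨(Real.pi / (a * b), rot (-(Real.pi / b))), mem_sheet_of_pow_eq_neg_one b a
      (rot_neg_pi_div_pow b)⟩

omit [NeZero b] in
lemma sheetMap_sheetPt : sheetMap a b (sheetPt a b) = basePt a b := by
  refine Subtype.ext (Prod.ext ?_ ?_) <;>
    simp [sheetMap, sheetPt, basePt, radius_rot, rot_zero]

variable {a b} in
/-- The second sheet map. -/
def sheetMap' : C(sheet b a, Ext a b) := (swap a b).comp (sheetMap b a)

lemma sheetMap'_sheetPt' : sheetMap' (sheetPt' a b) = basePt a b := by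
  have ha : (a : ℝ) ≠ 0 := NeZero.ne _
  have hb : (b : ℝ) ≠ 0 := NeZero.ne _
  refine Subtype.ext (Prod.ext ?_ ?_)
  · change rot (-(Real.pi / b)) * rot (a * (Real.pi / (a * b))) = 1
    rw [← rot_add, ← rot_zero]
    congr 1
    field_simp
    ring
  · change (radius (rot _) : ℂ) * rot (b * (Real.pi / (a * b))) = rot (Real.pi / a)
    rw [radius_rot, ofReal_one, one_mul]
    congr 1
    field_simp

end Generators

section Generators

lemma sheetMap'_sheetDeck [NeZero b] (k : ℤ) (q : sheet b a) :
    sheetMap' (sheetDeck b a k q) = sheetMap' (a := a) q :=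
  congrArg (swap a b) (sheetMap_sheetDeck k q)

variable (a b) [NeZero a] [NeZero b]

/-- The generator given by the core of the first sheet. -/
def genX : FundamentalGroup (Ext a b) (basePt a b) :=
  imageLoop (sheetMap a b) (sheetMap_sheetPt a b)
    ((sheetMap_sheetDeck 1 (sheetPt a b)).trans (sheetMap_sheetPt a b))

/-- The generator given by the core of the second sheet. -/
def genY : FundamentalGroup (Ext a b) (basePt a b) :=
  imageLoop sheetMap' (sheetMap'_sheetPt' a b)
    ((sheetMap'_sheetDeck 1 (sheetPt' a b)).trans (sheetMap'_sheetPt' a b))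

omit [NeZero b] in
lemma imageLoop_sheetDeck (k : ℤ) : imageLoop (sheetMap a b) (sheetMap_sheetPt a b)
    ((sheetMap_sheetDeck k (sheetPt a b)).trans (sheetMap_sheetPt a b)) = genX a b ^ k :=
  imageLoop_zpow _ _ (sheetDeck a b) sheetMap_sheetDeck sheetDeck_add sheetDeck_zero k

lemma imageLoop_sheetDeck' (k : ℤ) : imageLoop sheetMap' (sheetMap'_sheetPt' a b)
    ((sheetMap'_sheetDeck k (sheetPt' a b)).trans (sheetMap'_sheetPt' a b)) = genY a b ^ k :=
  imageLoop_zpow _ _ (sheetDeck b a) sheetMap'_sheetDeck sheetDeck_add sheetDeck_zero k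

omit [NeZero b] in
lemma winding_genX : (winding (defect a b) _ (genX a b)).toAdd = b :=
  winding_imageLoop _ _ _ _ (sheetLog a b) exp_sheetLog _ (sheetLog_sheetDeck _)

lemma winding_genY : (winding (defect a b) _ (genY a b)).toAdd = a := by
  -- Exchanging the coordinates changes the sign of the defining equation, hence the extra `π * I`.
  refine winding_imageLoop _ _ _ _ (sheetLog b a + .const _ (Real.pi * I)) (fun q => ?_) _ ?_
  · simp only [ContinuousMap.add_apply, ContinuousMap.const_apply, exp_add, exp_sheetLog,
      exp_pi_mul_I, defect, sheetMap', swap, ContinuousMap.coe_mk, ContinuousMap.comp_apply,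
      Prod.fst_swap, Prod.snd_swap]
    ring
  · simp only [ContinuousMap.add_apply, ContinuousMap.const_apply, sheetLog_sheetDeck]
    ring

/-- Both sides are the class of one loop: the closed orbit of the base point under the circle action
with weights `a`, `b`. It lifts to a vertical segment in each sheet. -/
lemma genX_pow : genX a b ^ a = genY a b ^ b := by
  have ha : (a : ℝ) ≠ 0 := NeZero.ne _
  have hb : (b : ℝ) ≠ 0 := NeZero.ne _
  rw [← zpow_natCast, ← zpow_natCast, ← imageLoop_sheetDeck, ← imageLoop_sheetDeck']
  let Γ : Path (sheetPt a b) (sheetDeck a b a (sheetPt a b)) :=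
    { toFun := fun t => ⟨(2 * Real.pi * t, rot (Real.pi / a)),
        mem_sheet_of_pow_eq_neg_one a b (rot_pi_div_pow a)⟩
      continuous_toFun := by fun_prop
      source' := by simp [sheetPt]
      target' := by
        refine Subtype.ext (Prod.ext ?_ ?_)
        · simp only [sheetPt, sheetDeck, ContinuousMap.coe_mk]
          push_cast
          field_simp
          simp
        · simp only [sheetPt, sheetDeck, ContinuousMap.coe_mk]
          have : rot (-(2 * Real.pi * ((a : ℤ) : ℝ) * b / a)) = 1 := by
            rw [← rot_int (-b)]
            congr 1
            push_cast
            field_simp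
          rw [this, mul_one] }
  let Γ' : Path (sheetPt' a b) (sheetDeck b a b (sheetPt' a b)) :=
    { toFun := fun t => ⟨(Real.pi / (a * b) + 2 * Real.pi * t, rot (-(Real.pi / b))),
        mem_sheet_of_pow_eq_neg_one b a (rot_neg_pi_div_pow b)⟩
      continuous_toFun := by fun_prop
      source' := by simp [sheetPt']
      target' := by
        refine Subtype.ext (Prod.ext ?_ ?_)
        · simp only [sheetPt', sheetDeck, ContinuousMap.coe_mk]
          push_cast
          field_simp
        · simp only [sheetPt', sheetDeck, ContinuousMap.coe_mk]
          have : rot (-(2 * Real.pi * ((b : ℤ) : ℝ) * a / b)) = 1 := by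
            rw [← rot_int (-a)]
            congr 1
            push_cast
            field_simp
          rw [this, mul_one] }
  rw [imageLoop_eq (sheetMap a b) (sheetMap_sheetPt a b) _ ((Γ.map (sheetMap a b).continuous).cast
    (sheetMap_sheetPt a b).symm ((sheetMap_sheetDeck a _).trans (sheetMap_sheetPt a b)).symm) Γ
    (fun _ => rfl)]
  refine (imageLoop_eq sheetMap' _ _ _ Γ' fun t => ?_).symm
  refine Subtype.ext (Prod.ext ?_ ?_)
  · change rot (-(Real.pi / b)) * rot (a * (Real.pi / (a * b) + 2 * Real.pi * t)) =
      radius (rot (Real.pi / a)) * rot (a * (2 * Real.pi * t))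
    rw [← rot_add, radius_rot, ofReal_one, one_mul]
    congr 1
    field_simp
    ring
  · change (radius (rot _) : ℂ) * rot (b * (Real.pi / (a * b) + 2 * Real.pi * t)) =
      rot (Real.pi / a) * rot (b * (2 * Real.pi * t))
    rw [radius_rot, ofReal_one, one_mul, ← rot_add]
    congr 1
    field_simp

/-- A loop inside one slit piece lifts to its sheet and ends at a deck translate of the starting
point, so it is a power of the corresponding generator. -/
theorem closure_genX_genY (hab : a.Coprime b) :
    Subgroup.closure {genX a b, genY a b} = ⊤ := by
  have hx : sheetMap a b (sheetPt a b) ∈ slitExt a b := sheetMap_mem _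
  have hy : sheetMap' (sheetPt' a b) ∈ slitExt' a b := sheetMap_mem (sheetPt' a b)
  rw [sheetMap_sheetPt] at hx
  rw [sheetMap'_sheetPt'] at hy
  refine subgroup_eq_top_of_open_cover isOpen_slitExt isOpen_slitExt' slitExt_union
    (isPathConnected_slitExt (NeZero.ne b)) (isPathConnected_slitExt' (NeZero.ne a))
    (isPathConnected_slitExt_inter hab) ⟨hx, hy⟩ _ (fun γ hγ => ?_) (fun γ hγ => ?_)
  · obtain ⟨Γ, h0, hΓ⟩ := exists_lift_sheetMap (a := a) (b := b) (NeZero.ne b) γ.toContinuousMap hγ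
      (sheetPt a b)
      (by simp [sheetMap_sheetPt])
    have h1 : sheetMap a b (Γ 1) = basePt a b := by simp [hΓ]
    obtain ⟨k, hk⟩ := exists_sheetDeck_eq (h1.trans (sheetMap_sheetPt a b).symm)
    rw [← imageLoop_eq (sheetMap a b) (sheetMap_sheetPt a b)
      ((sheetMap_sheetDeck k (sheetPt a b)).trans (sheetMap_sheetPt a b)) γ ⟨Γ, h0, hk⟩ hΓ,
      imageLoop_sheetDeck]
    exact Subgroup.zpow_mem _ (Subgroup.subset_closure (by simp)) k
  · obtain ⟨Γ, h0, hΓ⟩ := exists_lift_sheetMap (a := b) (b := a) (NeZero.ne a)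
      ((swap b a).comp γ.toContinuousMap) hγ (sheetPt' a b)
      (by
        have := congrArg (swap b a) (sheetMap'_sheetPt' a b)
        simpa [sheetMap', swap_swap] using this)
    have hΓ' (t) : sheetMap' (Γ t) = γ t := congrArg (swap a b) (hΓ t)
    have h1 : sheetMap' (Γ 1) = basePt a b := by simp [hΓ']
    obtain ⟨k, hk⟩ := exists_sheetDeck_eq (q' := Γ 1) (q := sheetPt' a b)
      (congrArg (swap b a) (h1.trans (sheetMap'_sheetPt' a b).symm))
    rw [← imageLoop_eq sheetMap' (sheetMap'_sheetPt' a b)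
      ((sheetMap'_sheetDeck k (sheetPt' a b)).trans (sheetMap'_sheetPt' a b)) γ ⟨Γ, h0, hk⟩ hΓ',
      imageLoop_sheetDeck']
    exact Subgroup.zpow_mem _ (Subgroup.subset_closure (by simp)) k

end Generators

end TorusExterior

end

noncomputable section

namespace CoveringAux

/-! ### Further facts on monodromy. -/

section Lifts

variable {E X : Type*} [TopologicalSpace E] [TopologicalSpace X] {p : E → X} (cov : IsCoveringMap p)

/-- Monodromy commutes with maps over the base. -/
lemma monodromyPerm_map {x₀ : X} (A : C(E, E)) (hA : ∀ e, p (A e) = p e)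
    (g : FundamentalGroup X x₀) (ε ε' : p ⁻¹' {x₀}) (h : ε'.1 = A ε.1) :
    (cov.monodromyPerm x₀ g ε').1 = A (cov.monodromyPerm x₀ g ε).1 := by
  obtain ⟨γ, rfl⟩ := Path.Homotopic.Quotient.mk_surjective g
  have h0 : γ 0 = p ε.1 := γ.source.trans ε.2.symm
  have hΓ (t) : p (cov.liftPath γ ε.1 h0 t) = γ t := congrFun (cov.liftPath_lifts γ ε.1 h0) t
  refine monodromy_mk cov γ ε' (A.comp (cov.liftPath γ ε.1 h0)) (fun t => ?_) ?_
  · simp [hA, hΓ]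
  · simp [h, cov.liftPath_zero]

lemma joined_monodromyPerm {x₀ : X} (g : FundamentalGroup X x₀) (ε : p ⁻¹' {x₀}) :
    Joined ε.1 (cov.monodromyPerm x₀ g ε).1 := by
  obtain ⟨γ, -⟩ := Path.Homotopic.Quotient.mk_surjective (cov.liftPathQuotient g ε)
  exact ⟨γ⟩

include cov in
lemma pathConnectedSpace_of_monodromyPerm [PathConnectedSpace X] (x₀ : X) (ε : p ⁻¹' {x₀})
    (h : ∀ ε' : p ⁻¹' {x₀}, ∃ g, cov.monodromyPerm x₀ g ε = ε') : PathConnectedSpace E := by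
  have key (e : E) : Joined e ε.1 := by
    let γ := PathConnectedSpace.somePath (p e) x₀
    have h0 : γ 0 = p e := γ.source
    have hΓ (t) : p (cov.liftPath γ e h0 t) = γ t := congrFun (cov.liftPath_lifts γ e h0) t
    have j : Joined e (cov.liftPath γ e h0 1) := ⟨⟨cov.liftPath γ e h0, cov.liftPath_zero .., rfl⟩⟩
    obtain ⟨g, hg⟩ := h ⟨cov.liftPath γ e h0 1, by simp [hΓ]⟩
    have := joined_monodromyPerm cov g ε
    rw [hg] at this
    exact j.trans this.symm
  exact ⟨⟨ε.1⟩, fun e e' => (key e).trans (key e').symm⟩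

end Lifts

end CoveringAux

namespace TorusExterior

open Complex CoveringAux

/-! ### Roots of unity as characters of `ℤ/m`. -/

section Character

variable {m : ℕ} [NeZero m]

lemma stdAddChar_pow (k : ZMod m) : ZMod.stdAddChar k ^ m = (1 : ℂ) := by
  rw [← AddChar.map_nsmul_eq_pow]
  simp

lemma exists_stdAddChar_eq {ζ : ℂ} (h : ζ ^ m = 1) : ∃ k : ZMod m, ZMod.stdAddChar k = ζ := by
  obtain ⟨i, -, hi⟩ := (isPrimitiveRoot_exp m (NeZero.ne m)).eq_pow_of_pow_eq_one h
  refine ⟨((i : ℤ) : ZMod m), ?_⟩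
  rw [ZMod.stdAddChar_coe, ← hi, ← exp_nat_mul]
  congr 1
  push_cast
  ring

lemma eq_zero_of_stdAddChar_eq_one {k : ZMod m} (h : ZMod.stdAddChar k = (1 : ℂ)) : k = 0 :=
  ZMod.injective_stdAddChar (by rw [h, AddChar.map_zero_eq_one])

lemma stdAddChar_intCast_eq_rot (j : ℤ) :
    ZMod.stdAddChar (j : ZMod m) = rot (2 * Real.pi * j / m) := by
  rw [ZMod.stdAddChar_coe, rot]
  congr 1
  push_cast
  ring

end Character

/-! ### The cyclic covers by roots of the defining equation. -/

section RootCover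

variable (a b m : ℕ)

/-- The space of `m`-th roots of the defining equation over the exterior. -/
abbrev RootCover : Type := {y : Ext a b × ℂ // y.2 ^ m = defect a b y.1}

variable {a b m}

lemma RootCover.ne_zero [NeZero m] (y : RootCover a b m) : y.1.2 ≠ 0 := fun h => by
  have := y.2
  rw [h, zero_pow (NeZero.ne m)] at this
  exact (defect a b y.1.1).2 this.symm

instance [NeZero m] : AddAction (ZMod m) (RootCover a b m) where
  vadd k y := ⟨(y.1.1, y.1.2 * ZMod.stdAddChar k), by
    rw [mul_pow, stdAddChar_pow, mul_one, y.2]⟩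
  zero_vadd y := Subtype.ext (Prod.ext rfl (by
    change y.1.2 * ZMod.stdAddChar 0 = _
    rw [AddChar.map_zero_eq_one, mul_one]))
  add_vadd k l y := Subtype.ext (Prod.ext rfl (by
    change y.1.2 * ZMod.stdAddChar (k + l) = y.1.2 * ZMod.stdAddChar l * ZMod.stdAddChar k
    rw [AddChar.map_add_eq_mul]
    ring))

lemma RootCover.vadd_snd [NeZero m] (k : ZMod m) (y : RootCover a b m) :
    (k +ᵥ y).1.2 = y.1.2 * ZMod.stdAddChar k := rfl

lemma RootCover.continuous_vadd [NeZero m] (k : ZMod m) :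
    Continuous fun y : RootCover a b m => k +ᵥ y := by
  refine Continuous.subtype_mk (f := fun y : RootCover a b m =>
    (y.1.1, y.1.2 * ZMod.stdAddChar k)) ?_ _
  fun_prop

lemma RootCover.free [NeZero m] (k : ZMod m) (y : RootCover a b m) (h : k +ᵥ y = y) : k = 0 := by
  have h2 := congrArg (fun y => y.1.2) h
  simp only [RootCover.vadd_snd] at h2
  exact eq_zero_of_stdAddChar_eq_one (mul_left_cancel₀ y.ne_zero (h2.trans (mul_one _).symm))

lemma RootCover.fst_eq_iff [NeZero m] (y y' : RootCover a b m) :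
    y.1.1 = y'.1.1 ↔ ∃ k : ZMod m, k +ᵥ y = y' := by
  constructor
  · intro h
    obtain ⟨k, hk⟩ := exists_stdAddChar_eq (m := m) (ζ := y'.1.2 / y.1.2) (by
      rw [div_pow, y.2, y'.2, h, div_self (defect a b _).2])
    refine ⟨k, Subtype.ext (Prod.ext h ?_)⟩
    rw [RootCover.vadd_snd, hk, mul_div_cancel₀ _ y.ne_zero]
  · rintro ⟨k, rfl⟩
    rfl

lemma RootCover.surjective [NeZero m] : Function.Surjective fun y : RootCover a b m => y.1.1 := by
  intro x
  obtain ⟨u, hu⟩ := IsAlgClosed.exists_pow_nat_eq (defect a b x : ℂ) (NeZero.pos m)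
  exact ⟨⟨(x, u), hu⟩, rfl⟩

lemma RootCover.isClosedMap [NeZero m] : IsClosedMap fun y : RootCover a b m => y.1.1 :=
  isClosedMap_fst_of_isProperMap (isProperMap_pow (NeZero.ne m))
    (r := fun x => (defect a b x : ℂ)) (by fun_prop)
    (C := {y : Ext a b × ℂ | y.2 ^ m = defect a b y.1})
    (isClosed_eq (by fun_prop) (by fun_prop)) fun _ h => h

theorem RootCover.isQuotientCoveringMap [NeZero m] :
    IsQuotientCoveringMap (fun y : RootCover a b m => y.1.1) (Multiplicative (ZMod m)) :=
  have : ContinuousConstSMul (Multiplicative (ZMod m)) (RootCover a b m) :=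
    ⟨fun k => RootCover.continuous_vadd k.toAdd⟩
  isQuotientCoveringMap_of_finite (fun k y h => RootCover.free k.toAdd y h) (by fun_prop)
    RootCover.surjective RootCover.isClosedMap fun {y y'} => by
      rw [eq_comm, RootCover.fst_eq_iff]
      rfl

lemma pathConnectedSpace_ext [NeZero a] [NeZero b] (hab : a.Coprime b) :
    PathConnectedSpace (Ext a b) := by
  rw [pathConnectedSpace_iff_univ, ← slitExt_union]
  exact (isPathConnected_slitExt (NeZero.ne b)).union (isPathConnected_slitExt' (NeZero.ne a))
    (isPathConnected_slitExt_inter hab).nonempty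

/-- The loop `genX` has winding number `b`, a unit modulo `m`, so its powers already act
transitively on a fibre. -/
theorem RootCover.pathConnectedSpace [NeZero a] [NeZero b] [NeZero m] (hab : a.Coprime b)
    (hmb : m.Coprime b) : PathConnectedSpace (RootCover a b m) := by
  have := pathConnectedSpace_ext hab
  have cov := (RootCover.isQuotientCoveringMap (a := a) (b := b) (m := m)).isCoveringMap
  obtain ⟨y, hy⟩ := RootCover.surjective (m := m) (basePt a b)
  refine pathConnectedSpace_of_monodromyPerm cov (basePt a b) ⟨y, hy⟩ fun y' => ?_
  obtain ⟨k, hk⟩ := (RootCover.fst_eq_iff y y'.1).mp (hy.trans y'.2.symm)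
  -- `j` solves `j * b = k` modulo `m`.
  let j : ℤ := (k * (b : ZMod m)⁻¹).cast
  refine ⟨genX a b ^ j, Subtype.ext (Subtype.ext (Prod.ext ?_ ?_))⟩
  · exact (cov.monodromyPerm (basePt a b) (genX a b ^ j) ⟨y, hy⟩).2.trans y'.2.symm
  · have h := root_monodromyPerm cov (defect a b) (NeZero.ne m) ⟨fun y => y.1.2, by fun_prop⟩
      (fun y => y.2) (genX a b ^ j) ⟨y, hy⟩
    simp only [ContinuousMap.coe_mk] at h
    rw [h, ← hk, RootCover.vadd_snd]
    congr 1
    rw [map_zpow, toAdd_zpow, winding_genX, smul_eq_mul, ← ZMod.stdAddChar_coe]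
    congr 1
    push_cast
    rw [ZMod.intCast_cast, ZMod.cast_id', id_eq, mul_assoc, mul_comm (b : ZMod m)⁻¹,
      ZMod.coe_mul_inv_eq_one _ hmb.symm, mul_one]

end RootCover

/-! ### The further `ℤ/b`-cover that detects torsion. -/

section TwistCover

variable (a b N c : ℕ)

/-- The cyclic cover of degree `b` of the space of `N`-th roots, obtained by splitting the
factorization `z ^ b = (w ^ c) ^ N - u ^ N` into `b`-th powers. -/
abbrev TwistCover : Type := {e : RootCover a b N × (ℂ × ℂ) //
  (e.2.1 ^ b = e.1.1.1.1.2 ^ c - e.1.1.2 ∧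
    e.2.2 ^ b = ∑ i ∈ Finset.range N, (e.1.1.1.1.2 ^ c) ^ i * e.1.1.2 ^ (N - 1 - i)) ∧
    e.2.1 * e.2.2 = e.1.1.1.1.1}

variable {a b N c}

instance [NeZero b] : AddAction (ZMod b) (TwistCover a b N c) where
  vadd k e := ⟨(e.1.1, (e.1.2.1 * ZMod.stdAddChar k, e.1.2.2 * ZMod.stdAddChar (-k))), by
    refine ⟨⟨?_, ?_⟩, ?_⟩
    · rw [mul_pow, stdAddChar_pow, mul_one, e.2.1.1]
    · rw [mul_pow, stdAddChar_pow, mul_one, e.2.1.2]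
    · have h : ZMod.stdAddChar k * ZMod.stdAddChar (-k) = (1 : ℂ) := by
        rw [← AddChar.map_add_eq_mul, add_neg_cancel, AddChar.map_zero_eq_one]
      have h2 := e.2.2
      linear_combination e.1.2.1 * e.1.2.2 * h + h2⟩
  zero_vadd e := Subtype.ext (Prod.ext rfl (Prod.ext
    (by change e.1.2.1 * ZMod.stdAddChar 0 = _; simp)
    (by change e.1.2.2 * ZMod.stdAddChar (-0) = _; simp)))
  add_vadd k l e := Subtype.ext (Prod.ext rfl (Prod.ext
    (by
      change e.1.2.1 * ZMod.stdAddChar (k + l) = e.1.2.1 * ZMod.stdAddChar l * ZMod.stdAddChar k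
      rw [AddChar.map_add_eq_mul]
      ring)
    (by
      change e.1.2.2 * ZMod.stdAddChar (-(k + l)) =
        e.1.2.2 * ZMod.stdAddChar (-l) * ZMod.stdAddChar (-k)
      rw [neg_add, AddChar.map_add_eq_mul]
      ring)))

lemma TwistCover.vadd_snd [NeZero b] (k : ZMod b) (e : TwistCover a b N c) :
    (k +ᵥ e).1.2 = (e.1.2.1 * ZMod.stdAddChar k, e.1.2.2 * ZMod.stdAddChar (-k)) := rfl

/-- The action of an element of the deck group. -/
def TwistCover.deck [NeZero b] (k : ZMod b) : C(TwistCover a b N c, TwistCover a b N c) where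
  toFun e := k +ᵥ e
  continuous_toFun := by
    refine Continuous.subtype_mk (f := fun e : TwistCover a b N c =>
      (e.1.1, (e.1.2.1 * ZMod.stdAddChar k, e.1.2.2 * ZMod.stdAddChar (-k)))) ?_ _
    fun_prop

/-- Where `u = w ^ c` the cofactor is `N * u ^ (N - 1)`. Since the two factors never vanish
together, `v` and `s` are never both zero and the action is free. -/
lemma RootCover.factors_ne_zero [NeZero N] (y : RootCover a b N)
    (h : y.1.1.1.2 ^ c - y.1.2 = 0) :
    ∑ i ∈ Finset.range N, (y.1.1.1.2 ^ c) ^ i * y.1.2 ^ (N - 1 - i) ≠ 0 := by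
  rw [sub_eq_zero.mp h]
  have : ∀ i ∈ Finset.range N, y.1.2 ^ i * y.1.2 ^ (N - 1 - i) = y.1.2 ^ (N - 1) := fun i hi => by
    rw [← pow_add]
    congr 1
    have := Finset.mem_range.mp hi
    omega
  rw [Finset.sum_congr rfl this, Finset.sum_const, Finset.card_range, nsmul_eq_mul]
  exact mul_ne_zero (Nat.cast_ne_zero.mpr (NeZero.ne N)) (pow_ne_zero _ y.ne_zero)

lemma RootCover.factors_mul (h : N * c = a) (y : RootCover a b N) :
    (y.1.1.1.2 ^ c - y.1.2) *
      ∑ i ∈ Finset.range N, (y.1.1.1.2 ^ c) ^ i * y.1.2 ^ (N - 1 - i) = y.1.1.1.1 ^ b := by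
  rw [mul_comm, geom_sum₂_mul, y.2, ← pow_mul, mul_comm c, h]
  simp [defect]

lemma TwistCover.ne_zero [NeZero b] [NeZero N] (e : TwistCover a b N c) :
    e.1.2.1 ≠ 0 ∨ e.1.2.2 ≠ 0 := by
  by_contra! h
  have h1 := e.2.1.1
  have h2 := e.2.1.2
  rw [h.1, zero_pow (NeZero.ne b)] at h1
  rw [h.2, zero_pow (NeZero.ne b)] at h2
  exact RootCover.factors_ne_zero e.1.1 h1.symm h2.symm

lemma TwistCover.free [NeZero b] [NeZero N] (k : ZMod b) (e : TwistCover a b N c)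
    (h : k +ᵥ e = e) : k = 0 := by
  have h2 := congrArg (fun y => y.1.2) h
  simp only [TwistCover.vadd_snd] at h2
  rcases e.ne_zero with h3 | h3
  · exact eq_zero_of_stdAddChar_eq_one
      (mul_left_cancel₀ h3 ((congrArg Prod.fst h2).trans (mul_one _).symm))
  · exact neg_eq_zero.mp (eq_zero_of_stdAddChar_eq_one
      (mul_left_cancel₀ h3 ((congrArg Prod.snd h2).trans (mul_one _).symm)))

lemma TwistCover.fst_eq_iff [NeZero b] [NeZero N] (e e' : TwistCover a b N c) :
    e.1.1 = e'.1.1 ↔ ∃ k : ZMod b, k +ᵥ e = e' := by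
  refine ⟨fun h => ?_, by rintro ⟨k, rfl⟩; rfl⟩
  obtain ⟨⟨y, v, s⟩, ⟨h1, h2⟩, h3⟩ := e
  obtain ⟨⟨y', v', s'⟩, ⟨h1', h2'⟩, h3'⟩ := e'
  simp only at h
  subst h
  simp only at h1 h1' h2 h2' h3 h3'
  by_cases hv : v = 0
  · have hs : s ≠ 0 := by
      rintro rfl
      rw [hv, zero_pow (NeZero.ne b)] at h1
      rw [zero_pow (NeZero.ne b)] at h2
      exact RootCover.factors_ne_zero y h1.symm h2.symm
    have hv' : v' = 0 := by
      rw [hv, zero_pow (NeZero.ne b)] at h1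
      rw [← h1] at h1'
      exact pow_eq_zero_iff (NeZero.ne b) |>.mp h1'
    obtain ⟨k, hk⟩ := exists_stdAddChar_eq (m := b) (ζ := s' / s) (by
      rw [div_pow, h2', ← h2, div_self (pow_ne_zero _ hs)])
    -- With `v = 0` only `s` sees the action, and through the inverse character.
    refine ⟨-k, Subtype.ext (Prod.ext rfl (Prod.ext ?_ ?_))⟩
    · rw [TwistCover.vadd_snd]
      simp [hv, hv']
    · rw [TwistCover.vadd_snd]
      simp only [neg_neg, hk]
      exact mul_div_cancel₀ _ hs
  · have hv' : v' ≠ 0 := by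
      rintro rfl
      rw [zero_pow (NeZero.ne b), ← h1] at h1'
      exact pow_ne_zero _ hv h1'.symm
    obtain ⟨k, hk⟩ := exists_stdAddChar_eq (m := b) (ζ := v' / v) (by
      rw [div_pow, h1', ← h1, div_self (pow_ne_zero _ hv)])
    refine ⟨k, Subtype.ext (Prod.ext rfl (Prod.ext ?_ ?_))⟩
    · rw [TwistCover.vadd_snd]
      simp only [hk]
      exact mul_div_cancel₀ _ hv
    · rw [TwistCover.vadd_snd]
      simp only
      rw [AddChar.map_neg_eq_inv, hk, inv_div, ← mul_right_inj' hv', h3', ← h3]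
      field_simp

lemma TwistCover.surjective [NeZero b] [NeZero N] (h : N * c = a) :
    Function.Surjective fun e : TwistCover a b N c => e.1.1 := by
  intro y
  have hf := RootCover.factors_mul h y
  -- If the first factor vanishes then `z = 0` and any root `s` will do; otherwise `s` is forced to
  -- be `z / v`.
  by_cases hv : y.1.1.1.2 ^ c - y.1.2 = 0
  · obtain ⟨s, hs⟩ := IsAlgClosed.exists_pow_nat_eq
      (∑ i ∈ Finset.range N, (y.1.1.1.2 ^ c) ^ i * y.1.2 ^ (N - 1 - i)) (NeZero.pos b)
    refine ⟨⟨(y, (0, s)), ⟨?_, hs⟩, ?_⟩, rfl⟩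
    · simp [hv, NeZero.ne b]
    · rw [hv, zero_mul] at hf
      simp [pow_eq_zero_iff (NeZero.ne b) |>.mp hf.symm]
  · obtain ⟨v, hv'⟩ := IsAlgClosed.exists_pow_nat_eq (y.1.1.1.2 ^ c - y.1.2) (NeZero.pos b)
    have hv0 : v ≠ 0 := by
      rintro rfl
      exact hv (by rw [← hv', zero_pow (NeZero.ne b)])
    refine ⟨⟨(y, (v, y.1.1.1.1 / v)), ⟨hv', ?_⟩, mul_div_cancel₀ _ hv0⟩, rfl⟩
    simp only
    rw [div_pow, ← hf, hv', mul_div_cancel_left₀ _ hv]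

lemma TwistCover.isClosedMap [NeZero b] : IsClosedMap fun e : TwistCover a b N c => e.1.1 :=
  isClosedMap_fst_of_isProperMap
    ((isProperMap_pow (NeZero.ne b)).prodMap (isProperMap_pow (NeZero.ne b)))
    (r := fun y : RootCover a b N => (y.1.1.1.2 ^ c - y.1.2,
      ∑ i ∈ Finset.range N, (y.1.1.1.2 ^ c) ^ i * y.1.2 ^ (N - 1 - i))) (by fun_prop)
    (((isClosed_eq (by fun_prop) (by fun_prop)).inter
      (isClosed_eq (by fun_prop) (by fun_prop))).inter (isClosed_eq (by fun_prop) (by fun_prop)))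
      fun _ h => Prod.ext h.1.1 h.1.2

theorem TwistCover.isQuotientCoveringMap [NeZero b] [NeZero N] (h : N * c = a) :
    IsQuotientCoveringMap (fun e : TwistCover a b N c => e.1.1) (Multiplicative (ZMod b)) :=
  have : ContinuousConstSMul (Multiplicative (ZMod b)) (TwistCover a b N c) :=
    ⟨fun k => (TwistCover.deck k.toAdd).continuous⟩
  isQuotientCoveringMap_of_finite (fun k y h => TwistCover.free k.toAdd y h) (by fun_prop)
    (TwistCover.surjective h) TwistCover.isClosedMap fun {y y'} => by
      rw [eq_comm, TwistCover.fst_eq_iff]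
      rfl

variable (a b N c) in
/-- The projection to the exterior. -/
def TwistCover.proj (e : TwistCover a b N c) : Ext a b := e.1.1.1.1

theorem TwistCover.isCoveringMap [NeZero b] [NeZero N] (h : N * c = a) :
    IsCoveringMap (TwistCover.proj a b N c) := by
  have h1 := TwistCover.isQuotientCoveringMap (b := b) h
  have h2 := RootCover.isQuotientCoveringMap (a := a) (b := b) (m := N)
  have := isCoveringMap_comp (f := fun e : TwistCover a b N c => e.1.1)
    (g := fun y : RootCover a b N => y.1.1) h1.isCoveringMap.isLocalHomeomorph
        h2.isCoveringMap.isLocalHomeomorph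
    TwistCover.isClosedMap RootCover.isClosedMap (IsQuotientCoveringMap.finite_fiber h1)
    (IsQuotientCoveringMap.finite_fiber h2)
  exact this

end TwistCover

end TorusExterior

end

noncomputable section

/-! ### Monodromy of the twisted cover, computed along the circle flow. -/

namespace TorusExterior

open Complex CoveringAux

variable {a b N c : ℕ}

/-- The circle action whose orbits are parallel to the knot. -/
def flow (t : ℝ) (x : Ext a b) : Ext a b :=
  ⟨(x.1.1 * rot (a * t), x.1.2 * rot (b * t)), by simpa [norm_rot] using x.2.1, by
    have e : rot (a * t) ^ b = rot (b * t) ^ a := by rw [rot_pow, rot_pow]; ring_nf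
    rw [mul_pow, mul_pow, e]
    exact fun h => x.2.2 (mul_right_cancel₀ (pow_ne_zero _ (rot_ne_zero _)) h)⟩

lemma geom_sum_mul_right (W u r : ℂ) (N : ℕ) :
    ∑ i ∈ Finset.range N, (W * r) ^ i * (u * r) ^ (N - 1 - i) =
      (∑ i ∈ Finset.range N, W ^ i * u ^ (N - 1 - i)) * r ^ (N - 1) := by
  rw [Finset.sum_mul]
  refine Finset.sum_congr rfl fun i hi => ?_
  have hi' : r ^ (N - 1) = r ^ i * r ^ (N - 1 - i) := by
    have := Finset.mem_range.mp hi
    rw [← pow_add]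
    congr 1
    omega
  rw [hi']
  ring

/-- The lift of an orbit of the circle action to the twisted cover. -/
def TwistCover.flow [NeZero N] (h : N * c = a) (e : TwistCover a b N c) :
    C(ℝ, TwistCover a b N c) where
  toFun t := ⟨(⟨(TorusExterior.flow t e.1.1.1.1, e.1.1.1.2 * rot (c * t) ^ b), by
      have e1 : rot (a * t) = rot (c * t) ^ N := by rw [rot_pow, ← h]; push_cast; ring_nf
      have e2 : rot (b * t) ^ a = rot (a * t) ^ b := by rw [rot_pow, rot_pow]; ring_nf
      have h1 := e.1.1.2
      simp only [defect, TorusExterior.flow, ContinuousMap.coe_mk] at h1 ⊢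
      rw [mul_pow, mul_pow, mul_pow, e2, e1, h1]
      ring⟩, (e.1.2.1 * rot (c * t), e.1.2.2 * rot (c * t) ^ (N - 1))), by
    have e1 : rot (a * t) = rot (c * t) ^ N := by rw [rot_pow, ← h]; push_cast; ring_nf
    have e3 : rot (b * t) ^ c = rot (c * t) ^ b := by rw [rot_pow, rot_pow]; ring_nf
    simp only [TorusExterior.flow]
    refine ⟨⟨?_, ?_⟩, ?_⟩
    · rw [mul_pow, mul_pow, e.2.1.1, e3]
      ring
    · rw [mul_pow _ _ c, e3, geom_sum_mul_right, mul_pow, e.2.1.2]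
      ring
    · rw [← e.2.2, e1, ← mul_pow_sub_one (NeZero.ne N) (rot (c * t))]
      ring⟩
  continuous_toFun := by
    refine Continuous.subtype_mk (Continuous.prodMk (Continuous.subtype_mk (Continuous.prodMk
      (Continuous.subtype_mk ?_ _) ?_) _) ?_) _ <;> fun_prop

/-- A point of the core of the sheet. -/
def corePt [NeZero a] (t : ℝ) : sheet a b :=
  ⟨(t, 0), by
    have := zero_mem_sheet (b := b) (NeZero.ne a)
    exact this⟩

lemma sheetDeck_corePt [NeZero a] (k : ℤ) :
    sheetDeck a b k (corePt 0) = corePt (2 * Real.pi * k / a) :=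
  Subtype.ext (Prod.ext (by simp [sheetDeck, corePt]) (by simp [sheetDeck, corePt]))

lemma sheetMap_corePt [NeZero a] (t : ℝ) :
    sheetMap a b (corePt t) = flow t (sheetMap a b (corePt 0)) := by
  refine Subtype.ext (Prod.ext ?_ ?_)
  · simp [sheetMap, corePt, flow, rot_zero]
  · simp [sheetMap, corePt, flow]

lemma sheetMap'_corePt [NeZero b] (t : ℝ) :
    sheetMap' (corePt (a := b) t) = flow t (sheetMap' (a := a) (corePt (a := b) 0)) :=
  congrArg (swap a b) (sheetMap_corePt t)

section Lifts

variable [NeZero b] [NeZero N] (h : N * c = a)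

/-- By uniqueness of lifts. The cores of the sheets are flow orbits, so this computes their lifts
explicitly. -/
lemma TwistCover.eq_flow (κ : C(ℝ, TwistCover a b N c))
    (hκ : ∀ t, TwistCover.proj a b N c (κ t) = TorusExterior.flow t (TwistCover.proj a b N c (κ 0)))
    (t : ℝ) : κ t = TwistCover.flow h (κ 0) t := by
  have cov := TwistCover.isCoveringMap (b := b) h
  refine congrFun (cov.eq_of_comp_eq κ.continuous (TwistCover.flow h (κ 0)).continuous
    (funext hκ) 0 ?_) t
  refine Subtype.ext (Prod.ext (Subtype.ext (Prod.ext (Subtype.ext (Prod.ext ?_ ?_)) ?_))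
    (Prod.ext ?_ ?_)) <;> simp [TwistCover.flow, TorusExterior.flow, rot_zero]

omit [NeZero b] in
lemma TwistCover.flow_eq_self {e : TwistCover a b N c} {t : ℝ} (ht : rot (c * t) = 1)
    (he : TwistCover.proj a b N c (TwistCover.flow h e t) = TwistCover.proj a b N c e) :
    TwistCover.flow h e t = e := by
  refine Subtype.ext (Prod.ext (Subtype.ext (Prod.ext he ?_)) (Prod.ext ?_ ?_))
  · change e.1.1.1.2 * rot (c * t) ^ b = _
    rw [ht, one_pow, mul_one]
  · change e.1.2.1 * rot (c * t) = _
    rw [ht, mul_one]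
  · change e.1.2.2 * rot (c * t) ^ (N - 1) = _
    rw [ht, one_pow, mul_one]

variable [NeZero a] (ε : TwistCover.proj a b N c ⁻¹' {basePt a b})

/-- On the core `w = 0`, `genX ^ N` flows for time `2π * N / a = 2π / c`, after which every fibre
coordinate has returned. Uniqueness of lifts carries this from the core to the base point. -/
theorem monodromy_genX_pow :
    (TwistCover.isCoveringMap h).monodromyPerm (basePt a b) (genX a b ^ N) ε = ε := by
  have ha : (a : ℝ) ≠ 0 := NeZero.ne _
  have cov := TwistCover.isCoveringMap (b := b) h
  obtain ⟨Θ, ⟨h0, hΘ⟩, -⟩ := cov.existsUnique_continuousMap_lifts (sheetMap a b) (sheetPt a b) ε.1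
    (ε.2.trans (sheetMap_sheetPt a b).symm)
  have hΘ' (q) : TwistCover.proj a b N c (Θ q) = sheetMap a b q := congrFun hΘ q
  have hcore (t : ℝ) : Θ (corePt t) = TwistCover.flow h (Θ (corePt 0)) t :=
    TwistCover.eq_flow h (Θ.comp ⟨corePt, by unfold corePt; fun_prop⟩) (fun t => by
      simp [hΘ', sheetMap_corePt t]) t
  have hper : Θ (sheetDeck a b N (corePt 0)) = Θ (corePt 0) := by
    rw [sheetDeck_corePt, hcore]
    refine TwistCover.flow_eq_self h ?_ ?_
    · rw [← rot_int 1]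
      congr 1
      rw [← h]
      have : ((N * c : ℕ) : ℝ) ≠ 0 := h ▸ ha
      push_cast at this ⊢
      have := left_ne_zero_of_mul this
      have := right_ne_zero_of_mul ‹(N * c : ℝ) ≠ 0›
      field_simp
    · rw [← hcore, ← sheetDeck_corePt, hΘ', hΘ', sheetMap_sheetDeck]
  have hall := cov.eq_of_comp_eq (Θ.comp (sheetDeck a b N)).continuous Θ.continuous
    (funext fun q => by
      simp [hΘ', sheetMap_sheetDeck]) _ hper
  refine Subtype.ext ?_
  rw [← zpow_natCast, ← imageLoop_sheetDeck]
  exact (monodromy_imageLoop cov _ _ _ Θ hΘ' ε h0).trans ((congrFun hall _).trans h0)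

/-- The value of the twisting character on the second generator. -/
theorem exists_monodromy_genY : ∃ ε₀ : TwistCover.proj a b N c ⁻¹' {basePt a b},
    ∀ ε : TwistCover.proj a b N c ⁻¹' {basePt a b},
      ((TwistCover.isCoveringMap h).monodromyPerm (basePt a b) (genY a b) ε).1 =
        ((c : ZMod b) - if ε.1.1.1.1.2 = ε₀.1.1.1.1.2 then ((N * c : ℕ) : ZMod b) else 0) +ᵥ ε.1 :=
            by
  have hb : (b : ℝ) ≠ 0 := NeZero.ne _
  have cov := TwistCover.isCoveringMap (b := b) h
  let x₁ : Ext a b := sheetMap' (corePt (a := b) 0)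
  have hx₁ : x₁.1.1 = 0 := by simp [x₁, sheetMap', swap, sheetMap, corePt]
  -- On the core `z = 0` one has `u ^ N = (w ^ c) ^ N`; the distinguished branch is `u = w ^ c`,
  -- where `v = 0`.
  obtain ⟨e₁, he₁⟩ := TwistCover.surjective (b := b) h ⟨(x₁, x₁.1.2 ^ c), by
    rw [← pow_mul, mul_comm c, h]
    simp [defect, hx₁, NeZero.ne b]⟩
  simp only at he₁
  obtain ⟨Θ₀, ⟨h0₀, hΘ₀⟩, -⟩ := cov.existsUnique_continuousMap_lifts (sheetMap' (a := a))
    (corePt (a := b) 0) e₁ (by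
      change e₁.1.1.1.1 = _
      rw [he₁])
  have hΘ₀' (q) : TwistCover.proj a b N c (Θ₀ q) = sheetMap' q := congrFun hΘ₀ q
  refine ⟨⟨Θ₀ (sheetPt' a b), (hΘ₀' _).trans (sheetMap'_sheetPt' a b)⟩, fun ε => ?_⟩
  obtain ⟨Θ, ⟨h0, hΘ⟩, -⟩ := cov.existsUnique_continuousMap_lifts (sheetMap' (a := a))
    (sheetPt' a b) ε.1 (ε.2.trans (sheetMap'_sheetPt' a b).symm)
  have hΘ' (q) : TwistCover.proj a b N c (Θ q) = sheetMap' q := congrFun hΘ q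
  have hpow (Φ : C(sheet b a, TwistCover a b N c))
      (hΦ : ∀ q, TwistCover.proj a b N c (Φ q) = sheetMap' q)
      (q) : (Φ q).1.1.1.2 ^ N = defect a b (sheetMap' q) := by
    rw [(Φ q).1.1.2, ← hΦ]
    rfl
  -- The ratio of two `N`-th roots of the same function is constant on the sheet, so the branch can
  -- be recognized at the base point.
  have hratio := eq_of_pow_eq_one (NeZero.ne N) (h := fun q => (Θ q).1.1.1.2 / (Θ₀ q).1.1.1.2)
    (by
      refine Continuous.div (by fun_prop) (by fun_prop) fun q => (Θ₀ q).1.1.ne_zero)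
    (fun q => by
      rw [div_pow, hpow Θ hΘ', hpow Θ₀ hΘ₀', div_self (defect a b _).2])
    (corePt (a := b) 0) (sheetPt' a b)
  have hu₁ : (Θ₀ (corePt (a := b) 0)).1.1.1.2 = x₁.1.2 ^ c := by rw [h0₀, he₁]
  have hiff : (Θ (corePt (a := b) 0)).1.1.1.2 = x₁.1.2 ^ c ↔
      ε.1.1.1.1.2 = (Θ₀ (sheetPt' a b)).1.1.1.2 := by
    rw [← hu₁, ← div_eq_one_iff_eq (Θ₀ _).1.1.ne_zero, ← div_eq_one_iff_eq (Θ₀ _).1.1.ne_zero]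
    rw [hratio, h0]
  have hcore (t : ℝ) : Θ (corePt (a := b) t) = TwistCover.flow h (Θ (corePt (a := b) 0)) t :=
    TwistCover.eq_flow h (Θ.comp ⟨corePt (a := b), by unfold corePt; fun_prop⟩) (fun t => by
      simp [hΘ', sheetMap'_corePt t]) t
  set δ : ZMod b := (c : ZMod b) - if ε.1.1.1.1.2 = (Θ₀ (sheetPt' a b)).1.1.1.2 then
    ((N * c : ℕ) : ZMod b) else 0 with hδ
  -- One turn takes time `2π / b`. With `ζ` the character value at `c`, it multiplies `v` by `ζ` and
  -- `s` by `ζ ^ (N - 1)`. On the core one of them is zero: if `s = 0` the deck element is `c`, and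
  -- if `v = 0` it is `-(N - 1) * c = c - N * c`, since `s` transforms by the inverse character.
  have hper : Θ (sheetDeck b a 1 (corePt 0)) = δ +ᵥ Θ (corePt (a := b) 0) := by
    set e := Θ (corePt (a := b) 0) with he
    have hex : e.1.1.1.1 = x₁ := hΘ' _
    have hproj : TwistCover.proj a b N c (Θ (sheetDeck b a 1 (corePt 0))) = e.1.1.1.1 := by
      rw [hΘ', sheetMap'_sheetDeck, ← hΘ']
      rfl
    have hvs : e.1.2.1 * e.1.2.2 = 0 := by rw [e.2.2, hex, hx₁]
    have hrot : rot (c * (2 * Real.pi * (1 : ℤ) / b)) = ZMod.stdAddChar ((c : ℤ) : ZMod b) := by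
      rw [stdAddChar_intCast_eq_rot]
      congr 1
      push_cast
      ring
    rw [sheetDeck_corePt, hcore] at hproj ⊢
    refine Subtype.ext (Prod.ext (Subtype.ext (Prod.ext hproj ?_)) ?_)
    · change e.1.1.1.2 * rot _ ^ b = e.1.1.1.2
      rw [hrot, stdAddChar_pow, mul_one]
    · change (e.1.2.1 * rot _, e.1.2.2 * rot _ ^ (N - 1)) = _
      rw [TwistCover.vadd_snd, hrot, Int.cast_natCast]
      have hv : e.1.2.1 = 0 ↔ e.1.1.1.2 = x₁.1.2 ^ c := by
        rw [← pow_eq_zero_iff (NeZero.ne b), e.2.1.1, hex, sub_eq_zero, eq_comm]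
      by_cases hv0 : e.1.2.1 = 0
      · rw [hv0, hδ, if_pos (hiff.mp (hv.mp hv0)), zero_mul, zero_mul,
          ← AddChar.map_nsmul_eq_pow]
        congr 3
        have : ((N - 1 : ℕ) : ZMod b) = N - 1 := by
          rw [Nat.cast_sub (NeZero.one_le), Nat.cast_one]
        rw [nsmul_eq_mul, this]
        push_cast
        ring
      · have hs : e.1.2.2 = 0 := (mul_eq_zero.mp hvs).resolve_left hv0
        rw [hs, hδ, if_neg (fun h' => hv0 (hv.mpr (hiff.mpr h'))), zero_mul, zero_mul, sub_zero]
  have hall := cov.eq_of_comp_eq (Θ.comp (sheetDeck b a 1)).continuous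
    ((TwistCover.deck δ).comp Θ).continuous
    (funext fun q => by
      change TwistCover.proj a b N c (Θ (sheetDeck b a 1 q)) = TwistCover.proj a b N c (Θ q)
      rw [hΘ', hΘ', sheetMap'_sheetDeck]) _ hper
  refine (monodromy_imageLoop cov _ _ _ Θ hΘ' ε h0).trans ((congrFun hall _).trans ?_)
  change δ +ᵥ Θ (sheetPt' a b) = _
  rw [h0]

end Lifts

end TorusExterior

end

noncomputable section

namespace TorusExterior

open Complex CoveringAux TorusGroup

/-! ### The character of the twisted cover. -/

section TwistHom

variable {a b N c : ℕ} [NeZero a] [NeZero b] [NeZero N]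

lemma exp_eq_one_iff_dvd {k : ℤ} :
    exp (2 * Real.pi * I * k / N) = 1 ↔ (N : ℤ) ∣ k := by
  rw [← ZMod.stdAddChar_coe, ← ZMod.intCast_zmod_eq_zero_iff_dvd]
  exact ⟨eq_zero_of_stdAddChar_eq_one, fun h => by rw [h, AddChar.map_zero_eq_one]⟩

/-- Loops with winding number divisible by `N` fix the root `u`, so they move a fibre point `ε`
within its `ℤ/b`-orbit; the displacement is the character. For `ε` on the distinguished branch,
conjugating `genY` by `genX ^ i` evaluates the monodromy of `genY` on another branch unless `N ∣ i`.
-/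
theorem exists_twistHom (h : N * c = a) (hN : N.Coprime b) :
    ∃ φ : divKer (winding (defect a b) (basePt a b)) N →* Multiplicative (ZMod b),
      (∀ g, g.1 = genX a b ^ N → φ g = 1) ∧
      ∀ (i : ℤ) g, g.1 = genX a b ^ i * genY a b * genX a b ^ (-i) →
        (φ g).toAdd = c - if (N : ℤ) ∣ i then ((N * c : ℕ) : ZMod b) else 0 := by
  let ρ := (TwistCover.isCoveringMap (b := b) h).monodromyPerm (basePt a b)
  obtain ⟨ε, hε⟩ := exists_monodromy_genY (b := b) h
  have root (g) (ε' : TwistCover.proj a b N c ⁻¹' {basePt a b}) : (ρ g ε').1.1.1.1.2 =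
      ε'.1.1.1.1.2 * exp (2 * Real.pi * I * (winding (defect a b) (basePt a b) g).toAdd / N) :=
    root_monodromyPerm (TwistCover.isCoveringMap (b := b) h) (defect a b) (NeZero.ne N)
      ⟨fun e => e.1.1.1.2, by fun_prop⟩ (fun e => e.1.1.2) g ε'
  have deck (g) (k : ZMod b) (ε₁ ε₂ : TwistCover.proj a b N c ⁻¹' {basePt a b})
      (he : ε₂.1 = k +ᵥ ε₁.1) : (ρ g ε₂).1 = k +ᵥ (ρ g ε₁).1 :=
    monodromyPerm_map (TwistCover.isCoveringMap (b := b) h) (TwistCover.deck k) (fun _ => rfl) g ε₁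
        ε₂ he
  have cancel {k l : ZMod b} {e : TwistCover a b N c} (hkl : k +ᵥ e = l +ᵥ e) : k = l := by
    have := TwistCover.free (-l + k) e (by rw [add_vadd, hkl, neg_vadd_vadd])
    rw [← sub_eq_zero, sub_eq_neg_add, this]
  have ex (g : divKer (winding (defect a b) (basePt a b)) N) : ∃ k : ZMod b, k +ᵥ ε.1 =
      (ρ g.1 ε).1 := by
    refine (TwistCover.fst_eq_iff _ _).mp (Subtype.ext (Prod.ext (ε.2.trans (ρ g.1 ε).2.symm) ?_))
    rw [root, exp_eq_one_iff_dvd.mpr (mem_divKer.mp g.2), mul_one]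
  choose κ hκ using ex
  refine ⟨MonoidHom.mk' (fun g => Multiplicative.ofAdd (κ g)) fun g g' => ?_, fun g hg => ?_,
    fun i g hg => ?_⟩
  · rw [← ofAdd_add]
    refine congrArg _ (cancel (e := ε.1) ?_)
    rw [hκ, add_comm, add_vadd, hκ]
    change (ρ (g.1 * g'.1) ε).1 = _
    rw [map_mul]
    exact deck g.1 _ ε (ρ g'.1 ε) (hκ g').symm
  · refine congrArg Multiplicative.ofAdd (cancel (e := ε.1) (l := 0) ?_)
    rw [hκ, hg, zero_vadd]
    exact congrArg Subtype.val (monodromy_genX_pow h ε)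
  · refine cancel (e := ε.1) ?_
    change κ g +ᵥ ε.1 = _
    rw [hκ, hg, map_mul, map_mul]
    let ε' := ρ (genX a b ^ (-i)) ε
    -- `genX ^ (-i)` rotates `u` through `-i * b / N` of a turn, and `b` is prime to `N`.
    have hu : ε'.1.1.1.1.2 = ε.1.1.1.1.2 ↔ (N : ℤ) ∣ i := by
      rw [root, map_zpow, toAdd_zpow, winding_genX, mul_eq_left₀ ε.1.1.1.ne_zero,
          exp_eq_one_iff_dvd,
        smul_eq_mul, neg_mul, Int.dvd_neg]
      have hco : IsCoprime (N : ℤ) b := Nat.isCoprime_iff_coprime.mpr hN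
      exact ⟨hco.dvd_of_dvd_mul_right, fun hi => hi.mul_right _⟩
    have hy := hε ε'
    simp only [hu] at hy
    have := deck (genX a b ^ i) _ ε' (ρ (genY a b) ε') hy
    have hinv : ρ (genX a b ^ i) ε' = ε := by
      change (ρ (genX a b ^ i) * ρ (genX a b ^ (-i))) ε = ε
      rw [← map_mul, ← zpow_add, add_neg_cancel, zpow_zero, map_one]
      rfl
    rw [hinv] at this
    exact this

end TwistHom

/-! ### The actual exterior compared with the model. -/

section Exterior

/-- Conjugation of the coordinate if the exponent is negative. -/
def conjSign (a : ℤ) (z : ℂ) : ℂ := if a < 0 then (starRingEnd ℂ) z else z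

@[fun_prop]
lemma continuous_conjSign (a : ℤ) : Continuous (conjSign a) := by
  unfold conjSign
  split_ifs
  · exact continuous_conj
  · exact continuous_id

lemma conjSign_conjSign (a : ℤ) (z : ℂ) : conjSign a (conjSign a z) = z := by
  unfold conjSign
  split_ifs <;> simp

lemma norm_conjSign (a : ℤ) (z : ℂ) : ‖conjSign a z‖ = ‖z‖ := by
  unfold conjSign
  split_ifs <;> simp

lemma conjSign_mul_ofReal (a : ℤ) (r : ℝ) (z : ℂ) : conjSign a (r * z) = r * conjSign a z := by
  unfold conjSign
  split_ifs <;> simp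

lemma sqrt_two_mul_conjSign (a : ℤ) (z : ℂ) :
    ((√2 : ℝ) : ℂ) * conjSign a (((√2)⁻¹ : ℝ) * conjSign a z) = z := by
  have h2 : ((√2 : ℝ) : ℂ) ≠ 0 := ofReal_ne_zero.mpr (by positivity)
  rw [conjSign_mul_ofReal, conjSign_conjSign, ofReal_inv, mul_inv_cancel_left₀ h2]

lemma conjSign_rot (a : ℤ) (t : ℝ) : conjSign a (rot (a * t)) = rot (a.natAbs * t) := by
  unfold conjSign
  split_ifs with h
  · have e : (a.natAbs : ℝ) = -a := by
      rw [← Int.cast_natCast, Int.natCast_natAbs, abs_of_neg h, Int.cast_neg]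
    rw [e, rot, ← exp_conj, rot]
    congr 1
    simp
  · have e : (a.natAbs : ℝ) = a := by
      rw [← Int.cast_natCast, Int.natCast_natAbs, abs_of_nonneg (not_lt.mp h)]
    rw [e]

/-- If one modulus were below `1` the other would exceed `1`, contradicting `|w| ^ a = |z| ^ b`. So
both equal `1`, and Bézout finds a common parameter from the two arguments. -/
lemma pow_eq_pow_iff_exists_rot {a b : ℕ} [NeZero a] [NeZero b] (hab : a.Coprime b) {z w : ℂ}
    (hzw : ‖z‖ ^ 2 + ‖w‖ ^ 2 = 2) :
    w ^ a = z ^ b ↔ ∃ t : ℝ, z = rot (a * t) ∧ w = rot (b * t) := by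
  have ha : (a : ℝ) ≠ 0 := NeZero.ne _
  constructor
  · intro h
    have hn : ‖w‖ ^ a = ‖z‖ ^ b := by rw [← norm_pow, h, norm_pow]
    have hz : ‖z‖ = 1 := by
      rcases lt_trichotomy ‖z‖ 1 with h1 | h1 | h1
      · have h2 : 1 < ‖w‖ := by nlinarith [norm_nonneg z, norm_nonneg w]
        have h3 := one_lt_pow₀ h2 (NeZero.ne a)
        have h4 := pow_lt_one₀ (norm_nonneg z) h1 (NeZero.ne b)
        linarith
      · exact h1
      · have h2 : ‖w‖ < 1 := by nlinarith [norm_nonneg z, norm_nonneg w]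
        have h3 := one_lt_pow₀ h1 (NeZero.ne b)
        have h4 := pow_lt_one₀ (norm_nonneg w) h2 (NeZero.ne a)
        linarith
    have hw : ‖w‖ = 1 := by nlinarith [norm_nonneg w]
    have hz' : z = rot (arg z) := by
      have := norm_mul_rot_arg z
      rw [hz, ofReal_one, one_mul] at this
      exact this.symm
    have hw' : w = rot (arg w) := by
      have := norm_mul_rot_arg w
      rw [hw, ofReal_one, one_mul] at this
      exact this.symm
    rw [hz', hw', rot_pow, rot_pow, rot_eq_rot_iff] at h
    obtain ⟨k, hk⟩ := h
    obtain ⟨i, j, hij⟩ := Nat.isCoprime_iff_coprime.mpr hab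
    have hij' : (i : ℝ) * a + j * b = 1 := by exact_mod_cast hij
    refine ⟨(arg z + 2 * Real.pi * (k * j : ℤ)) / a, ?_, ?_⟩
    · nth_rewrite 1 [hz']
      rw [rot_eq_rot_iff]
      refine ⟨-(k * j), ?_⟩
      push_cast
      field_simp
      ring
    · nth_rewrite 1 [hw']
      rw [rot_eq_rot_iff]
      refine ⟨k * i, ?_⟩
      push_cast
      field_simp
      linear_combination hk - 2 * Real.pi * k * hij'
  · rintro ⟨t, rfl, rfl⟩
    rw [rot_pow, rot_pow]
    ring_nf

lemma mem_torusKnot_iff {a b : ℤ} [NeZero a.natAbs] [NeZero b.natAbs]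
    (hab : a.natAbs.Coprime b.natAbs) (x : ThreeSphere) :
    x ∈ torusKnot a b ↔ ((√2 : ℝ) * conjSign b (x.1 1)) ^ a.natAbs =
      ((√2 : ℝ) * conjSign a (x.1 0)) ^ b.natAbs := by
  have h2 : ((√2 : ℝ) : ℂ) ≠ 0 := ofReal_ne_zero.mpr (by positivity)
  have hx : ‖((√2 : ℝ) : ℂ) * conjSign a (x.1 0)‖ ^ 2 + ‖((√2 : ℝ) : ℂ) * conjSign b (x.1 1)‖ ^ 2 =
      2 := by
    have h := EuclideanSpace.norm_sq_eq x.1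
    rw [norm_eq_of_mem_sphere, Fin.sum_univ_two] at h
    rw [norm_mul, norm_mul, norm_conjSign, norm_conjSign, mul_pow, mul_pow, norm_real,
      Real.norm_eq_abs, sq_abs, Real.sq_sqrt (by norm_num)]
    linarith
  rw [pow_eq_pow_iff_exists_rot hab hx]
  have key (a : ℤ) (z : ℂ) (t : ℝ) : z = exp (a * t * I) / (√2 : ℝ) ↔
      ((√2 : ℝ) : ℂ) * conjSign a z = rot (a.natAbs * t) := by
    rw [← conjSign_rot, ← conjSign_mul_ofReal, (Function.LeftInverse.injective
        (conjSign_conjSign a)).eq_iff,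
      eq_div_iff h2, mul_comm, rot]
    push_cast
    rfl
  exact exists_congr fun t => and_congr (key a _ t) (key b _ t)

/-- The exterior of a torus knot is homeomorphic to the model with positive exponents. -/
def exteriorHomeomorph {a b : ℤ} [NeZero a.natAbs] [NeZero b.natAbs]
    (hab : a.natAbs.Coprime b.natAbs) : TorusKnotExterior a b ≃ₜ Ext a.natAbs b.natAbs where
  toFun x := ⟨((√2 : ℝ) * conjSign a (x.1.1 0), (√2 : ℝ) * conjSign b (x.1.1 1)), by
    have h := EuclideanSpace.norm_sq_eq x.1.1
    rw [norm_eq_of_mem_sphere, Fin.sum_univ_two] at h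
    rw [norm_mul, norm_mul, norm_conjSign, norm_conjSign, mul_pow, mul_pow, norm_real,
      Real.norm_eq_abs, sq_abs, Real.sq_sqrt (by norm_num)]
    linarith, fun h => x.2 ((mem_torusKnot_iff hab x.1).mpr h)⟩
  invFun y := ⟨⟨!₂[((√2)⁻¹ : ℝ) * conjSign a y.1.1, ((√2)⁻¹ : ℝ) * conjSign b y.1.2], by
      rw [mem_sphere_zero_iff_norm, ← sq_eq_sq₀ (norm_nonneg _) zero_le_one,
        EuclideanSpace.norm_sq_eq, Fin.sum_univ_two]
      simp only [Matrix.cons_val_zero, Matrix.cons_val_one]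
      rw [norm_mul, norm_mul, norm_conjSign, norm_conjSign, mul_pow, mul_pow, norm_real,
        Real.norm_eq_abs, sq_abs, inv_pow, Real.sq_sqrt (by norm_num)]
      linarith [y.2.1]⟩, fun h => y.2.2 (by
        have := (mem_torusKnot_iff hab _).mp h
        simp only [Matrix.cons_val_zero, Matrix.cons_val_one, sqrt_two_mul_conjSign] at this
        exact this)⟩
  left_inv x := by
    have h2 : ((√2 : ℝ) : ℂ) ≠ 0 := ofReal_ne_zero.mpr (by positivity)
    refine Subtype.ext (Subtype.ext ?_)
    ext i
    fin_cases i <;> simp [conjSign_mul_ofReal, conjSign_conjSign, h2]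
  right_inv y := Subtype.ext
    (Prod.ext (sqrt_two_mul_conjSign a y.1.1) (sqrt_two_mul_conjSign b y.1.2))
  continuous_toFun := by fun_prop
  continuous_invFun := by
    refine Continuous.subtype_mk (Continuous.subtype_mk ?_ _) _
    fun_prop

/-- Radial projection to the sphere exhibits the exterior as a quotient of an open set. -/
lemma locallyPathConnectedSpace_ext {a b : ℕ} [NeZero a] [NeZero b] :
    LocallyPathConnectedSpace (Ext a b) := by
  let n : ℂ × ℂ → ℝ := fun x => √((‖x.1‖ ^ 2 + ‖x.2‖ ^ 2) / 2)
  have hn : Continuous n := by fun_prop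
  let O : Set (ℂ × ℂ) := {x | x.2 ^ a * (n x : ℂ) ^ b ≠ x.1 ^ b * (n x : ℂ) ^ a}
  have hO : IsOpen O := isOpen_ne_fun (by fun_prop) (by fun_prop)
  have hn0 (x : O) : n x.1 ≠ 0 := fun h0 => x.2 (by
    simp [h0, NeZero.ne a, NeZero.ne b])
  have hn0' (x : O) : (n x.1 : ℂ) ≠ 0 := ofReal_ne_zero.mpr (hn0 x)
  have := hO.locallyPathConnectedSpace
  let r : O → Ext a b := fun x => ⟨(x.1.1 / n x.1, x.1.2 / n x.1), by
    have hsq : n x.1 ^ 2 = (‖x.1.1‖ ^ 2 + ‖x.1.2‖ ^ 2) / 2 := Real.sq_sqrt (by positivity)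
    simp only [norm_div, norm_real, Real.norm_eq_abs, div_pow, sq_abs]
    rw [← add_div, div_eq_iff (pow_ne_zero 2 (hn0 x)), hsq]
    ring, fun h => x.2 (by
      have := hn0' x
      simp only [div_pow] at h
      field_simp at h
      rw [h, mul_comm])⟩
  have hr : Continuous r := by
    refine Continuous.subtype_mk (Continuous.prodMk ?_ ?_) _ <;>
    exact Continuous.div (by fun_prop) (by fun_prop) hn0'
  let i : Ext a b → O := fun x => ⟨x.1, by
    have : n x.1 = 1 := by simp [n, x.2.1]
    simpa [O, this] using x.2.2⟩
  have hi : Continuous i := by fun_prop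
  have hri : r ∘ i = id := by
    funext x
    have : n x.1 = 1 := by simp [n, x.2.1]
    refine Subtype.ext (Prod.ext ?_ ?_) <;> simp [r, i, this]
  have : Topology.IsQuotientMap r :=
    Topology.IsQuotientMap.of_comp hi hr (hri ▸ Topology.IsQuotientMap.id)
  exact this.locallyPathConnectedSpace

end Exterior

/-! ### Existence of the tower and the order of the torsion. -/

section Towers

variable {X X' : Type} [TopologicalSpace X] [TopologicalSpace X']

/-- Transport of a cyclic cover along a homeomorphism of the bases. -/
def mapCyclicCover {m : ℕ} (h : X ≃ₜ X') (C : CyclicCover m X) : CyclicCover m X' where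
  space := C.space
  proj := h ∘ C.proj
  isCoveringMap := C.isCoveringMap.homeomorph_comp h
  surjective := h.surjective.comp C.surjective
  continuous_vadd := C.continuous_vadd
  proj_eq_iff x y := h.injective.eq_iff.trans (C.proj_eq_iff x y)
  free := C.free

/-- Transport of a `ℤ_p`-cover along a homeomorphism of the bases. -/
def mapZpCover {p : ℕ} (h : X ≃ₜ X') (C : ZpCover p X) : ZpCover p X' where
  layer n := mapCyclicCover h (C.layer n)
  trans := C.trans
  continuous_trans := C.continuous_trans
  proj_trans n x := congrArg h (C.proj_trans n x)
  trans_vadd := C.trans_vadd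

variable {a b : ℕ} [NeZero a] [NeZero b]

/-- The cyclic cover of `m`-th roots of the defining equation. -/
def rootCyclicCover (hab : a.Coprime b) (m : ℕ) [NeZero m] (hm : m.Coprime b) :
    CyclicCover m (Ext a b) where
  space := RootCover a b m
  connectedSpace :=
    have := RootCover.pathConnectedSpace hab hm
    inferInstance
  proj y := y.1.1
  isCoveringMap := RootCover.isQuotientCoveringMap.isCoveringMap
  surjective := RootCover.surjective
  continuous_vadd := RootCover.continuous_vadd
  proj_eq_iff := RootCover.fst_eq_iff
  free := RootCover.free

/-- This makes the transition map `u ↦ u ^ p` equivariant along reduction. -/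
lemma stdAddChar_pow_castHom (p n : ℕ) [NeZero p] (g : ZMod (p ^ (n + 1))) :
    (ZMod.stdAddChar g : ℂ) ^ p =
      ZMod.stdAddChar (ZMod.castHom (pow_dvd_pow p n.le_succ) (ZMod (p ^ n)) g) := by
  obtain ⟨j, rfl⟩ := ZMod.intCast_surjective g
  have hp : (p : ℂ) ≠ 0 := NeZero.ne _
  rw [map_intCast (ZMod.castHom (pow_dvd_pow p n.le_succ) (ZMod (p ^ n))), ZMod.stdAddChar_coe,
      ZMod.stdAddChar_coe, ← exp_nat_mul]
  congr 1
  push_cast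
  field_simp
  ring

/-- The `ℤ_p`-cover of roots of the defining equation. -/
def rootZpCover (hab : a.Coprime b) (p : ℕ) [NeZero p] (hp : p.Coprime b) :
    ZpCover p (Ext a b) where
  layer n := rootCyclicCover hab (p ^ n) (hp.pow_left n)
  trans n y := ⟨(y.1.1, y.1.2 ^ p), by rw [← pow_mul, ← pow_succ', y.2]⟩
  continuous_trans n := by
    refine Continuous.subtype_mk (f := fun y : RootCover a b (p ^ (n + 1)) => (y.1.1, y.1.2 ^ p)) ?_
        _
    fun_prop
  proj_trans _ _ := rfl
  trans_vadd n g y := by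
    refine Subtype.ext (Prod.ext rfl ?_)
    change (y.1.2 * ZMod.stdAddChar g) ^ p = y.1.2 ^ p * ZMod.stdAddChar _
    rw [mul_pow, stdAddChar_pow_castHom]

theorem cardTorsionH₁_cyclicCover (hab : a.Coprime b) {p : ℕ} (hp : p.Prime) (hpb : ¬ p ∣ b)
    {r a' : ℕ} (ha : a = p ^ r * a') (ha' : ¬ p ∣ a') (n : ℕ) (C : CyclicCover (p ^ n) (Ext a b)) :
    cardTorsionH₁ C.space = b ^ (p ^ min n r - 1) := by
  have := locallyPathConnectedSpace_ext (a := a) (b := b)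
  obtain ⟨φ, hφ, hC⟩ := exists_hom_card_torsion C (basePt a b)
  have hgen := closure_genX_genY a b hab
  have hrel := genX_pow a b
  have hpb' : p.Coprime b := (Nat.Prime.coprime_iff_not_dvd hp).mpr hpb
  rw [hC, ker_eq_divKer hgen hrel _ (winding_genX a b) (winding_genY a b) hp hpb n φ hφ]
  have hpos : 0 < p ^ min n r := pow_pos hp.pos _
  have : NeZero (p ^ min n r) := ⟨hpos.ne'⟩
  have hNc : p ^ min n r * (p ^ (r - min n r) * a') = a := by
    rw [← mul_assoc, ← pow_add, Nat.add_sub_cancel' (min_le_right n r), ha]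
  have hgcd : a.gcd (p ^ n) = p ^ min n r := by
    have hc : a'.Coprime (p ^ n) :=
      ((Nat.Prime.coprime_iff_not_dvd hp).mpr ha').symm.pow_right n
    rw [ha, hc.gcd_mul_right_cancel]
    rcases le_total n r with h | h
    · rw [min_eq_left h, Nat.gcd_eq_right (pow_dvd_pow p h)]
    · rw [min_eq_right h, Nat.gcd_eq_left (pow_dvd_pow p h)]
  obtain ⟨c, hcx, hcy⟩ := exists_twistHom (b := b) hNc (hpb'.pow_left _)
  exact card_torsion_abelianization_divKer hgen hrel (NeZero.ne b) hab _ (winding_genX a b)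
    (winding_genY a b) (pow_pos hp.pos n).ne' (hpb'.pow_left n) hgcd
    (Nat.sub_add_cancel hpos).symm c _ _
    -- Here `β` is `N * c = a` modulo `b`, a unit by coprimality.
    (by rw [hNc]; exact (ZMod.isUnit_iff_coprime a b).mpr hab) hcx hcy

end Towers

end TorusExterior

end

/-! ### The theorem for integers of either sign. -/

theorem mainTheorem6 (p : ℕ) [Fact p.Prime] (a b : ℤ) (hab : IsCoprime a b)
    (hb : ¬ (p : ℤ) ∣ b) (r : ℕ) (a' : ℤ) (ha : a = (p : ℤ) ^ r * a') (ha' : ¬ (p : ℤ) ∣ a') :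
    Nonempty (ZpCover p (TorusKnotExterior a b)) ∧
    ∀ C : ZpCover p (TorusKnotExterior a b),
      (∀ n : ℕ, cardTorsionH₁ (C.layer n).space = b.natAbs ^ (p ^ min n r - 1)) ∧
      Filter.Tendsto (fun n : ℕ => (cardTorsionH₁ (C.layer n).space : ℤ_[p])) Filter.atTop
        (𝓝 ((b.natAbs : ℤ_[p]) ^ (p ^ r - 1))) := by
  have hp : p.Prime := Fact.out
  have ha0 : a' ≠ 0 := fun h => ha' (h ▸ dvd_zero _)
  have hb0 : b ≠ 0 := fun h => hb (h ▸ dvd_zero _)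
  have : NeZero p := ⟨hp.ne_zero⟩
  have : NeZero b.natAbs := ⟨Int.natAbs_ne_zero.mpr hb0⟩
  have : NeZero a.natAbs := ⟨Int.natAbs_ne_zero.mpr
    (ha ▸ mul_ne_zero (pow_ne_zero r (Int.natCast_ne_zero.mpr hp.ne_zero)) ha0)⟩
  have hab' : a.natAbs.Coprime b.natAbs := Int.isCoprime_iff_gcd_eq_one.mp hab
  have hpb : ¬ p ∣ b.natAbs := fun h => hb (Int.natCast_dvd.mpr h)
  have hpa : ¬ p ∣ a'.natAbs := fun h => ha' (Int.natCast_dvd.mpr h)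
  have haa : a.natAbs = p ^ r * a'.natAbs := by
    rw [ha, Int.natAbs_mul, Int.natAbs_pow, Int.natAbs_natCast]
  let e := TorusExterior.exteriorHomeomorph hab'
  refine ⟨⟨TorusExterior.mapZpCover e.symm (TorusExterior.rootZpCover hab' p
    ((Nat.Prime.coprime_iff_not_dvd hp).mpr hpb))⟩, fun C => ?_⟩
  have hcard (n : ℕ) : cardTorsionH₁ (C.layer n).space = b.natAbs ^ (p ^ min n r - 1) :=
    TorusExterior.cardTorsionH₁_cyclicCover hab' hp hpb haa hpa n
      (TorusExterior.mapCyclicCover e (C.layer n))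
  -- The sequence is constant once `n ≥ r`, so it converges `p`-adically.
  refine ⟨hcard, tendsto_const_nhds.congr' ?_⟩
  filter_upwards [Filter.eventually_ge_atTop r] with n hn
  rw [hcard, min_eq_right hn, Nat.cast_pow]
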